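/- **Setting.** Let $\Gamma=[0,1]^2$, $T>0$, and let $P:[0,\infty)\to(0,\infty)$ satisfy: (A1) there are constants $p_0,p_1,z_0>0$ with $P(z)\ge p_0$ for all $z\ge 0$ and $P(z)\le p_1$ for $0\le z\le z_0$; (A2) $P$ is continuously differentiable with $0\le P'(z)\le L$ for $z\ge 0$. Let $u:\Gamma\times[0,T]\to\mathbb R$ be a classical solution of $$\partial_t^2u+P\Big(\int_\Gamma|\Delta u|^2\,d\mathbf x\Big)\,\partial_t u+\Delta^2u=f\quad\text{on }\Gamma\times[0,T],$$ $$u(\cdot,0)=u_0,\qquad \partial_tu(\cdot,0)=u_1,\qquad u=\Delta u=0\ \text{ on }\partial\Gamma\times(0,T],$$ and put $v=\Delta u$. Assume that for some constant $Q$, on $\Gamma\times[0,T]$ and for $k=x,y$: (A4) $|\partial_t^4u|\le Q$, $|\partial_t^3\partial_k^2u|\le Q$, $|\partial_k^6u|\le Q$, $|\partial_t\partial_k^4u|\le Q$; (A4$'$) $|\partial_t\partial_k^6u|\le Q$, $|\partial_k^6v|\le Q$. Here each listed derivative is understood to exist classically and to be continuous on $\Gamma\times[0,T]$, together with all the lower-order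 ones. **Scheme.** Let $J_1,J_2,N\ge 1$ be integers, $h_1=\frac1{2J_1}$, $h_2=\frac1{2J_2}$, $h=\max(h_1,h_2)$, $x_i=ih_1$, $y_j=jh_2$, and let $\tau>0$ with $(N+1)\tau\le T$, $t_n=n\tau$. Write $w_{ij}^n=w(x_i,y_j,t_n)$ for $w=u,v,f$. For grid functions put $$\delta_tW^n=\tfrac{W^n-W^{n-1}}{\tau},\quad \delta_t^{(2)}W^n=\delta_t(\delta_tW^{n+1}),\quad \bar\delta_tW^n=\tfrac{W^{n+1}-W^{n-1}}{2\tau},\quad \widetilde W^n=\tfrac{W^{n+1}+W^{n-1}}2,$$ $$\delta_x\delta_{\bar x}W_{ij}=\tfrac{W_{i+1,j}-2W_{ij}+W_{i-1,j}}{h_1^2},\qquad \delta_y\delta_{\bar y}W_{ij}=\tfrac{W_{i,j+1}-2W_{ij}+W_{i,j-1}}{h_2^2},$$ $$\mathcal AW_{ij}=\tfrac{W_{i+1,j}+10W_{ij}+W_{i-1,j}}{12}\ (1\le i\le 2J_1-1),\qquad \mathcal AW_{ij}=W_{ij}\ (i=0,2J_1),$$ $$\mathcal BW_{ij}=\tfrac{W_{i,j+1}+10W_{ij}+W_{i,j-1}}{12}\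 (1\le j\le 2J_2-1),\qquad \mathcal BW_{ij}=W_{ij}\ (j=0,2J_2),$$ $$\mathcal H=\mathcal A\mathcal B,\qquad \Phi=\mathcal B\,\delta_x\delta_{\bar x}+\mathcal A\,\delta_y\delta_{\bar y},\qquad \|W\|^2=h_1h_2\sum_{i=1}^{2J_1-1}\sum_{j=1}^{2J_2-1}W_{ij}^2,$$ $$\|W\|_E=\tfrac23\Big(h_1h_2\sum_{i=1}^{J_1}\sum_{j=1}^{J_2}\big(W_{2i-2,2j-1}^2+W_{2i-1,2j-2}^2+3W_{2i-1,2j-1}^2\big)\Big)^{1/2},\qquad \|W\|_F^2=\tfrac49\|W\|^2+\|W\|_E^2 .$$ (For $W$ vanishing on the boundary of the grid, $\|W\|_F^2$ is the composite two-dimensional Simpson rule for $W^2$.) Let $(U,V)$ be a solution of the fully discrete compact scheme: for $1\le i\le 2J_1-1$, $1\le j\le 2J_2-1$ and $1\le n\le N$, $$\mathcal H\delta_t^{(2)}U_{ij}^n+P(\|V^n\|_F^2)\,\mathcal H\bar\delta_tU_{ij}^n+\Phi\widetilde V_{ij}^n=\mathcal Hf_{ij}^n,\qquad \mathcal H\bar\delta_tV_{ij}^n=\Phi\bar\delta_tU_{ij}^n;$$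 $U^n$ and $V^n$ vanish at the boundary grid points for $0\le n\le N+1$; and at the interior grid points $$U^0=u_0,\qquad \delta_tU^1=u_1+\tfrac\tau2u_2,\qquad V^0=\Delta u_0,\qquad V^1=\Delta\big(u_0+\tau u_1+\tfrac{\tau^2}2u_2\big),$$ where $u_2=-P\big(\int_\Gamma|\Delta u_0|^2\big)u_1-\Delta^2u_0+f(\cdot,0)$, which equals $\partial_t^2u(\cdot,0)$. **Theorem 4.2.** There is a constant $\mathcal Q(T)>0$, independent of the discretization parameters $J_1,J_2,N,\tau$, such that for all such $J_1,J_2,N,\tau$ and all such $(U,V)$, $$\sqrt{\|\delta_t(u^{n+1}-U^{n+1})\|^2+\|v^{n+1}-V^{n+1}\|^2+\|v^n-V^n\|^2}\ \le\ \mathcal Q(T)\,(\tau^2+h^4),\qquad 1\le n\le N .$$ -/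

import Mathlib

open Set

namespace PlateScheme

noncomputable section

/-! ### The continuous problem

Functions on the square are `g : ℝ → ℝ → ℝ`, evaluated as `g x y`; space-time functions are
`u : ℝ → ℝ → ℝ → ℝ`, evaluated as `u t x y`. Only the values for `t ∈ [0, T]` and
`x, y ∈ [0, 1]` matter: all derivatives are taken within these intervals, so they are one-sided
at the end points. -/

/-- `∂ₓ g` on the closed unit square. -/
def dX (g : ℝ → ℝ → ℝ) : ℝ → ℝ → ℝ :=
  fun x y => derivWithin (fun s => g s y) (Icc 0 1) x

/-- `∂_y g` on the closed unit square. -/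
def dY (g : ℝ → ℝ → ℝ) : ℝ → ℝ → ℝ :=
  fun x y => derivWithin (fun s => g x s) (Icc 0 1) y

/-- The Laplacian `Δ g = ∂ₓ² g + ∂_y² g`. -/
def lap (g : ℝ → ℝ → ℝ) : ℝ → ℝ → ℝ :=
  fun x y => dX (dX g) x y + dY (dY g) x y

/-- `∂ₜ u` on the time interval `[0, T]`. -/
def dT (T : ℝ) (u : ℝ → ℝ → ℝ → ℝ) : ℝ → ℝ → ℝ → ℝ :=
  fun t x y => derivWithin (fun s => u s x y) (Icc 0 T) t

/-- The closed space-time cylinder `[0, T] × [0, 1]²`. -/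
def cylinder (T : ℝ) : Set (ℝ × ℝ × ℝ) :=
  Icc 0 T ×ˢ Icc 0 1 ×ˢ Icc 0 1

/-- The partial derivative `∂ₜᵃ ∂ₓᵇ ∂_yᶜ u`. -/
def partialDeriv (T : ℝ) (a b c : ℕ) (u : ℝ → ℝ → ℝ → ℝ) : ℝ → ℝ → ℝ → ℝ :=
  (dT T)^[a] (fun t => dX^[b] (dY^[c] (u t)))

/-- The partial derivative `∂ₜᵃ ∂ₓᵇ ∂_yᶜ u` exists (in the classical sense, together with all the
lower ones, so that no value of `derivWithin` is a junk value), all these derivatives are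
continuous on the closed cylinder, and `|∂ₜᵃ ∂ₓᵇ ∂_yᶜ u| ≤ Q` there. -/
structure PartialBound (T Q : ℝ) (a b c : ℕ) (u : ℝ → ℝ → ℝ → ℝ) : Prop where
  diff_y : ∀ c' < c, ∀ t ∈ Icc 0 T, ∀ x ∈ Icc (0 : ℝ) 1, ∀ y ∈ Icc (0 : ℝ) 1,
    DifferentiableWithinAt ℝ (fun s => partialDeriv T 0 0 c' u t x s) (Icc 0 1) y
  diff_x : ∀ b' < b, ∀ c' ≤ c, ∀ t ∈ Icc 0 T, ∀ x ∈ Icc (0 : ℝ) 1, ∀ y ∈ Icc (0 : ℝ) 1,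
    DifferentiableWithinAt ℝ (fun s => partialDeriv T 0 b' c' u t s y) (Icc 0 1) x
  diff_t : ∀ a' < a, ∀ b' ≤ b, ∀ c' ≤ c,
    ∀ t ∈ Icc 0 T, ∀ x ∈ Icc (0 : ℝ) 1, ∀ y ∈ Icc (0 : ℝ) 1,
    DifferentiableWithinAt ℝ (fun s => partialDeriv T a' b' c' u s x y) (Icc 0 T) t
  cont : ∀ a' ≤ a, ∀ b' ≤ b, ∀ c' ≤ c,
    ContinuousOn (fun p : ℝ × ℝ × ℝ => partialDeriv T a' b' c' u p.1 p.2.1 p.2.2) (cylinder T)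
  bound : ∀ t ∈ Icc 0 T, ∀ x ∈ Icc (0 : ℝ) 1, ∀ y ∈ Icc (0 : ℝ) 1,
    |partialDeriv T a b c u t x y| ≤ Q

/-- `∫_Γ |g|²` over the unit square. -/
def sqIntegral (g : ℝ → ℝ → ℝ) : ℝ :=
  ∫ p in (Icc (0 : ℝ) 1 ×ˢ Icc (0 : ℝ) 1 : Set (ℝ × ℝ)), |g p.1 p.2| ^ 2

/-- `(x, y)` lies on the boundary of the unit square. -/
def OnBoundary (x y : ℝ) : Prop :=
  (x ∈ Icc (0 : ℝ) 1 ∧ y ∈ Icc (0 : ℝ) 1) ∧ (x = 0 ∨ x = 1 ∨ y = 0 ∨ y = 1)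

/-- `u` is a solution of the hinged plate problem
`∂ₜ² u + P(∫_Γ |Δu|²) ∂ₜ u + Δ² u = f`, `u(0) = u₀`, `∂ₜ u(0) = u₁`, `u = Δu = 0` on `∂Γ`. -/
structure IsPlateSolution (P : ℝ → ℝ) (T : ℝ) (f : ℝ → ℝ → ℝ → ℝ) (u₀ u₁ : ℝ → ℝ → ℝ)
    (u : ℝ → ℝ → ℝ → ℝ) : Prop where
  equation : ∀ t ∈ Icc 0 T, ∀ x ∈ Icc (0 : ℝ) 1, ∀ y ∈ Icc (0 : ℝ) 1,
    dT T (dT T u) t x y + P (sqIntegral (lap (u t))) * dT T u t x y + lap (lap (u t)) x y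
      = f t x y
  init : ∀ x ∈ Icc (0 : ℝ) 1, ∀ y ∈ Icc (0 : ℝ) 1, u 0 x y = u₀ x y
  init_deriv : ∀ x ∈ Icc (0 : ℝ) 1, ∀ y ∈ Icc (0 : ℝ) 1, dT T u 0 x y = u₁ x y
  hinged : ∀ t ∈ Ioc 0 T, ∀ x y : ℝ, OnBoundary x y → u t x y = 0 ∧ lap (u t) x y = 0

/-- Bounds on `P`: `P ≤ p₁` on `[0, z₀]` and `P ≥ p₀` on `[0, ∞)`, with `p₀, p₁ > 0`. -/
def DampingBounds (P : ℝ → ℝ) (p₀ p₁ z₀ : ℝ) : Prop :=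
  0 < p₀ ∧ 0 < p₁ ∧ 0 < z₀ ∧ (∀ z, 0 ≤ z → z ≤ z₀ → P z ≤ p₁) ∧ (∀ z, 0 ≤ z → p₀ ≤ P z)

/-- `P` is continuously differentiable on `[0, ∞)` with `0 ≤ P' ≤ L`. -/
def DampingSlope (P : ℝ → ℝ) (L : ℝ) : Prop :=
  ContDiffOn ℝ 1 P (Ici 0) ∧
    ∀ z, 0 ≤ z → 0 ≤ derivWithin P (Ici 0) z ∧ derivWithin P (Ici 0) z ≤ L

/-- Bounds by `Q` for `∂ₜ⁴u`, `∂ₜ³∂ₖ²u`, `∂ₖ⁶u`, `∂ₜ∂ₖ⁴u`, `k = x, y`. -/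
structure SolutionBounds (T Q : ℝ) (u : ℝ → ℝ → ℝ → ℝ) : Prop where
  tttt : PartialBound T Q 4 0 0 u
  ttt_xx : PartialBound T Q 3 2 0 u
  ttt_yy : PartialBound T Q 3 0 2 u
  x6 : PartialBound T Q 0 6 0 u
  y6 : PartialBound T Q 0 0 6 u
  t_x4 : PartialBound T Q 1 4 0 u
  t_y4 : PartialBound T Q 1 0 4 u

/-- Bounds by `Q` for `∂ₜ∂ₖ⁶u` and `∂ₖ⁶v`, where `v = Δu` and `k = x, y`. -/
structure CompactBounds (T Q : ℝ) (u : ℝ → ℝ → ℝ → ℝ) : Prop where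
  t_x6 : PartialBound T Q 1 6 0 u
  t_y6 : PartialBound T Q 1 0 6 u
  lap_x6 : PartialBound T Q 0 6 0 (fun t => lap (u t))
  lap_y6 : PartialBound T Q 0 0 6 (fun t => lap (u t))

/-! ### Grid functions

A grid function is `w : ℕ → ℕ → ℝ`, `w i j` being the value at `(i h₁, j h₂)`, with
`0 ≤ i ≤ 2 J₁`, `0 ≤ j ≤ 2 J₂`, `h₁ = 1 / (2 J₁)`, `h₂ = 1 / (2 J₂)`. -/

/-- The step size `1 / (2 J)`. -/
def step (J : ℕ) : ℝ := 1 / (2 * (J : ℝ))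

/-- The restriction of a function on the square to the grid. -/
def onGrid (J₁ J₂ : ℕ) (g : ℝ → ℝ → ℝ) : ℕ → ℕ → ℝ :=
  fun i j => g (i * step J₁) (j * step J₂)

/-- Forward difference quotient `δₓ`. -/
def fwdX (J₁ : ℕ) (w : ℕ → ℕ → ℝ) : ℕ → ℕ → ℝ :=
  fun i j => (w (i + 1) j - w i j) / step J₁

/-- Backward difference quotient `δ_x̄` (used for `i ≥ 1`). -/
def bwdX (J₁ : ℕ) (w : ℕ → ℕ → ℝ) : ℕ → ℕ → ℝ :=
  fun i j => (w i j - w (i - 1) j) / step J₁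

/-- `δₓ δ_x̄` (used for `1 ≤ i ≤ 2 J₁ - 1`). -/
def secX (J₁ : ℕ) (w : ℕ → ℕ → ℝ) : ℕ → ℕ → ℝ :=
  fun i j => (fwdX J₁ w i j - bwdX J₁ w i j) / step J₁

/-- Forward difference quotient `δ_y`. -/
def fwdY (J₂ : ℕ) (w : ℕ → ℕ → ℝ) : ℕ → ℕ → ℝ :=
  fun i j => (w i (j + 1) - w i j) / step J₂

/-- Backward difference quotient `δ_ȳ` (used for `j ≥ 1`). -/
def bwdY (J₂ : ℕ) (w : ℕ → ℕ → ℝ) : ℕ → ℕ → ℝ :=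
  fun i j => (w i j - w i (j - 1)) / step J₂

/-- `δ_y δ_ȳ` (used for `1 ≤ j ≤ 2 J₂ - 1`). -/
def secY (J₂ : ℕ) (w : ℕ → ℕ → ℝ) : ℕ → ℕ → ℝ :=
  fun i j => (fwdY J₂ w i j - bwdY J₂ w i j) / step J₂

/-- The averaging operator `𝓐` in `x`. -/
def opA (J₁ : ℕ) (w : ℕ → ℕ → ℝ) : ℕ → ℕ → ℝ :=
  fun i j => if 1 ≤ i ∧ i + 1 ≤ 2 * J₁ then (w (i + 1) j + 10 * w i j + w (i - 1) j) / 12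
    else w i j

/-- The averaging operator `𝓑` in `y`. -/
def opB (J₂ : ℕ) (w : ℕ → ℕ → ℝ) : ℕ → ℕ → ℝ :=
  fun i j => if 1 ≤ j ∧ j + 1 ≤ 2 * J₂ then (w i (j + 1) + 10 * w i j + w i (j - 1)) / 12
    else w i j

/-- `𝓗 = 𝓐 𝓑`. -/
def opH (J₁ J₂ : ℕ) (w : ℕ → ℕ → ℝ) : ℕ → ℕ → ℝ := opA J₁ (opB J₂ w)

/-- `Φ = 𝓑 δₓ δ_x̄ + 𝓐 δ_y δ_ȳ`. -/
def opPhi (J₁ J₂ : ℕ) (w : ℕ → ℕ → ℝ) : ℕ → ℕ → ℝ :=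
  fun i j => opB J₂ (secX J₁ w) i j + opA J₁ (secY J₂ w) i j

/-- The discrete inner product over the interior grid points. -/
def gridInner (J₁ J₂ : ℕ) (w z : ℕ → ℕ → ℝ) : ℝ :=
  step J₁ * step J₂ *
    ∑ i ∈ Finset.Icc 1 (2 * J₁ - 1), ∑ j ∈ Finset.Icc 1 (2 * J₂ - 1), w i j * z i j

/-- The discrete `L²` norm. -/
def gridNorm (J₁ J₂ : ℕ) (w : ℕ → ℕ → ℝ) : ℝ := √(gridInner J₁ J₂ w w)

/-- The norm `‖·‖_E`. -/
def normE (J₁ J₂ : ℕ) (w : ℕ → ℕ → ℝ) : ℝ :=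
  2 / 3 * √(step J₁ * step J₂ *
    ∑ i ∈ Finset.Icc 1 J₁, ∑ j ∈ Finset.Icc 1 J₂,
      (w (2 * i - 2) (2 * j - 1) ^ 2 + w (2 * i - 1) (2 * j - 2) ^ 2
        + 3 * w (2 * i - 1) (2 * j - 1) ^ 2))

/-- The norm `‖·‖_F`; its square is the composite two-dimensional Simpson rule for `w²` when `w`
vanishes on the boundary. -/
def normF (J₁ J₂ : ℕ) (w : ℕ → ℕ → ℝ) : ℝ :=
  √(4 / 9 * gridNorm J₁ J₂ w ^ 2 + normE J₁ J₂ w ^ 2)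

/-! ### Time differences

A sequence of grid functions is `W : ℕ → ℕ → ℕ → ℝ`, `W n i j` being the value at time `n τ`. -/

/-- `δₜ Wⁿ = (Wⁿ - Wⁿ⁻¹) / τ` (used for `n ≥ 1`). -/
def dt (τ : ℝ) (W : ℕ → ℕ → ℕ → ℝ) (n : ℕ) : ℕ → ℕ → ℝ :=
  fun i j => (W n i j - W (n - 1) i j) / τ

/-- `δₜ⁽²⁾ Wⁿ = δₜ (δₜ Wⁿ⁺¹)`. -/
def dt2 (τ : ℝ) (W : ℕ → ℕ → ℕ → ℝ) (n : ℕ) : ℕ → ℕ → ℝ :=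
  dt τ (dt τ W) (n + 1)

/-- `(Wⁿ⁺¹ - Wⁿ⁻¹) / (2 τ)` (used for `n ≥ 1`). -/
def dtBar (τ : ℝ) (W : ℕ → ℕ → ℕ → ℝ) (n : ℕ) : ℕ → ℕ → ℝ :=
  fun i j => (W (n + 1) i j - W (n - 1) i j) / (2 * τ)

/-- `(Wⁿ⁺¹ + Wⁿ⁻¹) / 2` (used for `n ≥ 1`). -/
def avg (W : ℕ → ℕ → ℕ → ℝ) (n : ℕ) : ℕ → ℕ → ℝ :=
  fun i j => (W (n + 1) i j + W (n - 1) i j) / 2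

/-- The values of a space-time function at the grid points, at the times `n τ`. -/
def sample (J₁ J₂ : ℕ) (τ : ℝ) (w : ℝ → ℝ → ℝ → ℝ) : ℕ → ℕ → ℕ → ℝ :=
  fun n => onGrid J₁ J₂ (w (n * τ))

/-! ### The fully discrete scheme -/

/-- The value of `∂ₜ² u` at `t = 0` read off from the data:
`u₂ = f(0) - P(∫_Γ |Δu₀|²) u₁ - Δ² u₀`. -/
def secondInit (P : ℝ → ℝ) (f : ℝ → ℝ → ℝ → ℝ) (u₀ u₁ : ℝ → ℝ → ℝ) : ℝ → ℝ → ℝ :=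
  fun x y => -P (sqIntegral (lap u₀)) * u₁ x y - lap (lap u₀) x y + f 0 x y

/-- The starting function `u₀ + τ u₁ + (τ² / 2) u₂`, whose grid values are `U¹`. -/
def firstStep (P : ℝ → ℝ) (f : ℝ → ℝ → ℝ → ℝ) (u₀ u₁ : ℝ → ℝ → ℝ) (τ : ℝ) : ℝ → ℝ → ℝ :=
  fun x y => u₀ x y + τ * u₁ x y + τ ^ 2 / 2 * secondInit P f u₀ u₁ x y

/-- `(U, V)` solves the fully discrete compact difference scheme with parameters
`J₁, J₂, N, τ`. -/
structure IsSchemeSolution (P : ℝ → ℝ) (f : ℝ → ℝ → ℝ → ℝ) (u₀ u₁ : ℝ → ℝ → ℝ)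
    (J₁ J₂ N : ℕ) (τ : ℝ) (U V : ℕ → ℕ → ℕ → ℝ) : Prop where
  eqU : ∀ n ∈ Finset.Icc 1 N, ∀ i ∈ Finset.Icc 1 (2 * J₁ - 1), ∀ j ∈ Finset.Icc 1 (2 * J₂ - 1),
    opH J₁ J₂ (dt2 τ U n) i j + P (normF J₁ J₂ (V n) ^ 2) * opH J₁ J₂ (dtBar τ U n) i j
      + opPhi J₁ J₂ (avg V n) i j = opH J₁ J₂ (sample J₁ J₂ τ f n) i j
  eqV : ∀ n ∈ Finset.Icc 1 N, ∀ i ∈ Finset.Icc 1 (2 * J₁ - 1), ∀ j ∈ Finset.Icc 1 (2 * J₂ - 1),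
    opH J₁ J₂ (dtBar τ V n) i j = opPhi J₁ J₂ (dtBar τ U n) i j
  bdry_x : ∀ n ≤ N + 1, ∀ j ≤ 2 * J₂,
    U n 0 j = 0 ∧ U n (2 * J₁) j = 0 ∧ V n 0 j = 0 ∧ V n (2 * J₁) j = 0
  bdry_y : ∀ n ≤ N + 1, ∀ i ≤ 2 * J₁,
    U n i 0 = 0 ∧ U n i (2 * J₂) = 0 ∧ V n i 0 = 0 ∧ V n i (2 * J₂) = 0
  initU0 : ∀ i ∈ Finset.Icc 1 (2 * J₁ - 1), ∀ j ∈ Finset.Icc 1 (2 * J₂ - 1),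
    U 0 i j = onGrid J₁ J₂ u₀ i j
  initU1 : ∀ i ∈ Finset.Icc 1 (2 * J₁ - 1), ∀ j ∈ Finset.Icc 1 (2 * J₂ - 1),
    dt τ U 1 i j = onGrid J₁ J₂ u₁ i j + τ / 2 * onGrid J₁ J₂ (secondInit P f u₀ u₁) i j
  initV0 : ∀ i ∈ Finset.Icc 1 (2 * J₁ - 1), ∀ j ∈ Finset.Icc 1 (2 * J₂ - 1),
    V 0 i j = onGrid J₁ J₂ (lap u₀) i j
  initV1 : ∀ i ∈ Finset.Icc 1 (2 * J₁ - 1), ∀ j ∈ Finset.Icc 1 (2 * J₂ - 1),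
    V 1 i j = onGrid J₁ J₂ (lap (firstStep P f u₀ u₁ τ)) i j

end

end PlateScheme

/-!
**Idea.** Put `e = u - U` and `η = v - V`. Testing the first error equation with `δ̄ₜe` and the
second with the average `η̃` makes the terms in `Φ` cancel, since `Φ` is symmetric, and bounds the
growth of `‖δₜe‖² + (‖ηⁿ⁺¹‖² + ‖ηⁿ‖²) / 2` in the norm of the form `(w, z) ↦ ⟨𝓗 w, z⟩`, which is
equivalent to `‖·‖`; the damping only has to be nonnegative. The truncation error of `Φ ṽ` would
involve two more space derivatives of `∂ₜ²v` than are available. It is therefore measured with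
`Φ vⁿ`, and the shift `Gⁿ = ṽⁿ - vⁿ` is subtracted from `η` in the energy: `Gⁿ = O(τ²)` and
`Gⁿ⁺¹ - Gⁿ = O(τ³)`, so the shift costs no order.

The same stability estimate, applied to the scheme itself, bounds `‖Vⁿ‖`. As `‖·‖_F²` is Simpson's
rule, of order four, and `P` is Lipschitz, this gives
`|P(∫_Γ |vⁿ|²) - P(‖Vⁿ‖_F²)| ≤ K (τ² + h⁴ + ‖ηⁿ‖)`, and the discrete Gronwall lemma finishes.
-/

namespace PlateScheme

noncomputable section

/-! ### Energy estimates for positive semidefinite forms -/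

section Form

variable {X : Type*} [AddCommGroup X] [Module ℝ X] {H Φ : LinearMap.BilinForm ℝ X}

/-- The seminorm `√(H x x)` of a positive semidefinite form `H`. -/
def formNorm (H : LinearMap.BilinForm ℝ X) (x : X) : ℝ := √(H x x)

theorem formNorm_nonneg (x : X) : 0 ≤ formNorm H x := Real.sqrt_nonneg _

theorem formNorm_sq (hH : H.IsPosSemidef) (x : X) : formNorm H x ^ 2 = H x x :=
  Real.sq_sqrt (hH.nonneg x)

theorem apply_le_formNorm_mul (hH : H.IsPosSemidef) (x y : X) :
    H x y ≤ formNorm H x * formNorm H y := by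
  refine le_of_abs_le (abs_le_of_sq_le_sq ?_ (mul_nonneg (formNorm_nonneg _) (formNorm_nonneg _)))
  rw [mul_pow, formNorm_sq hH, formNorm_sq hH]
  exact H.apply_sq_le_of_symm hH.nonneg (LinearMap.BilinForm.isSymm_iff.1 hH.isSymm) x y

theorem formNorm_add_le (hH : H.IsPosSemidef) (x y : X) :
    formNorm H (x + y) ≤ formNorm H x + formNorm H y := by
  refine Real.sqrt_le_iff.2 ⟨add_nonneg (formNorm_nonneg _) (formNorm_nonneg _), ?_⟩
  have hxy := apply_le_formNorm_mul hH x y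
  have hsymm := hH.isSymm.eq x y
  simp only [map_add, LinearMap.add_apply] at hsymm ⊢
  linarith [formNorm_sq hH x, formNorm_sq hH y]

/-- The form `H e e + (H a a + H b b) / 2` on triples `(e, a, b)`: in the energy method `e` is a
discrete velocity and `a`, `b` are two consecutive values of the second unknown. -/
def energyForm (H : LinearMap.BilinForm ℝ X) : LinearMap.BilinForm ℝ (X × X × X) :=
  let fst := LinearMap.fst ℝ X (X × X)
  let mid := LinearMap.fst ℝ X X ∘ₗ LinearMap.snd ℝ X (X × X)
  let last := LinearMap.snd ℝ X X ∘ₗ LinearMap.snd ℝ X (X × X)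
  H.comp fst fst + (1 / 2 : ℝ) • (H.comp mid mid + H.comp last last)

theorem energyForm_apply (x y : X × X × X) :
    energyForm H x y = H x.1 y.1 + 1 / 2 * (H x.2.1 y.2.1 + H x.2.2 y.2.2) := rfl

theorem isPosSemidef_energyForm (hH : H.IsPosSemidef) : (energyForm H).IsPosSemidef where
  eq x y := by simp only [energyForm_apply, hH.isSymm.eq x.1, hH.isSymm.eq x.2.1,
    hH.isSymm.eq x.2.2]
  nonneg x := by
    have := hH.nonneg x.1
    have := hH.nonneg x.2.1
    have := hH.nonneg x.2.2
    rw [energyForm_apply]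
    positivity

theorem formNorm_fst_le_energy (hH : H.IsPosSemidef) (e a b : X) :
    formNorm H e ≤ formNorm (energyForm H) (e, a, b) := by
  refine Real.sqrt_le_sqrt ?_
  rw [energyForm_apply]
  linarith [hH.nonneg a, hH.nonneg b]

theorem formNorm_mid_le_energy (hH : H.IsPosSemidef) (e a b : X) :
    formNorm H a ≤ 3 / 2 * formNorm (energyForm H) (e, a, b) := by
  have hE := formNorm_nonneg (H := energyForm H) (e, a, b)
  refine Real.sqrt_le_iff.2 ⟨by positivity, ?_⟩
  rw [mul_pow, formNorm_sq (isPosSemidef_energyForm hH), energyForm_apply]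
  linarith [hH.nonneg e, hH.nonneg a, hH.nonneg b]

theorem formNorm_last_le_energy (hH : H.IsPosSemidef) (e a b : X) :
    formNorm H b ≤ 3 / 2 * formNorm (energyForm H) (e, a, b) := by
  have hE := formNorm_nonneg (H := energyForm H) (e, a, b)
  refine Real.sqrt_le_iff.2 ⟨by positivity, ?_⟩
  rw [mul_pow, formNorm_sq (isPosSemidef_energyForm hH), energyForm_apply]
  linarith [hH.nonneg e, hH.nonneg a, hH.nonneg b]

theorem le_add_of_sq_sub_sq_le {x y c : ℝ} (hy : 0 ≤ y) (hc : 0 ≤ c)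
    (h : x ^ 2 - y ^ 2 ≤ c * (x + y)) : x ≤ y + c := by
  by_contra! hlt
  nlinarith

variable {τ p : ℝ} {e₀ e₁ a b c : X} {g s : Module.Dual ℝ X}

/-- Testing the first equation with `e₁ + e₀` and the second with `a + b` makes the two terms in
`Φ` cancel; `c` enters the energies at both times and drops out of their difference. -/
theorem energyForm_sub_le (hH : H.IsPosSemidef) (hΦ : Φ.IsSymm) (hp : 0 ≤ p)
    (hU : τ⁻¹ • H (e₁ - e₀) + (p / 2) • H (e₁ + e₀) + (1 / 2 : ℝ) • Φ (a + b) = g)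
    (hV : (2 * τ)⁻¹ • H (a - b) = (1 / 2 : ℝ) • Φ (e₁ + e₀) + s) :
    τ⁻¹ * (energyForm H (e₁, a, c) (e₁, a, c) - energyForm H (e₀, c, b) (e₀, c, b))
      ≤ g (e₁ + e₀) + s (a + b) := by
  have hU' := LinearMap.congr_fun hU (e₁ + e₀)
  have hV' := LinearMap.congr_fun hV (a + b)
  have hdamp : 0 ≤ p / 2 * H (e₁ + e₀) (e₁ + e₀) := mul_nonneg (by positivity) (hH.nonneg _)
  have hcross := hΦ.eq (a + b) (e₁ + e₀)
  have he := hH.isSymm.eq e₁ e₀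
  have hab := hH.isSymm.eq a b
  simp only [LinearMap.add_apply, LinearMap.smul_apply, smul_eq_mul, mul_inv] at hU' hV'
  rw [hcross] at hU'
  have hsqe : H (e₁ - e₀) (e₁ + e₀) = H e₁ e₁ - H e₀ e₀ := by
    simp only [map_sub, map_add, LinearMap.sub_apply]; linarith
  have hsqa : H (a - b) (a + b) = H a a - H b b := by
    simp only [map_sub, map_add, LinearMap.sub_apply]; linarith
  rw [hsqe] at hU'
  rw [hsqa] at hV'
  simp only [energyForm_apply]
  linarith

theorem energy_le_add (hH : H.IsPosSemidef) (hΦ : Φ.IsSymm) (hτ : 0 < τ) (hp : 0 ≤ p)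
    (hU : τ⁻¹ • H (e₁ - e₀) + (p / 2) • H (e₁ + e₀) + (1 / 2 : ℝ) • Φ (a + b) = g)
    (hV : (2 * τ)⁻¹ • H (a - b) = (1 / 2 : ℝ) • Φ (e₁ + e₀) + s)
    {γ σ : ℝ} (hγ : 0 ≤ γ) (hσ : 0 ≤ σ) (hg : ∀ x, g x ≤ γ * formNorm H x)
    (hs : ∀ x, s x ≤ σ * formNorm H x) :
    formNorm (energyForm H) (e₁, a, c)
      ≤ formNorm (energyForm H) (e₀, c, b) + 3 / 2 * τ * (γ + σ) := by
  have hE := isPosSemidef_energyForm hH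
  refine le_add_of_sq_sub_sq_le (formNorm_nonneg _) (by positivity) ?_
  rw [formNorm_sq hE, formNorm_sq hE]
  have h := energyForm_sub_le (c := c) hH hΦ hp hU hV
  rw [inv_mul_le_iff₀ hτ, map_add, map_add] at h
  have hg₁ := (hg e₁).trans (mul_le_mul_of_nonneg_left (formNorm_fst_le_energy hH e₁ a c) hγ)
  have hg₀ := (hg e₀).trans (mul_le_mul_of_nonneg_left (formNorm_fst_le_energy hH e₀ c b) hγ)
  have hsa := (hs a).trans (mul_le_mul_of_nonneg_left (formNorm_mid_le_energy hH e₁ a c) hσ)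
  have hsb := (hs b).trans (mul_le_mul_of_nonneg_left (formNorm_last_le_energy hH e₀ c b) hσ)
  have hsum := add_nonneg (formNorm_nonneg (H := energyForm H) (e₁, a, c))
    (formNorm_nonneg (H := energyForm H) (e₀, c, b))
  refine h.trans ?_
  rw [mul_comm (3 / 2) τ, mul_assoc, mul_assoc]
  refine mul_le_mul_of_nonneg_left ?_ hτ.le
  linarith [mul_nonneg hγ hsum]

end Form

/-! ### Grid functions vanishing on the boundary -/

section Grid

theorem step_pos {J : ℕ} (hJ : 1 ≤ J) : 0 < step J := by
  have : (0 : ℝ) < J := by exact_mod_cast hJ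
  unfold step; positivity

theorem step_nonneg (J : ℕ) : 0 ≤ step J := by unfold step; positivity

theorem step_mul {J : ℕ} (hJ : 1 ≤ J) : ((2 * J : ℕ) : ℝ) * step J = 1 := by
  have : (0 : ℝ) < J := by exact_mod_cast hJ
  unfold step; push_cast; field_simp

/-- `(i, j)` is an interior grid point. -/
def Interior (J₁ J₂ i j : ℕ) : Prop :=
  i ∈ Finset.Icc 1 (2 * J₁ - 1) ∧ j ∈ Finset.Icc 1 (2 * J₂ - 1)

variable {J₁ J₂ : ℕ} {w z : ℕ → ℕ → ℝ}

theorem Interior.bounds {i j : ℕ} (h : Interior J₁ J₂ i j) :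
    (1 ≤ i ∧ i + 1 ≤ 2 * J₁) ∧ 1 ≤ j ∧ j + 1 ≤ 2 * J₂ := by
  obtain ⟨hi, hj⟩ := h
  rw [Finset.mem_Icc] at hi hj
  omega

/-- The grid functions that vanish at the boundary points of the grid. -/
def zeroTrace (J₁ J₂ : ℕ) : Submodule ℝ (ℕ → ℕ → ℝ) where
  carrier := {w | (∀ j ≤ 2 * J₂, w 0 j = 0 ∧ w (2 * J₁) j = 0) ∧
    ∀ i ≤ 2 * J₁, w i 0 = 0 ∧ w i (2 * J₂) = 0}
  add_mem' {w z} hw hz := ⟨fun j hj => by simp [hw.1 j hj, hz.1 j hj],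
    fun i hi => by simp [hw.2 i hi, hz.2 i hi]⟩
  zero_mem' := by simp
  smul_mem' c w hw := ⟨fun j hj => by simp [hw.1 j hj], fun i hi => by simp [hw.2 i hi]⟩

/-- The discrete inner product as a bilinear form. -/
def gridForm (J₁ J₂ : ℕ) : LinearMap.BilinForm ℝ (ℕ → ℕ → ℝ) :=
  LinearMap.mk₂ ℝ (gridInner J₁ J₂)
    (fun _ _ _ => by
      simp only [gridInner, Pi.add_apply, add_mul, Finset.sum_add_distrib, mul_add])
    (fun _ _ _ => by
      simp only [gridInner, Pi.smul_apply, smul_eq_mul, mul_assoc, ← Finset.mul_sum]; ring)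
    (fun _ _ _ => by
      simp only [gridInner, Pi.add_apply, mul_add, Finset.sum_add_distrib])
    (fun c w z => by
      simp only [gridInner, Pi.smul_apply, smul_eq_mul, mul_left_comm _ c, ← Finset.mul_sum])

theorem gridForm_apply (w z : ℕ → ℕ → ℝ) : gridForm J₁ J₂ w z = gridInner J₁ J₂ w z := rfl

theorem isPosSemidef_gridForm (J₁ J₂ : ℕ) : (gridForm J₁ J₂).IsPosSemidef where
  eq w z := by simp only [gridForm_apply, gridInner, mul_comm (w _ _)]
  nonneg w := mul_nonneg (mul_nonneg (step_nonneg J₁) (step_nonneg J₂))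
    (Finset.sum_nonneg fun i _ => Finset.sum_nonneg fun j _ => mul_self_nonneg (w i j))

theorem gridNorm_nonneg (w : ℕ → ℕ → ℝ) : 0 ≤ gridNorm J₁ J₂ w := Real.sqrt_nonneg _

theorem gridNorm_sq (w : ℕ → ℕ → ℝ) : gridNorm J₁ J₂ w ^ 2 = gridInner J₁ J₂ w w :=
  formNorm_sq (isPosSemidef_gridForm J₁ J₂) w

theorem gridInner_le (w z : ℕ → ℕ → ℝ) :
    gridInner J₁ J₂ w z ≤ gridNorm J₁ J₂ w * gridNorm J₁ J₂ z :=
  apply_le_formNorm_mul (isPosSemidef_gridForm J₁ J₂) w z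

theorem gridNorm_neg (w : ℕ → ℕ → ℝ) : gridNorm J₁ J₂ (-w) = gridNorm J₁ J₂ w := by
  simp [gridNorm, gridInner]

theorem abs_gridInner_le (w z : ℕ → ℕ → ℝ) :
    |gridInner J₁ J₂ w z| ≤ gridNorm J₁ J₂ w * gridNorm J₁ J₂ z := by
  have hneg := gridInner_le (J₁ := J₁) (J₂ := J₂) (-w) z
  rw [gridNorm_neg, ← gridForm_apply, map_neg] at hneg
  exact abs_le'.2 ⟨gridInner_le w z, hneg⟩

theorem gridNorm_add_le (w z : ℕ → ℕ → ℝ) :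
    gridNorm J₁ J₂ (w + z) ≤ gridNorm J₁ J₂ w + gridNorm J₁ J₂ z :=
  formNorm_add_le (isPosSemidef_gridForm J₁ J₂) w z

theorem gridNorm_sub_le (w z : ℕ → ℕ → ℝ) :
    gridNorm J₁ J₂ (w - z) ≤ gridNorm J₁ J₂ w + gridNorm J₁ J₂ z := by
  simpa only [sub_eq_add_neg, gridNorm_neg] using gridNorm_add_le (J₁ := J₁) (J₂ := J₂) w (-z)

theorem gridNorm_smul (c : ℝ) (w : ℕ → ℕ → ℝ) :
    gridNorm J₁ J₂ (c • w) = |c| * gridNorm J₁ J₂ w := by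
  rw [gridNorm, ← gridForm_apply, map_smul, map_smul, LinearMap.smul_apply, smul_smul, smul_eq_mul,
    Real.sqrt_mul (mul_self_nonneg c), Real.sqrt_mul_self_eq_abs, gridForm_apply, gridNorm]

theorem gridInner_congr_left {w' : ℕ → ℕ → ℝ} (h : ∀ i j, Interior J₁ J₂ i j → w i j = w' i j)
    (z : ℕ → ℕ → ℝ) : gridInner J₁ J₂ w z = gridInner J₁ J₂ w' z := by
  unfold gridInner
  congr 1
  exact Finset.sum_congr rfl fun i hi => Finset.sum_congr rfl fun j hj => by rw [h i j ⟨hi, hj⟩]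

theorem gridNorm_le_of_abs_le (h₁ : 1 ≤ J₁) (h₂ : 1 ≤ J₂) {c : ℝ} (hc : 0 ≤ c)
    (hw : ∀ i j, Interior J₁ J₂ i j → |w i j| ≤ c) : gridNorm J₁ J₂ w ≤ c := by
  refine Real.sqrt_le_iff.2 ⟨hc, ?_⟩
  have hsum : ∑ i ∈ Finset.Icc 1 (2 * J₁ - 1), ∑ j ∈ Finset.Icc 1 (2 * J₂ - 1), w i j * w i j
      ≤ ((2 * J₁ : ℕ) : ℝ) * (((2 * J₂ : ℕ) : ℝ) * c ^ 2) := by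
    calc _ ≤ ∑ i ∈ Finset.Icc 1 (2 * J₁ - 1), ∑ j ∈ Finset.Icc 1 (2 * J₂ - 1), c ^ 2 :=
          Finset.sum_le_sum fun i hi => Finset.sum_le_sum fun j hj => by
            rw [← abs_mul_abs_self, ← pow_two]
            exact pow_le_pow_left₀ (abs_nonneg _) (hw i j ⟨hi, hj⟩) 2
      _ = ((2 * J₁ - 1 : ℕ) : ℝ) * (((2 * J₂ - 1 : ℕ) : ℝ) * c ^ 2) := by simp
      _ ≤ _ := by gcongr <;> omega
  calc gridInner J₁ J₂ w w
      ≤ step J₁ * step J₂ * (((2 * J₁ : ℕ) : ℝ) * (((2 * J₂ : ℕ) : ℝ) * c ^ 2)) :=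
        mul_le_mul_of_nonneg_left hsum (mul_nonneg (step_nonneg J₁) (step_nonneg J₂))
    _ = ((2 * J₁ : ℕ) * step J₁) * ((2 * J₂ : ℕ) * step J₂) * c ^ 2 := by ring
    _ = c ^ 2 := by rw [step_mul h₁, step_mul h₂, one_mul, one_mul]

/-! ### Nine-point stencils -/

/-- The sum of the two horizontal neighbours. -/
def nbrX : (ℕ → ℕ → ℝ) →ₗ[ℝ] (ℕ → ℕ → ℝ) where
  toFun w i j := w (i + 1) j + w (i - 1) j
  map_add' _ _ := by ext i j; simp only [Pi.add_apply]; ring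
  map_smul' _ _ := by ext i j; simp [mul_add]

/-- The sum of the two vertical neighbours. -/
def nbrY : (ℕ → ℕ → ℝ) →ₗ[ℝ] (ℕ → ℕ → ℝ) where
  toFun w i j := w i (j + 1) + w i (j - 1)
  map_add' _ _ := by ext i j; simp only [Pi.add_apply]; ring
  map_smul' _ _ := by ext i j; simp [mul_add]

/-- A symmetric nine-point stencil. -/
def stencil (a b c d : ℝ) : (ℕ → ℕ → ℝ) →ₗ[ℝ] (ℕ → ℕ → ℝ) :=
  a • LinearMap.id + b • nbrX + c • nbrY + d • (nbrX ∘ₗ nbrY)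

theorem stencil_apply (a b c d : ℝ) (w : ℕ → ℕ → ℝ) :
    stencil a b c d w = a • w + b • nbrX w + c • nbrY w + d • nbrX (nbrY w) := rfl

theorem nbrX_nbrY_comm (w : ℕ → ℕ → ℝ) : nbrX (nbrY w) = nbrY (nbrX w) := by
  ext i j; simp only [nbrX, nbrY, LinearMap.coe_mk, AddHom.coe_mk]; ring

/-- The stencil of `𝓗`. -/
def stencilH : (ℕ → ℕ → ℝ) →ₗ[ℝ] (ℕ → ℕ → ℝ) :=
  stencil (100 / 144) (10 / 144) (10 / 144) (1 / 144)

/-- The stencil of `Φ`. -/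
def stencilPhi (J₁ J₂ : ℕ) : (ℕ → ℕ → ℝ) →ₗ[ℝ] (ℕ → ℕ → ℝ) :=
  stencil (-(20 / 12) * ((step J₁)⁻¹ ^ 2 + (step J₂)⁻¹ ^ 2))
    (10 / 12 * (step J₁)⁻¹ ^ 2 - 2 / 12 * (step J₂)⁻¹ ^ 2)
    (10 / 12 * (step J₂)⁻¹ ^ 2 - 2 / 12 * (step J₁)⁻¹ ^ 2)
    (1 / 12 * ((step J₁)⁻¹ ^ 2 + (step J₂)⁻¹ ^ 2))

theorem opH_eq_stencilH {i j : ℕ} (w : ℕ → ℕ → ℝ) (h : Interior J₁ J₂ i j) :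
    opH J₁ J₂ w i j = stencilH w i j := by
  obtain ⟨hi, hj⟩ := h.bounds
  simp only [opH, opA, opB, stencilH, stencil_apply, nbrX, nbrY, if_pos hi, if_pos hj,
    LinearMap.coe_mk, AddHom.coe_mk, Pi.add_apply, Pi.smul_apply, smul_eq_mul]
  ring

theorem opPhi_eq_stencilPhi {i j : ℕ} (w : ℕ → ℕ → ℝ) (h : Interior J₁ J₂ i j) :
    opPhi J₁ J₂ w i j = stencilPhi J₁ J₂ w i j := by
  obtain ⟨hi, hj⟩ := h.bounds
  simp only [opPhi, opA, opB, stencilPhi, stencil_apply, nbrX, nbrY, if_pos hi, if_pos hj, secX,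
    secY, fwdX, fwdY, bwdX, bwdY, div_eq_mul_inv, LinearMap.coe_mk, AddHom.coe_mk, Pi.add_apply,
    Pi.smul_apply, smul_eq_mul]
  ring

theorem sum_nbr_mul_symm {M : ℕ} (hM : 1 ≤ M) {w z : ℕ → ℝ} (hw0 : w 0 = 0) (hwM : w M = 0)
    (hz0 : z 0 = 0) (hzM : z M = 0) :
    ∑ i ∈ Finset.Icc 1 (M - 1), (w (i + 1) + w (i - 1)) * z i
      = ∑ i ∈ Finset.Icc 1 (M - 1), w i * (z (i + 1) + z (i - 1)) := by
  obtain ⟨m, rfl⟩ : ∃ m, M = m + 1 := ⟨M - 1, by omega⟩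
  rw [← sub_eq_zero, ← Finset.sum_sub_distrib, Nat.add_sub_cancel,
    ← Finset.Ico_add_one_right_eq_Icc, Finset.sum_Ico_eq_sum_range, Nat.add_sub_cancel]
  have h := Finset.sum_range_sub (fun i => w (i + 1) * z i - w i * z (i + 1)) m
  simp only [hw0, hwM, hz0, hzM, mul_zero, zero_mul, sub_zero, zero_add] at h
  rw [← h]
  refine Finset.sum_congr rfl fun i _ => ?_
  rw [Nat.add_comm 1 i, Nat.add_sub_cancel]
  ring

theorem sum_nbr_sq_le {M : ℕ} (hM : 1 ≤ M) {w : ℕ → ℝ} (hw0 : w 0 = 0) (hwM : w M = 0) :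
    ∑ i ∈ Finset.Icc 1 (M - 1), (w (i + 1) + w (i - 1)) ^ 2
      ≤ 4 * ∑ i ∈ Finset.Icc 1 (M - 1), w i ^ 2 := by
  obtain ⟨m, rfl⟩ : ∃ m, M = m + 1 := ⟨M - 1, by omega⟩
  rw [← sub_nonpos, Finset.mul_sum, ← Finset.sum_sub_distrib, Nat.add_sub_cancel,
    ← Finset.Ico_add_one_right_eq_Icc, Finset.sum_Ico_eq_sum_range, Nat.add_sub_cancel]
  have htel := Finset.sum_range_sub (fun i => 2 * (w (i + 1) ^ 2 - w i ^ 2)) m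
  calc _ ≤ ∑ i ∈ Finset.range m,
        (2 * (w (i + 1 + 1) ^ 2 - w (i + 1) ^ 2) - 2 * (w (i + 1) ^ 2 - w i ^ 2)) := by
        refine Finset.sum_le_sum fun i _ => ?_
        rw [Nat.add_comm 1 i, Nat.add_sub_cancel]
        linarith [sq_nonneg (w (i + 1 + 1) - w i)]
    _ ≤ 0 := by
        rw [htel, hwM, zero_add, hw0]
        linarith [sq_nonneg (w m), sq_nonneg (w 1)]

/-- `w` vanishes at the left and right ends of the interior grid rows. -/
def VanishesX (J₁ J₂ : ℕ) (w : ℕ → ℕ → ℝ) : Prop :=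
  ∀ j ∈ Finset.Icc 1 (2 * J₂ - 1), w 0 j = 0 ∧ w (2 * J₁) j = 0

/-- `w` vanishes at the lower and upper ends of the interior grid columns. -/
def VanishesY (J₁ J₂ : ℕ) (w : ℕ → ℕ → ℝ) : Prop :=
  ∀ i ∈ Finset.Icc 1 (2 * J₁ - 1), w i 0 = 0 ∧ w i (2 * J₂) = 0

theorem vanishesX_of_mem (hw : w ∈ zeroTrace J₁ J₂) : VanishesX J₁ J₂ w := fun j hj => by
  rw [Finset.mem_Icc] at hj
  exact hw.1 j (by omega)

theorem vanishesY_of_mem (hw : w ∈ zeroTrace J₁ J₂) : VanishesY J₁ J₂ w := fun i hi => by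
  rw [Finset.mem_Icc] at hi
  exact hw.2 i (by omega)

theorem vanishesX_nbrY (hw : w ∈ zeroTrace J₁ J₂) : VanishesX J₁ J₂ (nbrY w) := fun j hj => by
  rw [Finset.mem_Icc] at hj
  simp [nbrY, hw.1 (j + 1) (by omega), hw.1 (j - 1) (by omega)]

theorem vanishesY_nbrX (hw : w ∈ zeroTrace J₁ J₂) : VanishesY J₁ J₂ (nbrX w) := fun i hi => by
  rw [Finset.mem_Icc] at hi
  simp [nbrX, hw.2 (i + 1) (by omega), hw.2 (i - 1) (by omega)]

theorem gridForm_nbrX_left (h₁ : 1 ≤ J₁) (hw : VanishesX J₁ J₂ w) (hz : VanishesX J₁ J₂ z) :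
    gridForm J₁ J₂ (nbrX w) z = gridForm J₁ J₂ w (nbrX z) := by
  simp only [gridForm_apply, gridInner]
  rw [Finset.sum_comm, Finset.sum_comm (f := fun i j => w i j * nbrX z i j)]
  congr 1
  exact Finset.sum_congr rfl fun j hj => sum_nbr_mul_symm (w := (w · j)) (z := (z · j))
    (by omega) (hw j hj).1 (hw j hj).2 (hz j hj).1 (hz j hj).2

theorem gridForm_nbrY_left (h₂ : 1 ≤ J₂) (hw : VanishesY J₁ J₂ w) (hz : VanishesY J₁ J₂ z) :
    gridForm J₁ J₂ (nbrY w) z = gridForm J₁ J₂ w (nbrY z) := by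
  simp only [gridForm_apply, gridInner]
  congr 1
  exact Finset.sum_congr rfl fun i hi => sum_nbr_mul_symm (by omega) (hw i hi).1 (hw i hi).2
    (hz i hi).1 (hz i hi).2

theorem gridForm_stencil_comm (h₁ : 1 ≤ J₁) (h₂ : 1 ≤ J₂) (hw : w ∈ zeroTrace J₁ J₂)
    (hz : z ∈ zeroTrace J₁ J₂) (a b c d : ℝ) :
    gridForm J₁ J₂ (stencil a b c d w) z = gridForm J₁ J₂ (stencil a b c d z) w := by
  rw [(isPosSemidef_gridForm J₁ J₂).isSymm.eq (stencil a b c d z)]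
  simp only [stencil_apply, map_add, map_smul, LinearMap.add_apply, LinearMap.smul_apply]
  rw [gridForm_nbrX_left h₁ (vanishesX_of_mem hw) (vanishesX_of_mem hz),
    gridForm_nbrY_left h₂ (vanishesY_of_mem hw) (vanishesY_of_mem hz),
    gridForm_nbrX_left h₁ (vanishesX_nbrY hw) (vanishesX_of_mem hz),
    gridForm_nbrY_left h₂ (vanishesY_of_mem hw) (vanishesY_nbrX hz), nbrX_nbrY_comm z]

theorem gridNorm_le_two_mul (h : gridInner J₁ J₂ w w ≤ 4 * gridInner J₁ J₂ z z) :
    gridNorm J₁ J₂ w ≤ 2 * gridNorm J₁ J₂ z := by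
  refine Real.sqrt_le_iff.2 ⟨mul_nonneg two_pos.le (gridNorm_nonneg z), h.trans ?_⟩
  rw [mul_pow, gridNorm_sq]
  norm_num

theorem gridNorm_nbrX_le (h₁ : 1 ≤ J₁) (hw : VanishesX J₁ J₂ w) :
    gridNorm J₁ J₂ (nbrX w) ≤ 2 * gridNorm J₁ J₂ w := by
  refine gridNorm_le_two_mul ?_
  simp only [gridInner, ← pow_two (nbrX w _ _), ← pow_two (w _ _)]
  rw [mul_left_comm, Finset.sum_comm, Finset.sum_comm (f := fun i j => w i j ^ 2)]
  refine mul_le_mul_of_nonneg_left ?_ (mul_nonneg (step_nonneg J₁) (step_nonneg J₂))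
  rw [Finset.mul_sum]
  exact Finset.sum_le_sum fun j hj =>
    sum_nbr_sq_le (w := (w · j)) (by omega) (hw j hj).1 (hw j hj).2

theorem gridNorm_nbrY_le (h₂ : 1 ≤ J₂) (hw : VanishesY J₁ J₂ w) :
    gridNorm J₁ J₂ (nbrY w) ≤ 2 * gridNorm J₁ J₂ w := by
  refine gridNorm_le_two_mul ?_
  simp only [gridInner, ← pow_two (nbrY w _ _), ← pow_two (w _ _)]
  rw [mul_left_comm]
  refine mul_le_mul_of_nonneg_left ?_ (mul_nonneg (step_nonneg J₁) (step_nonneg J₂))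
  rw [Finset.mul_sum]
  exact Finset.sum_le_sum fun i hi => sum_nbr_sq_le (by omega) (hw i hi).1 (hw i hi).2

/-- The off-centre weights of `𝓗` sum to `44 / 144`, and each neighbour sum is at most doubling, so
`𝓗` differs from the multiple `100 / 144` of the identity by an operator of norm `44 / 144`. -/
theorem gridNorm_stencilH_sub_le (h₁ : 1 ≤ J₁) (h₂ : 1 ≤ J₂) (hw : w ∈ zeroTrace J₁ J₂) :
    gridNorm J₁ J₂ (stencilH w - (100 / 144 : ℝ) • w) ≤ 44 / 144 * gridNorm J₁ J₂ w := by
  have hX := gridNorm_nbrX_le h₁ (vanishesX_of_mem hw)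
  have hY := gridNorm_nbrY_le h₂ (vanishesY_of_mem hw)
  have hXY := gridNorm_nbrX_le h₁ (vanishesX_nbrY hw)
  have hsplit : stencilH w - (100 / 144 : ℝ) • w
      = (10 / 144 : ℝ) • nbrX w + (10 / 144 : ℝ) • nbrY w + (1 / 144 : ℝ) • nbrX (nbrY w) := by
    rw [stencilH, stencil_apply]; abel
  have h₂₃ := gridNorm_add_le (J₁ := J₁) (J₂ := J₂) ((10 / 144 : ℝ) • nbrX w)
    ((10 / 144 : ℝ) • nbrY w)
  have h₁₂₃ := gridNorm_add_le (J₁ := J₁) (J₂ := J₂)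
    ((10 / 144 : ℝ) • nbrX w + (10 / 144 : ℝ) • nbrY w) ((1 / 144 : ℝ) • nbrX (nbrY w))
  simp only [gridNorm_smul, abs_of_pos (show (0 : ℝ) < 10 / 144 by norm_num),
    abs_of_pos (show (0 : ℝ) < 1 / 144 by norm_num)] at h₂₃ h₁₂₃
  rw [hsplit]
  linarith

/-- The form `⟨𝓗 w, z⟩`. -/
def formH (J₁ J₂ : ℕ) : LinearMap.BilinForm ℝ (zeroTrace J₁ J₂) :=
  (gridForm J₁ J₂).comp (stencilH ∘ₗ (zeroTrace J₁ J₂).subtype) (zeroTrace J₁ J₂).subtype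

/-- The form `⟨Φ w, z⟩`. -/
def formPhi (J₁ J₂ : ℕ) : LinearMap.BilinForm ℝ (zeroTrace J₁ J₂) :=
  (gridForm J₁ J₂).comp (stencilPhi J₁ J₂ ∘ₗ (zeroTrace J₁ J₂).subtype) (zeroTrace J₁ J₂).subtype

theorem formH_apply (w z : zeroTrace J₁ J₂) :
    formH J₁ J₂ w z = gridInner J₁ J₂ (opH J₁ J₂ w) z :=
  (gridInner_congr_left (fun _ _ h => opH_eq_stencilH _ h) _).symm

theorem formPhi_apply (w z : zeroTrace J₁ J₂) :
    formPhi J₁ J₂ w z = gridInner J₁ J₂ (opPhi J₁ J₂ w) z :=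
  (gridInner_congr_left (fun _ _ h => opPhi_eq_stencilPhi _ h) _).symm

theorem isSymm_formPhi (h₁ : 1 ≤ J₁) (h₂ : 1 ≤ J₂) : (formPhi J₁ J₂).IsSymm where
  eq w z := gridForm_stencil_comm h₁ h₂ w.2 z.2 _ _ _ _

theorem abs_formH_self_sub_le (h₁ : 1 ≤ J₁) (h₂ : 1 ≤ J₂) (w : zeroTrace J₁ J₂) :
    |formH J₁ J₂ w w - 100 / 144 * gridNorm J₁ J₂ w ^ 2| ≤ 44 / 144 * gridNorm J₁ J₂ w ^ 2 := by
  have hr := mul_le_mul_of_nonneg_right (gridNorm_stencilH_sub_le h₁ h₂ w.2)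
    (gridNorm_nonneg (J₁ := J₁) (J₂ := J₂) w)
  have hform : formH J₁ J₂ w w - 100 / 144 * gridNorm J₁ J₂ w ^ 2
      = gridInner J₁ J₂ (stencilH w - (100 / 144 : ℝ) • w) w := by
    rw [gridNorm_sq, ← gridForm_apply, ← gridForm_apply, map_sub, map_smul]; rfl
  rw [hform, pow_two, ← mul_assoc]
  exact (abs_gridInner_le _ _).trans hr

theorem isPosSemidef_formH (h₁ : 1 ≤ J₁) (h₂ : 1 ≤ J₂) : (formH J₁ J₂).IsPosSemidef where
  eq w z := gridForm_stencil_comm h₁ h₂ w.2 z.2 _ _ _ _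
  nonneg w := by
    linarith [(abs_le.1 (abs_formH_self_sub_le h₁ h₂ w)).1, sq_nonneg (gridNorm J₁ J₂ w)]

theorem formNorm_formH_le (h₁ : 1 ≤ J₁) (h₂ : 1 ≤ J₂) (w : zeroTrace J₁ J₂) :
    formNorm (formH J₁ J₂) w ≤ gridNorm J₁ J₂ w :=
  Real.sqrt_le_iff.2 ⟨gridNorm_nonneg _, by
    linarith [(abs_le.1 (abs_formH_self_sub_le h₁ h₂ w)).2]⟩

theorem gridNorm_le_formNorm_formH (h₁ : 1 ≤ J₁) (h₂ : 1 ≤ J₂) (w : zeroTrace J₁ J₂) :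
    gridNorm J₁ J₂ w ≤ 2 * formNorm (formH J₁ J₂) w := by
  refine (abs_le_of_sq_le_sq' ?_ (mul_nonneg two_pos.le (formNorm_nonneg w))).2
  rw [mul_pow, formNorm_sq (isPosSemidef_formH h₁ h₂)]
  linarith [(abs_le.1 (abs_formH_self_sub_le h₁ h₂ w)).1, sq_nonneg (gridNorm J₁ J₂ w)]

/-! ### The energy method on the grid -/

/-- The energy `√(⟨𝓗 e, e⟩ + (⟨𝓗 a, a⟩ + ⟨𝓗 b, b⟩) / 2)`, where `e` stands for a discrete velocity
and `a`, `b` for two consecutive values of the discretized `Δu`. -/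
def gridEnergy (J₁ J₂ : ℕ) (e a b : ℕ → ℕ → ℝ) : ℝ :=
  √(gridInner J₁ J₂ (opH J₁ J₂ e) e
    + 1 / 2 * (gridInner J₁ J₂ (opH J₁ J₂ a) a + gridInner J₁ J₂ (opH J₁ J₂ b) b))

theorem gridEnergy_nonneg (e a b : ℕ → ℕ → ℝ) : 0 ≤ gridEnergy J₁ J₂ e a b := Real.sqrt_nonneg _

theorem gridEnergy_eq_formNorm (e a b : zeroTrace J₁ J₂) :
    gridEnergy J₁ J₂ e a b = formNorm (energyForm (formH J₁ J₂)) (e, a, b) := by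
  simp only [gridEnergy, formNorm, energyForm_apply, formH_apply]

section Energy

variable {e a b d : ℕ → ℕ → ℝ}

theorem gridEnergy_le (h₁ : 1 ≤ J₁) (h₂ : 1 ≤ J₂) (he : e ∈ zeroTrace J₁ J₂)
    (ha : a ∈ zeroTrace J₁ J₂) (hb : b ∈ zeroTrace J₁ J₂) :
    gridEnergy J₁ J₂ e a b ≤ gridNorm J₁ J₂ e + gridNorm J₁ J₂ a + gridNorm J₁ J₂ b := by
  have hle (x : zeroTrace J₁ J₂) : formH J₁ J₂ x x ≤ gridNorm J₁ J₂ x ^ 2 := by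
    linarith [(abs_le.1 (abs_formH_self_sub_le h₁ h₂ x)).2]
  have he₀ := gridNorm_nonneg (J₁ := J₁) (J₂ := J₂) e
  have ha₀ := gridNorm_nonneg (J₁ := J₁) (J₂ := J₂) a
  have hb₀ := gridNorm_nonneg (J₁ := J₁) (J₂ := J₂) b
  rw [gridEnergy_eq_formNorm ⟨e, he⟩ ⟨a, ha⟩ ⟨b, hb⟩]
  refine Real.sqrt_le_iff.2 ⟨by positivity, ?_⟩
  rw [energyForm_apply]
  nlinarith [hle ⟨e, he⟩, hle ⟨a, ha⟩, hle ⟨b, hb⟩, mul_nonneg he₀ ha₀, mul_nonneg he₀ hb₀,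
    mul_nonneg ha₀ hb₀, sq_nonneg (gridNorm J₁ J₂ a), sq_nonneg (gridNorm J₁ J₂ b)]

theorem gridNorm_le_gridEnergy (h₁ : 1 ≤ J₁) (h₂ : 1 ≤ J₂) (he : e ∈ zeroTrace J₁ J₂)
    (ha : a ∈ zeroTrace J₁ J₂) (hb : b ∈ zeroTrace J₁ J₂) :
    gridNorm J₁ J₂ e ≤ 2 * gridEnergy J₁ J₂ e a b ∧ gridNorm J₁ J₂ a ≤ 3 * gridEnergy J₁ J₂ e a b ∧
      gridNorm J₁ J₂ b ≤ 3 * gridEnergy J₁ J₂ e a b := by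
  have hH := isPosSemidef_formH h₁ h₂
  rw [gridEnergy_eq_formNorm ⟨e, he⟩ ⟨a, ha⟩ ⟨b, hb⟩]
  refine ⟨(gridNorm_le_formNorm_formH h₁ h₂ ⟨e, he⟩).trans ?_,
    (gridNorm_le_formNorm_formH h₁ h₂ ⟨a, ha⟩).trans ?_,
    (gridNorm_le_formNorm_formH h₁ h₂ ⟨b, hb⟩).trans ?_⟩
  · linarith [formNorm_fst_le_energy hH ⟨e, he⟩ ⟨a, ha⟩ ⟨b, hb⟩]
  · linarith [formNorm_mid_le_energy hH ⟨e, he⟩ ⟨a, ha⟩ ⟨b, hb⟩]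
  · linarith [formNorm_last_le_energy hH ⟨e, he⟩ ⟨a, ha⟩ ⟨b, hb⟩]

theorem gridEnergy_add_le (h₁ : 1 ≤ J₁) (h₂ : 1 ≤ J₂) (he : e ∈ zeroTrace J₁ J₂)
    (ha : a ∈ zeroTrace J₁ J₂) (hb : b ∈ zeroTrace J₁ J₂) (hd : d ∈ zeroTrace J₁ J₂) :
    gridEnergy J₁ J₂ e (a + d) (b + d) ≤ gridEnergy J₁ J₂ e a b + gridNorm J₁ J₂ d := by
  have hH := isPosSemidef_formH h₁ h₂
  let e' : zeroTrace J₁ J₂ := ⟨e, he⟩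
  let a' : zeroTrace J₁ J₂ := ⟨a, ha⟩
  let b' : zeroTrace J₁ J₂ := ⟨b, hb⟩
  let d' : zeroTrace J₁ J₂ := ⟨d, hd⟩
  have hshift : formNorm (energyForm (formH J₁ J₂)) (0, d', d') = formNorm (formH J₁ J₂) d' := by
    simp only [formNorm, energyForm_apply, map_zero]
    ring_nf
  have htri := formNorm_add_le (isPosSemidef_energyForm hH) (e', a', b') (0, d', d')
  rw [hshift, Prod.mk_add_mk, Prod.mk_add_mk, add_zero, ← gridEnergy_eq_formNorm,
    ← gridEnergy_eq_formNorm] at htri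
  exact htri.trans (add_le_add_right (formNorm_formH_le h₁ h₂ d') _)

end Energy

theorem dt_mem_zeroTrace {τ : ℝ} {W : ℕ → ℕ → ℕ → ℝ} {n : ℕ} (h : W n ∈ zeroTrace J₁ J₂)
    (h' : W (n - 1) ∈ zeroTrace J₁ J₂) : dt τ W n ∈ zeroTrace J₁ J₂ := by
  have heq : dt τ W n = τ⁻¹ • (W n - W (n - 1)) := by
    ext i j; simp only [dt, Pi.smul_apply, Pi.sub_apply, smul_eq_mul]; ring
  rw [heq]
  exact Submodule.smul_mem _ _ (Submodule.sub_mem _ h h')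

/-- The linear system common to the scheme and to its error equation, with damping coefficients
`p n` and sources `g`, `s`. In the first equation the average of `η` is shifted by `G n`; the error
equation has `G n = ṽⁿ - vⁿ`, since `Φ (ṽⁿ - vⁿ)` cannot be estimated as a source. -/
structure IsDampedSolution (J₁ J₂ N : ℕ) (τ : ℝ) (p : ℕ → ℝ) (g s G e η : ℕ → ℕ → ℕ → ℝ) :
    Prop where
  trace_fst : ∀ n ≤ N + 1, e n ∈ zeroTrace J₁ J₂
  trace_snd : ∀ n ≤ N + 1, η n ∈ zeroTrace J₁ J₂
  trace_shift : ∀ n ≤ N, G n ∈ zeroTrace J₁ J₂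
  eq_fst : ∀ n ∈ Finset.Icc 1 N, ∀ i j, Interior J₁ J₂ i j →
    opH J₁ J₂ (dt2 τ e n) i j + p n * opH J₁ J₂ (dtBar τ e n) i j
      + opPhi J₁ J₂ (avg η n - G n) i j = g n i j
  eq_snd : ∀ n ∈ Finset.Icc 1 N, ∀ i j, Interior J₁ J₂ i j →
    opH J₁ J₂ (dtBar τ η n) i j = opPhi J₁ J₂ (dtBar τ e n) i j + s n i j

/-- The energy of `(e, η)` between the times `n` and `n + 1`, with `η` shifted by `G n`. -/
def shiftedEnergy (J₁ J₂ : ℕ) (τ : ℝ) (G e η : ℕ → ℕ → ℕ → ℝ) (n : ℕ) : ℝ :=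
  gridEnergy J₁ J₂ (dt τ e (n + 1)) (η (n + 1) - G n) (η n - G n)

namespace IsDampedSolution

variable {N : ℕ} {τ : ℝ} {p : ℕ → ℝ} {g s G e η : ℕ → ℕ → ℕ → ℝ}

theorem dt_mem (h : IsDampedSolution J₁ J₂ N τ p g s G e η) {n : ℕ} (hn : n ≤ N) :
    dt τ e (n + 1) ∈ zeroTrace J₁ J₂ :=
  dt_mem_zeroTrace (h.trace_fst _ (by omega)) (h.trace_fst _ (by omega))

theorem sub_shift_mem (h : IsDampedSolution J₁ J₂ N τ p g s G e η) {m n : ℕ} (hm : m ≤ N + 1)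
    (hn : n ≤ N) : η m - G n ∈ zeroTrace J₁ J₂ :=
  Submodule.sub_mem _ (h.trace_snd _ hm) (h.trace_shift _ hn)

theorem form_eq_fst (h : IsDampedSolution J₁ J₂ N τ p g s G e η) {n : ℕ} (hn : n < N)
    {e₁ e₀ a b : zeroTrace J₁ J₂} (he₁ : e₁ = dt τ e (n + 1 + 1)) (he₀ : e₀ = dt τ e (n + 1))
    (ha : a = η (n + 1 + 1) - G (n + 1)) (hb : b = η n - G (n + 1)) :
    τ⁻¹ • formH J₁ J₂ (e₁ - e₀) + (p (n + 1) / 2) • formH J₁ J₂ (e₁ + e₀)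
      + (1 / 2 : ℝ) • formPhi J₁ J₂ (a + b)
      = gridForm J₁ J₂ (g (n + 1)) ∘ₗ (zeroTrace J₁ J₂).subtype := by
  have hdt2 : dt2 τ e (n + 1) = ↑(τ⁻¹ • (e₁ - e₀)) := by
    ext i j; simp [he₁, he₀, dt2, dt]; ring
  have hbar : dtBar τ e (n + 1) = ↑((1 / 2 : ℝ) • (e₁ + e₀)) := by
    ext i j; simp [he₁, he₀, dtBar, dt]; ring
  have havg : avg η (n + 1) - G (n + 1) = ↑((1 / 2 : ℝ) • (a + b)) := by
    ext i j; simp [ha, hb, avg]; ring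
  ext z
  have heq := gridInner_congr_left (w := opH J₁ J₂ (dt2 τ e (n + 1))
    + p (n + 1) • opH J₁ J₂ (dtBar τ e (n + 1)) + opPhi J₁ J₂ (avg η (n + 1) - G (n + 1)))
    (h.eq_fst (n + 1) (Finset.mem_Icc.2 ⟨by omega, hn⟩)) z
  rw [hdt2, hbar, havg, ← gridForm_apply] at heq
  simp only [map_add, map_smul, LinearMap.add_apply, LinearMap.smul_apply, gridForm_apply,
    ← formH_apply, ← formPhi_apply, smul_eq_mul] at heq
  simp only [map_add, LinearMap.add_apply, LinearMap.smul_apply, smul_eq_mul, LinearMap.comp_apply,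
    Submodule.subtype_apply, gridForm_apply]
  linarith

theorem form_eq_snd (h : IsDampedSolution J₁ J₂ N τ p g s G e η) {n : ℕ} (hn : n < N)
    {e₁ e₀ a b : zeroTrace J₁ J₂} (he₁ : e₁ = dt τ e (n + 1 + 1)) (he₀ : e₀ = dt τ e (n + 1))
    (ha : a = η (n + 1 + 1) - G (n + 1)) (hb : b = η n - G (n + 1)) :
    (2 * τ)⁻¹ • formH J₁ J₂ (a - b) = (1 / 2 : ℝ) • formPhi J₁ J₂ (e₁ + e₀)
      + gridForm J₁ J₂ (s (n + 1)) ∘ₗ (zeroTrace J₁ J₂).subtype := by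
  have hbarη : dtBar τ η (n + 1) = ↑((2 * τ)⁻¹ • (a - b)) := by
    ext i j; simp [ha, hb, dtBar]; ring
  have hbar : dtBar τ e (n + 1) = ↑((1 / 2 : ℝ) • (e₁ + e₀)) := by
    ext i j; simp [he₁, he₀, dtBar, dt]; ring
  ext z
  have heq := gridInner_congr_left (w' := opPhi J₁ J₂ (dtBar τ e (n + 1)) + s (n + 1))
    (h.eq_snd (n + 1) (Finset.mem_Icc.2 ⟨by omega, hn⟩)) z
  rw [hbarη, hbar, ← gridForm_apply, ← gridForm_apply, map_add, LinearMap.add_apply,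
    gridForm_apply, gridForm_apply, ← formH_apply, ← formPhi_apply, map_smul, map_smul] at heq
  exact heq

theorem shiftedEnergy_succ_le (h : IsDampedSolution J₁ J₂ N τ p g s G e η) (h₁ : 1 ≤ J₁)
    (h₂ : 1 ≤ J₂) (hτ : 0 < τ) {n : ℕ} (hn : n < N) (hp : 0 ≤ p (n + 1)) :
    shiftedEnergy J₁ J₂ τ G e η (n + 1)
      ≤ shiftedEnergy J₁ J₂ τ G e η n + gridNorm J₁ J₂ (G n - G (n + 1))
        + 3 * τ * (gridNorm J₁ J₂ (g (n + 1)) + gridNorm J₁ J₂ (s (n + 1))) := by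
  let e₁ : zeroTrace J₁ J₂ := ⟨_, h.dt_mem hn⟩
  let e₀ : zeroTrace J₁ J₂ := ⟨_, h.dt_mem hn.le⟩
  let a : zeroTrace J₁ J₂ := ⟨_, h.sub_shift_mem (show n + 1 + 1 ≤ N + 1 by omega) hn⟩
  let b : zeroTrace J₁ J₂ := ⟨_, h.sub_shift_mem (show n ≤ N + 1 by omega) hn⟩
  let c : zeroTrace J₁ J₂ := ⟨_, h.sub_shift_mem (show n + 1 ≤ N + 1 by omega) hn⟩
  have hsource (w : ℕ → ℕ → ℝ) (x : zeroTrace J₁ J₂) :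
      (gridForm J₁ J₂ w ∘ₗ (zeroTrace J₁ J₂).subtype) x
        ≤ 2 * gridNorm J₁ J₂ w * formNorm (formH J₁ J₂) x := by
    have hx := mul_le_mul_of_nonneg_left (gridNorm_le_formNorm_formH h₁ h₂ x)
      (gridNorm_nonneg (J₁ := J₁) (J₂ := J₂) w)
    exact (gridInner_le w x).trans (by linarith)
  have hstep := energy_le_add (e₁ := e₁) (e₀ := e₀) (a := a) (b := b) (c := c)
    (isPosSemidef_formH h₁ h₂) (isSymm_formPhi h₁ h₂) hτ hp (h.form_eq_fst hn rfl rfl rfl rfl)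
    (h.form_eq_snd hn rfl rfl rfl rfl) (mul_nonneg two_pos.le (gridNorm_nonneg _))
    (mul_nonneg two_pos.le (gridNorm_nonneg _)) (hsource _) (hsource _)
  have hshift := gridEnergy_add_le h₁ h₂ (h.dt_mem hn.le)
    (h.sub_shift_mem (show n + 1 ≤ N + 1 by omega) hn.le)
    (h.sub_shift_mem (show n ≤ N + 1 by omega) hn.le)
    (Submodule.sub_mem _ (h.trace_shift n hn.le) (h.trace_shift (n + 1) hn))
  rw [← gridEnergy_eq_formNorm, ← gridEnergy_eq_formNorm] at hstep
  rw [sub_add_sub_cancel, sub_add_sub_cancel] at hshift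
  unfold shiftedEnergy
  linarith

theorem shiftedEnergy_zero_le (h : IsDampedSolution J₁ J₂ N τ p g s G e η) (h₁ : 1 ≤ J₁)
    (h₂ : 1 ≤ J₂) :
    shiftedEnergy J₁ J₂ τ G e η 0 ≤ gridNorm J₁ J₂ (dt τ e 1) + gridNorm J₁ J₂ (η 1)
      + gridNorm J₁ J₂ (η 0) + 2 * gridNorm J₁ J₂ (G 0) := by
  have hE := gridEnergy_le h₁ h₂ (h.dt_mem N.zero_le)
    (h.sub_shift_mem (show 1 ≤ N + 1 by omega) N.zero_le)
    (h.sub_shift_mem (N + 1).zero_le N.zero_le)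
  have hη₁ := gridNorm_sub_le (J₁ := J₁) (J₂ := J₂) (η 1) (G 0)
  have hη₀ := gridNorm_sub_le (J₁ := J₁) (J₂ := J₂) (η 0) (G 0)
  exact hE.trans (by linarith)

theorem gridNorm_le_shiftedEnergy (h : IsDampedSolution J₁ J₂ N τ p g s G e η) (h₁ : 1 ≤ J₁)
    (h₂ : 1 ≤ J₂) {n : ℕ} (hn : n ≤ N) :
    gridNorm J₁ J₂ (dt τ e (n + 1)) ≤ 3 * shiftedEnergy J₁ J₂ τ G e η n ∧
      gridNorm J₁ J₂ (η (n + 1)) ≤ 3 * shiftedEnergy J₁ J₂ τ G e η n + gridNorm J₁ J₂ (G n) ∧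
      gridNorm J₁ J₂ (η n) ≤ 3 * shiftedEnergy J₁ J₂ τ G e η n + gridNorm J₁ J₂ (G n) := by
  obtain ⟨he, ha, hb⟩ := gridNorm_le_gridEnergy h₁ h₂ (h.dt_mem hn)
    (h.sub_shift_mem (show n + 1 ≤ N + 1 by omega) hn)
    (h.sub_shift_mem (show n ≤ N + 1 by omega) hn)
  have hnonneg : 0 ≤ shiftedEnergy J₁ J₂ τ G e η n := gridEnergy_nonneg _ _ _
  have hη₁ := gridNorm_add_le (J₁ := J₁) (J₂ := J₂) (η (n + 1) - G n) (G n)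
  have hη₀ := gridNorm_add_le (J₁ := J₁) (J₂ := J₂) (η n - G n) (G n)
  rw [sub_add_cancel] at hη₁ hη₀
  unfold shiftedEnergy at hnonneg ⊢
  exact ⟨by linarith, by linarith, by linarith⟩

end IsDampedSolution

theorem discrete_gronwall {y : ℕ → ℝ} {N : ℕ} {τ K δ : ℝ} (hδ : 0 ≤ δ) (hy : ∀ n, 0 ≤ y n)
    (h : ∀ n < N, y (n + 1) ≤ y n + τ * K * (y n + δ)) :
    ∀ n ≤ N, y n + δ ≤ Real.exp (K * (n * τ)) * (y 0 + δ) := by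
  intro n
  induction n with
  | zero => simp
  | succ n ih =>
    intro hn
    calc y (n + 1) + δ ≤ (τ * K + 1) * (y n + δ) := by linarith [h n hn]
      _ ≤ Real.exp (τ * K) * (Real.exp (K * (n * τ)) * (y 0 + δ)) :=
        mul_le_mul (Real.add_one_le_exp _) (ih (by omega)) (add_nonneg (hy n) hδ)
          (Real.exp_pos _).le
      _ = Real.exp (K * ((n + 1 : ℕ) * τ)) * (y 0 + δ) := by
        rw [← mul_assoc, ← Real.exp_add]; push_cast; ring_nf

/-- The admissible discretization parameters. -/
structure IsMesh (T : ℝ) (J₁ J₂ N : ℕ) (τ : ℝ) : Prop where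
  one_le_fst : 1 ≤ J₁
  one_le_snd : 1 ≤ J₂
  step_pos : 0 < τ
  time_le : ((N : ℝ) + 1) * τ ≤ T

theorem IsMesh.mul_le {T : ℝ} {N : ℕ} {τ : ℝ} (m : IsMesh T J₁ J₂ N τ) {n : ℕ} (hn : n ≤ N + 1) :
    n * τ ≤ T := by
  have hcast : (n : ℝ) ≤ N + 1 := by exact_mod_cast hn
  exact (mul_le_mul_of_nonneg_right hcast m.step_pos.le).trans m.time_le

/-- The constant in the stability estimate below; the exponential is the one of Gronwall's
inequality. -/
def stabilityConst (K T : ℝ) : ℝ := 3 * (Real.exp (3 * K * (3 + K) * T) * (5 * K + 1)) + K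

theorem stabilityConst_pos {K : ℝ} (hK : 0 ≤ K) (T : ℝ) : 0 < stabilityConst K T := by
  unfold stabilityConst; positivity

namespace IsDampedSolution

variable {N : ℕ} {τ T K δ : ℝ} {p : ℕ → ℝ} {g s G e η : ℕ → ℕ → ℕ → ℝ}

theorem shiftedEnergy_le (h : IsDampedSolution J₁ J₂ N τ p g s G e η) (m : IsMesh T J₁ J₂ N τ)
    (hK : 0 ≤ K) (hδ : 0 ≤ δ) (hp : ∀ n ∈ Finset.Icc 1 N, 0 ≤ p n)
    (he₁ : gridNorm J₁ J₂ (dt τ e 1) ≤ K * δ) (hη₁ : gridNorm J₁ J₂ (η 1) ≤ K * δ)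
    (hη₀ : gridNorm J₁ J₂ (η 0) ≤ K * δ) (hG : ∀ n ≤ N, gridNorm J₁ J₂ (G n) ≤ K * δ)
    (hG' : ∀ n < N, gridNorm J₁ J₂ (G n - G (n + 1)) ≤ τ * (K * δ))
    (hgs : ∀ n ∈ Finset.Icc 1 N,
      gridNorm J₁ J₂ (g n) + gridNorm J₁ J₂ (s n) ≤ K * (δ + gridNorm J₁ J₂ (η n)))
    {n : ℕ} (hn : n ≤ N) :
    shiftedEnergy J₁ J₂ τ G e η n ≤ Real.exp (3 * K * (3 + K) * T) * (5 * K + 1) * δ := by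
  have hτ := m.step_pos
  have hnonneg (n : ℕ) : 0 ≤ shiftedEnergy J₁ J₂ τ G e η n := gridEnergy_nonneg _ _ _
  have hstep : ∀ n < N, shiftedEnergy J₁ J₂ τ G e η (n + 1) ≤ shiftedEnergy J₁ J₂ τ G e η n
      + τ * (3 * K * (3 + K)) * (shiftedEnergy J₁ J₂ τ G e η n + δ) := fun n hn => by
    have hmem : n + 1 ∈ Finset.Icc 1 N := Finset.mem_Icc.2 ⟨by omega, hn⟩
    have hη := (h.gridNorm_le_shiftedEnergy m.one_le_fst m.one_le_snd hn.le).2.1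
    have hsource : gridNorm J₁ J₂ (g (n + 1)) + gridNorm J₁ J₂ (s (n + 1))
        ≤ K * (δ + (3 * shiftedEnergy J₁ J₂ τ G e η n + K * δ)) :=
      (hgs _ hmem).trans (mul_le_mul_of_nonneg_left (by linarith [hG n hn.le]) hK)
    have hsource' := mul_le_mul_of_nonneg_left hsource (mul_nonneg zero_le_three hτ.le)
    have hslack : 0 ≤ τ * (5 * K * δ + 3 * K ^ 2 * shiftedEnergy J₁ J₂ τ G e η n) :=
      mul_nonneg hτ.le (add_nonneg (by positivity) (mul_nonneg (by positivity) (hnonneg n)))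
    linarith [h.shiftedEnergy_succ_le m.one_le_fst m.one_le_snd hτ hn (hp _ hmem), hG' n hn]
  have hzero : shiftedEnergy J₁ J₂ τ G e η 0 + δ ≤ (5 * K + 1) * δ := by
    linarith [h.shiftedEnergy_zero_le m.one_le_fst m.one_le_snd, hG 0 N.zero_le]
  have hexp : Real.exp (3 * K * (3 + K) * (n * τ)) ≤ Real.exp (3 * K * (3 + K) * T) :=
    Real.exp_le_exp.2 (mul_le_mul_of_nonneg_left (m.mul_le (by omega)) (by positivity))
  have hgronwall := (discrete_gronwall hδ hnonneg hstep n hn).trans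
    (mul_le_mul hexp hzero (add_nonneg (hnonneg 0) hδ) (Real.exp_pos _).le)
  linarith

theorem stability (h : IsDampedSolution J₁ J₂ N τ p g s G e η) (m : IsMesh T J₁ J₂ N τ)
    (hK : 0 ≤ K) (hδ : 0 ≤ δ) (hp : ∀ n ∈ Finset.Icc 1 N, 0 ≤ p n)
    (he₁ : gridNorm J₁ J₂ (dt τ e 1) ≤ K * δ) (hη₁ : gridNorm J₁ J₂ (η 1) ≤ K * δ)
    (hη₀ : gridNorm J₁ J₂ (η 0) ≤ K * δ) (hG : ∀ n ≤ N, gridNorm J₁ J₂ (G n) ≤ K * δ)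
    (hG' : ∀ n < N, gridNorm J₁ J₂ (G n - G (n + 1)) ≤ τ * (K * δ))
    (hgs : ∀ n ∈ Finset.Icc 1 N,
      gridNorm J₁ J₂ (g n) + gridNorm J₁ J₂ (s n) ≤ K * (δ + gridNorm J₁ J₂ (η n)))
    {n : ℕ} (hn : n ≤ N) :
    gridNorm J₁ J₂ (dt τ e (n + 1)) ≤ stabilityConst K T * δ ∧
      gridNorm J₁ J₂ (η (n + 1)) ≤ stabilityConst K T * δ ∧
      gridNorm J₁ J₂ (η n) ≤ stabilityConst K T * δ := by
  have hE := h.shiftedEnergy_le m hK hδ hp he₁ hη₁ hη₀ hG hG' hgs hn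
  obtain ⟨he, hη, hη'⟩ := h.gridNorm_le_shiftedEnergy m.one_le_fst m.one_le_snd hn
  have hKδ := mul_nonneg hK hδ
  have := hG n hn
  unfold stabilityConst
  exact ⟨by linarith, by linarith, by linarith⟩

end IsDampedSolution

section Consistency

variable {i j : ℕ}

theorem opH_sub (w z : ℕ → ℕ → ℝ) (h : Interior J₁ J₂ i j) :
    opH J₁ J₂ (w - z) i j = opH J₁ J₂ w i j - opH J₁ J₂ z i j := by
  simp only [opH_eq_stencilH _ h, map_sub, Pi.sub_apply]

theorem opPhi_sub (w z : ℕ → ℕ → ℝ) (h : Interior J₁ J₂ i j) :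
    opPhi J₁ J₂ (w - z) i j = opPhi J₁ J₂ w i j - opPhi J₁ J₂ z i j := by
  simp only [opPhi_eq_stencilPhi _ h, map_sub, Pi.sub_apply]

theorem dt_sub (τ : ℝ) (W Z : ℕ → ℕ → ℕ → ℝ) : dt τ (W - Z) = dt τ W - dt τ Z := by
  ext n i j; simp only [dt, Pi.sub_apply]; ring

theorem dt2_sub (τ : ℝ) (W Z : ℕ → ℕ → ℕ → ℝ) (n : ℕ) :
    dt2 τ (W - Z) n = dt2 τ W n - dt2 τ Z n := by
  simp only [dt2, dt_sub, Pi.sub_apply]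

theorem dtBar_sub (τ : ℝ) (W Z : ℕ → ℕ → ℕ → ℝ) (n : ℕ) :
    dtBar τ (W - Z) n = dtBar τ W n - dtBar τ Z n := by
  ext i j; simp only [dtBar, Pi.sub_apply]; ring

theorem avg_sub (W Z : ℕ → ℕ → ℕ → ℝ) (n : ℕ) : avg (W - Z) n = avg W n - avg Z n := by
  ext i j; simp only [avg, Pi.sub_apply]; ring

theorem avg_mem_zeroTrace {W : ℕ → ℕ → ℕ → ℝ} {n : ℕ} (h : W (n + 1) ∈ zeroTrace J₁ J₂)
    (h' : W (n - 1) ∈ zeroTrace J₁ J₂) : avg W n ∈ zeroTrace J₁ J₂ := by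
  have heq : avg W n = (2 : ℝ)⁻¹ • (W (n + 1) + W (n - 1)) := by
    ext i j; simp only [avg, Pi.smul_apply, Pi.add_apply, smul_eq_mul]; ring
  rw [heq]
  exact Submodule.smul_mem _ _ (Submodule.add_mem _ h h')

/-- The residual of `(u, v)` in the first equation of the scheme at time `n`, with damping
coefficients `q`, source `F` and with `vⁿ` in place of the average `ṽⁿ`. -/
def residualFst (J₁ J₂ : ℕ) (τ : ℝ) (q : ℕ → ℝ) (F u v : ℕ → ℕ → ℕ → ℝ) (n : ℕ) : ℕ → ℕ → ℝ :=
  fun i j => opH J₁ J₂ (dt2 τ u n) i j + q n * opH J₁ J₂ (dtBar τ u n) i j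
    + opPhi J₁ J₂ (v n) i j - opH J₁ J₂ (F n) i j

/-- The residual of `(u, v)` in the second equation of the scheme at time `n`. -/
def residualSnd (J₁ J₂ : ℕ) (τ : ℝ) (u v : ℕ → ℕ → ℕ → ℝ) (n : ℕ) : ℕ → ℕ → ℝ :=
  fun i j => opH J₁ J₂ (dtBar τ v n) i j - opPhi J₁ J₂ (dtBar τ u n) i j

/-- The difference `ṽⁿ - vⁿ`; its value at `n = 1` is also used for `n = 0`, where `ṽⁿ` is not
defined. -/
def avgShift (v : ℕ → ℕ → ℕ → ℝ) (n : ℕ) : ℕ → ℕ → ℝ :=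
  avg v (max n 1) - v (max n 1)

/-- The grid functions `u`, `v` satisfy the scheme with damping coefficients `q` and source `F` up
to residuals of size `K δ`, and are smooth in time. -/
structure IsConsistent (J₁ J₂ N : ℕ) (τ K δ : ℝ) (q : ℕ → ℝ) (F u v : ℕ → ℕ → ℕ → ℝ) :
    Prop where
  trace_fst : ∀ n ≤ N + 1, u n ∈ zeroTrace J₁ J₂
  trace_snd : ∀ n ≤ N + 1, v n ∈ zeroTrace J₁ J₂
  residual_fst : ∀ n ∈ Finset.Icc 1 N, ∀ i j, Interior J₁ J₂ i j →
    |residualFst J₁ J₂ τ q F u v n i j| ≤ K * δ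
  residual_snd : ∀ n ∈ Finset.Icc 1 N, ∀ i j, Interior J₁ J₂ i j →
    |residualSnd J₁ J₂ τ u v n i j| ≤ K * δ
  velocity : ∀ n ∈ Finset.Icc 1 N, ∀ i j, Interior J₁ J₂ i j → |opH J₁ J₂ (dtBar τ u n) i j| ≤ K
  shift : ∀ n ∈ Finset.Icc 1 N, ∀ i j, Interior J₁ J₂ i j → |(avg v n - v n) i j| ≤ K * δ
  shift_diff : ∀ n, 1 ≤ n → n < N → ∀ i j, Interior J₁ J₂ i j →
    |(avg v n - v n - (avg v (n + 1) - v (n + 1))) i j| ≤ τ * (K * δ)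

variable {N : ℕ} {τ T K δ : ℝ} {p q : ℕ → ℝ} {F u v U V : ℕ → ℕ → ℕ → ℝ}

theorem IsConsistent.error (h : IsConsistent J₁ J₂ N τ K δ q F u v) (hN : 1 ≤ N)
    (hUV : IsDampedSolution J₁ J₂ N τ p (fun n => opH J₁ J₂ (F n)) 0 0 U V) :
    IsDampedSolution J₁ J₂ N τ p
      (fun n => residualFst J₁ J₂ τ q F u v n - (q n - p n) • opH J₁ J₂ (dtBar τ u n))
      (residualSnd J₁ J₂ τ u v) (avgShift v) (u - U) (v - V) where
  trace_fst n hn := Submodule.sub_mem _ (h.trace_fst n hn) (hUV.trace_fst n hn)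
  trace_snd n hn := Submodule.sub_mem _ (h.trace_snd n hn) (hUV.trace_snd n hn)
  trace_shift n hn := Submodule.sub_mem _
    (avg_mem_zeroTrace (h.trace_snd _ (by omega)) (h.trace_snd _ (by omega)))
    (h.trace_snd _ (by omega))
  eq_fst n hn i j hij := by
    have hU := hUV.eq_fst n hn i j hij
    rw [Pi.zero_apply, sub_zero] at hU
    rw [avgShift, max_eq_left (Finset.mem_Icc.1 hn).1, avg_sub, sub_right_comm, sub_sub_cancel,
      dt2_sub, dtBar_sub, opH_sub _ _ hij, opH_sub _ _ hij, opPhi_sub _ _ hij]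
    simp only [residualFst, Pi.sub_apply, Pi.smul_apply, smul_eq_mul]
    linarith
  eq_snd n hn i j hij := by
    have hV := hUV.eq_snd n hn i j hij
    rw [Pi.zero_apply, Pi.zero_apply, Pi.zero_apply, add_zero] at hV
    rw [dtBar_sub, dtBar_sub, opH_sub _ _ hij, opPhi_sub _ _ hij, residualSnd]
    linarith

theorem IsConsistent.gridNorm_avgShift_le (h : IsConsistent J₁ J₂ N τ K δ q F u v) (h₁ : 1 ≤ J₁)
    (h₂ : 1 ≤ J₂) (hN : 1 ≤ N) (hKδ : 0 ≤ K * δ) {n : ℕ} (hn : n ≤ N) :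
    gridNorm J₁ J₂ (avgShift v n) ≤ K * δ :=
  gridNorm_le_of_abs_le h₁ h₂ hKδ
    (h.shift _ (Finset.mem_Icc.2 ⟨le_max_right _ _, max_le hn hN⟩))

theorem IsConsistent.gridNorm_avgShift_sub_le (h : IsConsistent J₁ J₂ N τ K δ q F u v)
    (h₁ : 1 ≤ J₁) (h₂ : 1 ≤ J₂) (hτ : 0 ≤ τ) (hKδ : 0 ≤ K * δ) {n : ℕ} (hn : n < N) :
    gridNorm J₁ J₂ (avgShift v n - avgShift v (n + 1)) ≤ τ * (K * δ) := by
  refine gridNorm_le_of_abs_le h₁ h₂ (mul_nonneg hτ hKδ) fun i j hij => ?_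
  rcases Nat.eq_zero_or_pos n with rfl | hpos
  · rw [show avgShift v 0 = avgShift v (0 + 1) from rfl, sub_self, Pi.zero_apply, Pi.zero_apply,
      abs_zero]
    exact mul_nonneg hτ hKδ
  · have hdiff := h.shift_diff n hpos hn i j hij
    rwa [avgShift, avgShift, max_eq_left hpos, max_eq_left n.succ_pos]

theorem IsConsistent.gridNorm_source_le (h : IsConsistent J₁ J₂ N τ K δ q F u v) (h₁ : 1 ≤ J₁)
    (h₂ : 1 ≤ J₂) (hK : 0 ≤ K) (hδ : 0 ≤ δ) {n : ℕ} {r : ℝ} (hn : n ∈ Finset.Icc 1 N)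
    (hr : 0 ≤ r) (hqp : |q n - p n| ≤ K * (δ + r)) :
    gridNorm J₁ J₂ (residualFst J₁ J₂ τ q F u v n - (q n - p n) • opH J₁ J₂ (dtBar τ u n))
      + gridNorm J₁ J₂ (residualSnd J₁ J₂ τ u v n) ≤ (2 * K + K ^ 2) * (δ + r) := by
  have hfst := gridNorm_le_of_abs_le h₁ h₂ (mul_nonneg hK hδ) (h.residual_fst n hn)
  have hsnd := gridNorm_le_of_abs_le h₁ h₂ (mul_nonneg hK hδ) (h.residual_snd n hn)
  have hvel := gridNorm_le_of_abs_le h₁ h₂ hK (h.velocity n hn)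
  have hdamp := mul_le_mul hqp hvel (gridNorm_nonneg _) (by positivity)
  have htri := gridNorm_sub_le (J₁ := J₁) (J₂ := J₂) (residualFst J₁ J₂ τ q F u v n)
    ((q n - p n) • opH J₁ J₂ (dtBar τ u n))
  rw [gridNorm_smul] at htri
  linarith [mul_nonneg hK hr]

theorem IsConsistent.error_le (h : IsConsistent J₁ J₂ N τ K δ q F u v) (m : IsMesh T J₁ J₂ N τ)
    (hUV : IsDampedSolution J₁ J₂ N τ p (fun n => opH J₁ J₂ (F n)) 0 0 U V)
    (hK : 0 ≤ K) (hδ : 0 ≤ δ) (hp : ∀ n ∈ Finset.Icc 1 N, 0 ≤ p n)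
    (hqp : ∀ n ∈ Finset.Icc 1 N, |q n - p n| ≤ K * (δ + gridNorm J₁ J₂ (v n - V n)))
    (he₁ : gridNorm J₁ J₂ (dt τ (u - U) 1) ≤ K * δ) (hη₁ : gridNorm J₁ J₂ (v 1 - V 1) ≤ K * δ)
    (hη₀ : gridNorm J₁ J₂ (v 0 - V 0) ≤ K * δ) {n : ℕ} (hn : n ∈ Finset.Icc 1 N) :
    gridNorm J₁ J₂ (dt τ (u - U) (n + 1)) ≤ stabilityConst (2 * K + K ^ 2) T * δ ∧
      gridNorm J₁ J₂ (v (n + 1) - V (n + 1)) ≤ stabilityConst (2 * K + K ^ 2) T * δ ∧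
      gridNorm J₁ J₂ (v n - V n) ≤ stabilityConst (2 * K + K ^ 2) T * δ := by
  obtain ⟨h1n, hnN⟩ := Finset.mem_Icc.1 hn
  have hN : 1 ≤ N := h1n.trans hnN
  have hKδ := mul_nonneg hK hδ
  have hmono : K * δ ≤ (2 * K + K ^ 2) * δ := by nlinarith [mul_nonneg (sq_nonneg K) hδ]
  exact (h.error hN hUV).stability m (by positivity) hδ hp (he₁.trans hmono) (hη₁.trans hmono)
    (hη₀.trans hmono)
    (fun n hn => (h.gridNorm_avgShift_le m.one_le_fst m.one_le_snd hN hKδ hn).trans hmono)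
    (fun n hn => (h.gridNorm_avgShift_sub_le m.one_le_fst m.one_le_snd m.step_pos.le hKδ hn).trans
      (mul_le_mul_of_nonneg_left hmono m.step_pos.le))
    (fun n hn => h.gridNorm_source_le m.one_le_fst m.one_le_snd hK hδ hn (gridNorm_nonneg _)
      (hqp n hn)) hnN

theorem IsSchemeSolution.isDampedSolution {P : ℝ → ℝ} {f : ℝ → ℝ → ℝ → ℝ} {u₀ u₁ : ℝ → ℝ → ℝ}
    (h : IsSchemeSolution P f u₀ u₁ J₁ J₂ N τ U V) :
    IsDampedSolution J₁ J₂ N τ (fun n => P (normF J₁ J₂ (V n) ^ 2))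
      (fun n => opH J₁ J₂ (sample J₁ J₂ τ f n)) 0 0 U V where
  trace_fst n hn := ⟨fun j hj => ⟨(h.bdry_x n hn j hj).1, (h.bdry_x n hn j hj).2.1⟩,
    fun i hi => ⟨(h.bdry_y n hn i hi).1, (h.bdry_y n hn i hi).2.1⟩⟩
  trace_snd n hn := ⟨fun j hj => (h.bdry_x n hn j hj).2.2, fun i hi => (h.bdry_y n hn i hi).2.2⟩
  trace_shift _ _ := Submodule.zero_mem _
  eq_fst n hn i j hij := by
    rw [Pi.zero_apply, sub_zero]
    exact h.eqU n hn i hij.1 j hij.2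
  eq_snd n hn i j hij := by
    rw [Pi.zero_apply, Pi.zero_apply, Pi.zero_apply, add_zero]
    exact h.eqV n hn i hij.1 j hij.2

end Consistency

end Grid

/-! ### Taylor expansion and difference quotients -/

section Taylor

variable {s : Set ℝ} {m : ℕ} {M : ℝ} {φ : ℕ → ℝ → ℝ}

/-- `φ k` is the `k`-th derivative of `φ 0` on `s` for `k ≤ m`, and all these derivatives are
bounded by `M`. -/
structure DerivChain (s : Set ℝ) (m : ℕ) (M : ℝ) (φ : ℕ → ℝ → ℝ) : Prop where
  deriv : ∀ k < m, ∀ x ∈ s, HasDerivWithinAt (φ k) (φ (k + 1) x) s x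
  bound : ∀ k ≤ m, ∀ x ∈ s, |φ k x| ≤ M

/-- The remainder at `y` of the Taylor expansion about `x`, up to order `m - 1`, of `φ 0` with
derivatives `φ k`. -/
def taylorRemainder (φ : ℕ → ℝ → ℝ) (m : ℕ) (x y : ℝ) : ℝ :=
  φ 0 y - ∑ k ∈ Finset.range m, φ k x * (y - x) ^ k / (k.factorial : ℝ)

theorem hasDerivWithinAt_taylorRemainder {x y : ℝ}
    (h : HasDerivWithinAt (φ 0) (φ 1 y) s y) (m : ℕ) :
    HasDerivWithinAt (taylorRemainder φ (m + 1) x)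
      (taylorRemainder (fun k => φ (k + 1)) m x y) s y := by
  refine h.sub ?_
  have hterm (k : ℕ) (_ : k ∈ Finset.range (m + 1)) : HasDerivWithinAt
      (fun z => φ k x * (z - x) ^ k / (k.factorial : ℝ))
      (φ k x * (k * (y - x) ^ (k - 1) * 1) / (k.factorial : ℝ)) s y :=
    ((((hasDerivAt_id y).sub_const x).pow k).const_mul (φ k x)).div_const _ |>.hasDerivWithinAt
  convert HasDerivWithinAt.fun_sum hterm using 1
  rw [Finset.sum_range_succ']
  simp only [Nat.cast_zero, zero_mul, mul_zero, zero_div, add_zero]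
  refine Finset.sum_congr rfl fun k _ => ?_
  rw [Nat.factorial_succ, Nat.add_sub_cancel]
  push_cast
  field_simp

theorem abs_taylorRemainder_le [s.OrdConnected]
    (h : ∀ k < m, ∀ x ∈ s, HasDerivWithinAt (φ k) (φ (k + 1) x) s x)
    (hM : ∀ x ∈ s, |φ m x| ≤ M) {x y : ℝ} (hx : x ∈ s) (hy : y ∈ s) :
    |taylorRemainder φ m x y| ≤ M * |y - x| ^ m := by
  induction m generalizing φ y with
  | zero => simpa [taylorRemainder] using hM y hy
  | succ m ih =>
    have hsub : uIcc x y ⊆ s := OrdConnected.uIcc_subset inferInstance hx hy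
    have hbound (z : ℝ) (hz : z ∈ uIcc x y) :
        ‖taylorRemainder (fun k => φ (k + 1)) m x z‖ ≤ M * |y - x| ^ m :=
      (ih (fun k hk => h (k + 1) (by omega)) hM (hsub hz)).trans
        (mul_le_mul_of_nonneg_left
          (pow_le_pow_left₀ (abs_nonneg _) (abs_sub_left_of_mem_uIcc hz) m)
          ((abs_nonneg _).trans (hM x hx)))
    have hmvt := (convex_uIcc x y).norm_image_sub_le_of_norm_hasDerivWithin_le
      (fun z hz => (hasDerivWithinAt_taylorRemainder (h 0 (by omega) z (hsub hz)) m).mono hsub)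
      hbound left_mem_uIcc right_mem_uIcc
    have hzero : taylorRemainder φ (m + 1) x x = 0 := by
      simp [taylorRemainder, Finset.sum_range_succ']
    rwa [hzero, sub_zero, Real.norm_eq_abs, Real.norm_eq_abs, mul_assoc, ← pow_succ] at hmvt

theorem hasDerivWithinAt_integral {f : ℝ → ℝ} {a b z : ℝ} (hf : ContinuousOn f (uIcc a b))
    (hz : z ∈ uIcc a b) :
    HasDerivWithinAt (fun y => ∫ t in a..y, f t) (f z) (uIcc a b) z := by
  have hint : IntervalIntegrable f MeasureTheory.volume a z :=
    (hf.mono (uIcc_subset_uIcc left_mem_uIcc hz)).intervalIntegrable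
  rw [uIcc] at hf hz ⊢
  have : Fact (z ∈ Icc (a ⊓ b) (a ⊔ b)) := ⟨hz⟩
  exact intervalIntegral.integral_hasDerivWithinAt_right hint
    (hf.stronglyMeasurableAtFilter_nhdsWithin measurableSet_Icc z) (hf z hz)

namespace DerivChain

theorem shift {l n : ℕ} (h : DerivChain s m M φ) (hn : n + l ≤ m) :
    DerivChain s n M (fun k => φ (k + l)) where
  deriv k hk x hx := k.add_right_comm l 1 ▸ h.deriv (k + l) (by omega) x hx
  bound k hk x hx := h.bound (k + l) (by omega) x hx

theorem continuousOn (h : DerivChain s m M φ) {k : ℕ} (hk : k < m) : ContinuousOn (φ k) s :=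
  fun x hx => (h.deriv k hk x hx).continuousWithinAt

theorem nonneg (h : DerivChain s m M φ) {x : ℝ} (hx : x ∈ s) : 0 ≤ M :=
  (abs_nonneg _).trans (h.bound 0 (Nat.zero_le _) x hx)

variable [s.OrdConnected] {x d : ℝ}

theorem taylor {n : ℕ} (h : DerivChain s m M φ) (hn : n ≤ m) (hx : x ∈ s) (hd : x + d ∈ s) :
    |φ 0 (x + d) - ∑ k ∈ Finset.range n, φ k x * d ^ k / (k.factorial : ℝ)| ≤ M * |d| ^ n := by
  have hrem := abs_taylorRemainder_le (m := n) (fun k hk => h.deriv k (by omega)) (h.bound n hn)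
    hx hd
  rwa [taylorRemainder, add_sub_cancel_left] at hrem

theorem abs_image_sub_le (h : DerivChain s m M φ) (hm : 1 ≤ m) {y : ℝ} (hx : x ∈ s) (hy : y ∈ s) :
    |φ 0 y - φ 0 x| ≤ M * |y - x| := by
  simpa [taylorRemainder] using abs_taylorRemainder_le (m := 1)
    (fun k hk => h.deriv k (by omega)) (h.bound 1 hm) hx hy

theorem taylor_two (h : DerivChain s m M φ) (hm : 2 ≤ m) (hx : x ∈ s) (hd : x + d ∈ s) :
    |φ 0 (x + d) - (φ 0 x + φ 1 x * d)| ≤ M * |d| ^ 2 := by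
  simpa [Finset.sum_range_succ] using h.taylor hm hx hd

theorem taylor_three (h : DerivChain s m M φ) (hm : 3 ≤ m) (hx : x ∈ s) (hd : x + d ∈ s) :
    |φ 0 (x + d) - (φ 0 x + φ 1 x * d + φ 2 x * d ^ 2 / 2)| ≤ M * |d| ^ 3 := by
  simpa [Finset.sum_range_succ] using h.taylor hm hx hd

theorem taylor_four (h : DerivChain s m M φ) (hm : 4 ≤ m) (hx : x ∈ s) (hd : x + d ∈ s) :
    |φ 0 (x + d) - (φ 0 x + φ 1 x * d + φ 2 x * d ^ 2 / 2 + φ 3 x * d ^ 3 / 6)|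
      ≤ M * |d| ^ 4 := by
  simpa [Finset.sum_range_succ, Nat.factorial] using h.taylor hm hx hd

theorem taylor_six (h : DerivChain s m M φ) (hm : 6 ≤ m) (hx : x ∈ s) (hd : x + d ∈ s) :
    |φ 0 (x + d) - (φ 0 x + φ 1 x * d + φ 2 x * d ^ 2 / 2 + φ 3 x * d ^ 3 / 6
      + φ 4 x * d ^ 4 / 24 + φ 5 x * d ^ 5 / 120)| ≤ M * |d| ^ 6 := by
  simpa [Finset.sum_range_succ, Nat.factorial] using h.taylor hm hx hd

variable {τ : ℝ}

theorem abs_second_diff_le (h : DerivChain s m M φ) (hm : 2 ≤ m) (hx : x ∈ s) (hd : x + d ∈ s)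
    (hd' : x - d ∈ s) : |φ 0 (x + d) - 2 * φ 0 x + φ 0 (x - d)| ≤ 2 * M * d ^ 2 := by
  rw [sub_eq_add_neg] at hd' ⊢
  have hright := abs_le.1 (h.taylor_two hm hx hd)
  have hleft := abs_le.1 (h.taylor_two hm hx hd')
  rw [sq_abs] at hright
  rw [abs_neg, sq_abs] at hleft
  rw [← sub_eq_add_neg] at *
  exact abs_le.2 ⟨by linarith, by linarith⟩

theorem abs_third_diff_le (h : DerivChain s m M φ) (hm : 3 ≤ m) (hτ : 0 ≤ τ) (hx : x ∈ s)
    (h₁ : x + τ ∈ s) (h₂ : x + 2 * τ ∈ s) (h₃ : x - τ ∈ s) :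
    |φ 0 (x + 2 * τ) - 3 * φ 0 (x + τ) + 3 * φ 0 x - φ 0 (x - τ)| ≤ 12 * M * τ ^ 3 := by
  rw [sub_eq_add_neg x] at h₃ ⊢
  have ht₁ := abs_le.1 (h.taylor_three hm hx h₁)
  have ht₂ := abs_le.1 (h.taylor_three hm hx h₂)
  have ht₃ := abs_le.1 (h.taylor_three hm hx h₃)
  rw [abs_of_nonneg hτ] at ht₁
  rw [abs_of_nonneg (by positivity)] at ht₂
  rw [abs_neg, abs_of_nonneg hτ] at ht₃
  exact abs_le.2 ⟨by linarith, by linarith⟩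

theorem abs_central_quot_sub_le (h : DerivChain s m M φ) (hm : 3 ≤ m) (hτ : 0 < τ) (hx : x ∈ s)
    (h₁ : x + τ ∈ s) (h₂ : x - τ ∈ s) :
    |(φ 0 (x + τ) - φ 0 (x - τ)) / (2 * τ) - φ 1 x| ≤ M * τ ^ 2 := by
  rw [sub_eq_add_neg x] at h₂ ⊢
  have ht₁ := abs_le.1 (h.taylor_three hm hx h₁)
  have ht₂ := abs_le.1 (h.taylor_three hm hx h₂)
  rw [abs_of_nonneg hτ.le] at ht₁
  rw [abs_neg, abs_of_nonneg hτ.le] at ht₂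
  rw [div_sub' (by positivity), abs_div, abs_of_pos (show 0 < 2 * τ by positivity),
    div_le_iff₀ (by positivity)]
  exact abs_le.2 ⟨by linarith, by linarith⟩

theorem abs_second_quot_sub_le (h : DerivChain s m M φ) (hm : 4 ≤ m) (hτ : 0 < τ) (hx : x ∈ s)
    (h₁ : x + τ ∈ s) (h₂ : x - τ ∈ s) :
    |(φ 0 (x + τ) - 2 * φ 0 x + φ 0 (x - τ)) / τ ^ 2 - φ 2 x| ≤ 2 * M * τ ^ 2 := by
  rw [sub_eq_add_neg x] at h₂ ⊢
  have ht₁ := abs_le.1 (h.taylor_four hm hx h₁)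
  have ht₂ := abs_le.1 (h.taylor_four hm hx h₂)
  rw [abs_of_nonneg hτ.le] at ht₁
  rw [abs_neg, abs_of_nonneg hτ.le] at ht₂
  rw [div_sub' (by positivity), abs_div, abs_of_pos (show 0 < τ ^ 2 by positivity),
    div_le_iff₀ (by positivity)]
  exact abs_le.2 ⟨by linarith, by linarith⟩

theorem abs_forward_quot_sub_le (h : DerivChain s m M φ) (hm : 3 ≤ m) (hτ : 0 < τ) (hx : x ∈ s)
    (h₁ : x + τ ∈ s) :
    |(φ 0 (x + τ) - φ 0 x) / τ - (φ 1 x + τ / 2 * φ 2 x)| ≤ M * τ ^ 2 := by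
  have ht := abs_le.1 (h.taylor_three hm hx h₁)
  rw [abs_of_nonneg hτ.le] at ht
  rw [div_sub' hτ.ne', abs_div, abs_of_pos hτ, div_le_iff₀ hτ]
  exact abs_le.2 ⟨by linarith, by linarith⟩

theorem abs_compact_sub_le (h : DerivChain s m M φ) (hm : 6 ≤ m) (hd : d ≠ 0) (hx : x ∈ s)
    (h₁ : x + d ∈ s) (h₂ : x - d ∈ s) :
    |(φ 2 (x + d) + 10 * φ 2 x + φ 2 (x - d)) / 12
      - (φ 0 (x + d) - 2 * φ 0 x + φ 0 (x - d)) / d ^ 2| ≤ 3 * M * d ^ 4 := by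
  rw [sub_eq_add_neg x] at h₂ ⊢
  have h₀r := abs_le.1 (h.taylor_six hm hx h₁)
  have h₀l := abs_le.1 (h.taylor_six hm hx h₂)
  have h₂r := abs_le.1 ((h.shift (l := 2) (n := 4) hm).taylor_four le_rfl hx h₁)
  have h₂l := abs_le.1 ((h.shift (l := 2) (n := 4) hm).taylor_four le_rfl hx h₂)
  have heven₆ : |d| ^ 6 = d ^ 6 := Even.pow_abs (by decide) d
  have heven₄ : |d| ^ 4 = d ^ 4 := Even.pow_abs (by decide) d
  rw [abs_neg] at h₀l h₂l
  simp only [heven₆, heven₄, Nat.reduceAdd] at h₀r h₀l h₂r h₂l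
  have havg : |(φ 2 (x + d) + 10 * φ 2 x + φ 2 (x + -d)) / 12 - (φ 2 x + φ 4 x * d ^ 2 / 12)|
      ≤ M * d ^ 4 := by
    exact abs_le.2 ⟨by linarith, by linarith⟩
  have hdiff : |(φ 0 (x + d) - 2 * φ 0 x + φ 0 (x + -d)) / d ^ 2 - (φ 2 x + φ 4 x * d ^ 2 / 12)|
      ≤ 2 * M * d ^ 4 := by
    rw [div_sub' (by positivity), abs_div, abs_of_pos (show 0 < d ^ 2 by positivity),
      div_le_iff₀ (by positivity)]
    exact abs_le.2 ⟨by linarith, by linarith⟩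
  have htri := abs_sub_le ((φ 2 (x + d) + 10 * φ 2 x + φ 2 (x + -d)) / 12)
    (φ 2 x + φ 4 x * d ^ 2 / 12) ((φ 0 (x + d) - 2 * φ 0 x + φ 0 (x + -d)) / d ^ 2)
  rw [abs_sub_comm (φ 2 x + _)] at htri
  linarith

theorem taylor_primitive (h : DerivChain s m M φ) (hm : 4 ≤ m) (hx : x ∈ s) (hd : x + d ∈ s) :
    |(∫ z in x..(x + d), φ 0 z)
      - (φ 0 x * d + φ 1 x * d ^ 2 / 2 + φ 2 x * d ^ 3 / 6 + φ 3 x * d ^ 4 / 24)|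
      ≤ M * |d| ^ 5 := by
  have hsub : uIcc x (x + d) ⊆ s := OrdConnected.uIcc_subset inferInstance hx hd
  let ψ : ℕ → ℝ → ℝ
    | 0 => fun y => ∫ z in x..y, φ 0 z
    | k + 1 => φ k
  have hψ : ∀ k < 5, ∀ y ∈ uIcc x (x + d),
      HasDerivWithinAt (ψ k) (ψ (k + 1) y) (uIcc x (x + d)) y
    | 0, _, _, hy => hasDerivWithinAt_integral ((h.continuousOn (by omega)).mono hsub) hy
    | k + 1, hk, y, hy => (h.deriv k (by omega) y (hsub hy)).mono hsub
  have hrem := abs_taylorRemainder_le hψ (fun z hz => h.bound 4 hm z (hsub hz)) left_mem_uIcc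
    right_mem_uIcc
  simpa [taylorRemainder, Finset.sum_range_succ, Nat.factorial, ψ] using hrem

theorem abs_simpson_panel_le (h : DerivChain s m M φ) (hm : 4 ≤ m) (hτ : 0 ≤ τ) (hx : x ∈ s)
    (h₁ : x + τ ∈ s) (h₂ : x - τ ∈ s) :
    |(∫ z in (x - τ)..(x + τ), φ 0 z) - τ / 3 * (φ 0 (x - τ) + 4 * φ 0 x + φ 0 (x + τ))|
      ≤ 4 * M * τ ^ 5 := by
  have hint {y : ℝ} (hy : y ∈ s) : IntervalIntegrable (φ 0) MeasureTheory.volume x y :=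
    ((h.continuousOn (by omega)).mono
      (OrdConnected.uIcc_subset inferInstance hx hy)).intervalIntegrable
  rw [← intervalIntegral.integral_interval_sub_left (hint h₁) (hint h₂)]
  rw [sub_eq_add_neg x] at h₂ ⊢
  have hr := abs_le.1 (h.taylor_primitive hm hx h₁)
  have hl := abs_le.1 (h.taylor_primitive hm hx h₂)
  have hr₀ := abs_le.1 (h.taylor_four hm hx h₁)
  have hl₀ := abs_le.1 (h.taylor_four hm hx h₂)
  have hslack := mul_nonneg (h.nonneg hx) (pow_nonneg hτ 5)
  rw [abs_of_nonneg hτ] at hr hr₀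
  rw [abs_neg, abs_of_nonneg hτ] at hl hl₀
  have hτ₃ : 0 ≤ τ / 3 := by positivity
  have hup := mul_le_mul_of_nonneg_left (add_le_add hr₀.2 hl₀.2) hτ₃
  have hlow := mul_le_mul_of_nonneg_left (add_le_add hr₀.1 hl₀.1) hτ₃
  exact abs_le.2 ⟨by linarith, by linarith⟩

end DerivChain

end Taylor

/-! ### The composite Simpson rule -/

section Simpson

/-- The composite Simpson rule on `[0, 1]` with nodes `i * step J`, `i ≤ 2 * J`, as a function of
the nodal values. -/
def simpson (J : ℕ) (q : ℕ → ℝ) : ℝ :=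
  step J / 3 * ∑ i ∈ Finset.range J, (q (2 * i) + 4 * q (2 * i + 1) + q (2 * i + 2))

variable {J : ℕ} {q r : ℕ → ℝ}

theorem simpson_sub (q r : ℕ → ℝ) :
    simpson J q - simpson J r = simpson J (fun i => q i - r i) := by
  rw [simpson, simpson, simpson, ← mul_sub, ← Finset.sum_sub_distrib]
  congr 1
  exact Finset.sum_congr rfl fun i _ => by ring

theorem simpson_const (hJ : 1 ≤ J) (c : ℝ) : simpson J (fun _ => c) = c := by
  have hmul := step_mul hJ
  push_cast at hmul
  simp only [simpson, Finset.sum_const, Finset.card_range, nsmul_eq_mul]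
  linear_combination c * hmul

theorem simpson_mono (h : ∀ i ≤ 2 * J, q i ≤ r i) : simpson J q ≤ simpson J r := by
  refine mul_le_mul_of_nonneg_left (Finset.sum_le_sum fun i hi => ?_)
    (div_nonneg (step_nonneg J) (by norm_num))
  rw [Finset.mem_range] at hi
  linarith [h (2 * i) (by omega), h (2 * i + 1) (by omega), h (2 * i + 2) (by omega)]

theorem abs_simpson_le (J : ℕ) (q : ℕ → ℝ) : |simpson J q| ≤ simpson J (fun i => |q i|) := by
  have hneg : simpson J (fun i => -q i) = -simpson J q := by
    simpa [simpson] using (simpson_sub (J := J) 0 q).symm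
  exact abs_le'.2 ⟨simpson_mono fun i _ => le_abs_self (q i),
    hneg ▸ simpson_mono fun i _ => neg_le_abs (q i)⟩

theorem abs_simpson_le_of_abs_le (hJ : 1 ≤ J) {c : ℝ} (h : ∀ i ≤ 2 * J, |q i| ≤ c) :
    |simpson J q| ≤ c :=
  ((abs_simpson_le J q).trans (simpson_mono h)).trans_eq (simpson_const hJ c)

theorem sum_interior_eq_sum_range (h₀ : q 0 = 0) :
    ∑ i ∈ Finset.Icc 1 (2 * J - 1), q i = ∑ i ∈ Finset.range J, (q (2 * i + 1) + q (2 * i)) := by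
  have hpair : ∑ i ∈ Finset.range (2 * J), q i
      = ∑ i ∈ Finset.range J, (q (2 * i + 1) + q (2 * i)) := by
    induction J with
    | zero => simp
    | succ J ih =>
      rw [Finset.sum_range_succ, ← ih, mul_add_one, Finset.sum_range_succ, Finset.sum_range_succ]
      ring
  rw [← hpair, ← Finset.Ico_add_one_right_eq_Icc, Finset.range_eq_Ico]
  refine Finset.sum_subset (fun i hi => ?_) fun i hi hi' => ?_
  · rw [Finset.mem_Ico] at hi ⊢; omega
  · rw [Finset.mem_Ico] at hi hi'
    rwa [show i = 0 by omega]

theorem simpson_eq_of_endpoints (h₀ : q 0 = 0) (h₁ : q (2 * J) = 0) :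
    simpson J q = step J * ∑ i ∈ Finset.range J, (4 / 3 * q (2 * i + 1) + 2 / 3 * q (2 * i)) := by
  have htelescope := Finset.sum_range_sub (fun i => q (2 * i)) J
  rw [h₁, mul_zero, h₀, sub_zero, Finset.sum_sub_distrib] at htelescope
  simp only [mul_add_one] at htelescope
  simp only [simpson, Finset.sum_add_distrib, ← Finset.mul_sum]
  linear_combination step J / 3 * htelescope

theorem simpson_le_sum (hq : ∀ i, 0 ≤ q i) (h₀ : q 0 = 0) (h₁ : q (2 * J) = 0) :
    simpson J q ≤ 4 / 3 * (step J * ∑ i ∈ Finset.Icc 1 (2 * J - 1), q i) := by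
  rw [simpson_eq_of_endpoints h₀ h₁, sum_interior_eq_sum_range h₀, mul_left_comm (4 / 3 : ℝ),
    Finset.mul_sum _ _ (4 / 3 : ℝ)]
  refine mul_le_mul_of_nonneg_left (Finset.sum_le_sum fun i _ => ?_) (step_nonneg J)
  linarith [hq (2 * i)]

theorem mul_step_mem {i : ℕ} (hJ : 1 ≤ J) (hi : i ≤ 2 * J) :
    (i : ℝ) * step J ∈ Icc (0 : ℝ) 1 := by
  refine ⟨mul_nonneg i.cast_nonneg (step_nonneg J), ?_⟩
  rw [← step_mul hJ]
  exact mul_le_mul_of_nonneg_right (by exact_mod_cast hi) (step_nonneg J)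

variable {s : Set ℝ} {m : ℕ} {M : ℝ} {φ ψ : ℕ → ℝ → ℝ}

theorem DerivChain.abs_integral_sub_simpson_le (h : DerivChain (Icc 0 1) m M φ) (hm : 4 ≤ m)
    (hJ : 1 ≤ J) :
    |(∫ x in (0 : ℝ)..1, φ 0 x) - simpson J (fun i => φ 0 (i * step J))| ≤ 2 * M * step J ^ 4 := by
  let a (i : ℕ) : ℝ := ((2 * i : ℕ) : ℝ) * step J
  have hnode (i : ℕ) (hi : i ≤ 2 * J) : (i : ℝ) * step J ∈ Icc (0 : ℝ) 1 := mul_step_mem hJ hi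
  have hsplit : ∑ i ∈ Finset.range J, ∫ x in a i..a (i + 1), φ 0 x
      = ∫ x in (0 : ℝ)..1, φ 0 x := by
    rw [intervalIntegral.sum_integral_adjacent_intervals fun i hi =>
      ((h.continuousOn (k := 0) (by omega)).mono (uIcc_subset_Icc (hnode _ (by omega))
        (hnode _ (by omega)))).intervalIntegrable]
    simp only [step_mul hJ, mul_zero, Nat.cast_zero, zero_mul]
  have hpanel (i : ℕ) (hi : i ∈ Finset.range J) :
      |(∫ x in a i..a (i + 1), φ 0 x) - step J / 3 * (φ 0 ((2 * i : ℕ) * step J)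
          + 4 * φ 0 ((2 * i + 1 : ℕ) * step J) + φ 0 ((2 * i + 2 : ℕ) * step J))|
        ≤ 4 * M * step J ^ 5 := by
    rw [Finset.mem_range] at hi
    have hleft : ((2 * i : ℕ) : ℝ) * step J = (2 * i + 1 : ℕ) * step J - step J := by
      push_cast; ring
    have hright : ((2 * i + 2 : ℕ) : ℝ) * step J = (2 * i + 1 : ℕ) * step J + step J := by
      push_cast; ring
    have hquad := h.abs_simpson_panel_le hm (step_nonneg J) (hnode (2 * i + 1) (by omega))
      (hright ▸ hnode (2 * i + 2) (by omega)) (hleft ▸ hnode (2 * i) (by omega))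
    rwa [← hleft, ← hright] at hquad
  have hmul := step_mul hJ
  push_cast at hmul
  rw [← hsplit, simpson, Finset.mul_sum, ← Finset.sum_sub_distrib]
  calc _ ≤ ∑ i ∈ Finset.range J, 4 * M * step J ^ 5 :=
        (Finset.abs_sum_le_sum_abs _ _).trans (Finset.sum_le_sum hpanel)
    _ = 2 * M * step J ^ 4 * (2 * J * step J) := by
        rw [Finset.sum_const, Finset.card_range, nsmul_eq_mul]; ring
    _ = 2 * M * step J ^ 4 := by rw [hmul, mul_one]

theorem DerivChain.simpson {χ : ℕ → ℝ → ℕ → ℝ} (hJ : 1 ≤ J)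
    (h : ∀ j ≤ 2 * J, DerivChain s m M (fun k x => χ k x j)) :
    DerivChain s m M (fun k x => simpson J (χ k x)) where
  deriv k hk x hx := by
    refine HasDerivWithinAt.const_mul _ (HasDerivWithinAt.fun_sum fun i hi => ?_)
    rw [Finset.mem_range] at hi
    exact (((h (2 * i) (by omega)).deriv k hk x hx).add
      (((h (2 * i + 1) (by omega)).deriv k hk x hx).const_mul 4)).add
      ((h (2 * i + 2) (by omega)).deriv k hk x hx)
  bound k hk x hx := abs_simpson_le_of_abs_le hJ fun j hj => (h j hj).bound k hk x hx

theorem DerivChain.mul {M' : ℝ} (hφ : DerivChain s m M φ) (hψ : DerivChain s m M' ψ) :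
    DerivChain s m (2 ^ m * (M * M')) (fun k x =>
      ∑ ij ∈ Finset.HasAntidiagonal.antidiagonal k,
        (k.choose ij.1 : ℝ) * (φ ij.1 x * ψ ij.2 x)) where
  deriv k hk x hx := by
    rw [Finset.sum_antidiagonal_choose_succ_mul (fun i j => φ i x * ψ j x),
      ← Finset.sum_add_distrib]
    refine HasDerivWithinAt.fun_sum fun ij hij => ?_
    rw [Finset.HasAntidiagonal.mem_antidiagonal] at hij
    refine (((hφ.deriv ij.1 (by omega) x hx).mul (hψ.deriv ij.2 (by omega) x hx)).const_mul
      (k.choose ij.1 : ℝ)).congr_deriv ?_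
    rw [Nat.choose_symm_of_eq_add hij.symm]
    ring
  bound k hk x hx := by
    have hMM' : 0 ≤ M * M' := mul_nonneg (hφ.nonneg hx) (hψ.nonneg hx)
    calc _ ≤ ∑ ij ∈ Finset.HasAntidiagonal.antidiagonal k, (k.choose ij.1 : ℝ) * (M * M') := by
          refine (Finset.abs_sum_le_sum_abs _ _).trans (Finset.sum_le_sum fun ij hij => ?_)
          rw [Finset.HasAntidiagonal.mem_antidiagonal] at hij
          rw [abs_mul, abs_mul, Nat.abs_cast]
          exact mul_le_mul_of_nonneg_left (mul_le_mul (hφ.bound _ (by omega) x hx)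
            (hψ.bound _ (by omega) x hx) (abs_nonneg _) (hφ.nonneg hx)) (Nat.cast_nonneg _)
      _ = 2 ^ k * (M * M') := by
          rw [← Finset.sum_mul, Finset.Nat.sum_antidiagonal_eq_sum_range_succ
            (fun i _ => (k.choose i : ℝ)) k]
          congr 1
          exact_mod_cast Nat.sum_range_choose k
      _ ≤ 2 ^ m * (M * M') := by gcongr; norm_num

/-- The composite Simpson rule on the unit square. -/
def simpsonSquare (J₁ J₂ : ℕ) (w : ℕ → ℕ → ℝ) : ℝ := simpson J₁ (fun i => simpson J₂ (w i))

variable {J₁ J₂ : ℕ} {w z : ℕ → ℕ → ℝ}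

theorem simpsonSquare_le_sum (hw : ∀ i j, 0 ≤ w i j) (h₀ : w ∈ zeroTrace J₁ J₂) :
    simpsonSquare J₁ J₂ w ≤ 16 / 9 * (step J₁ * step J₂ *
      ∑ i ∈ Finset.Icc 1 (2 * J₁ - 1), ∑ j ∈ Finset.Icc 1 (2 * J₂ - 1), w i j) := by
  let rowSum (i : ℕ) : ℝ := 4 / 3 * (step J₂ * ∑ j ∈ Finset.Icc 1 (2 * J₂ - 1), w i j)
  have hrow (i : ℕ) (hi : i ≤ 2 * J₁) : simpson J₂ (w i) ≤ rowSum i :=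
    simpson_le_sum (hw i) (h₀.2 i hi).1 (h₀.2 i hi).2
  have hnonneg (i : ℕ) : 0 ≤ rowSum i :=
    mul_nonneg (by norm_num) (mul_nonneg (step_nonneg J₂) (Finset.sum_nonneg fun j _ => hw i j))
  have hedge (i : ℕ) (h : ∀ j ≤ 2 * J₂, w i j = 0) : rowSum i = 0 := by
    have hsum : ∑ j ∈ Finset.Icc 1 (2 * J₂ - 1), w i j = 0 :=
      Finset.sum_eq_zero fun j hj => h j (by rw [Finset.mem_Icc] at hj; omega)
    simp only [rowSum, hsum, mul_zero]
  calc simpsonSquare J₁ J₂ w ≤ simpson J₁ rowSum := simpson_mono hrow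
    _ ≤ 4 / 3 * (step J₁ * ∑ i ∈ Finset.Icc 1 (2 * J₁ - 1), rowSum i) :=
        simpson_le_sum hnonneg (hedge 0 fun j hj => (h₀.1 j hj).1)
          (hedge (2 * J₁) fun j hj => (h₀.1 j hj).2)
    _ = _ := by simp only [rowSum, ← Finset.mul_sum]; ring

theorem sum_interior_square_eq (hw : w ∈ zeroTrace J₁ J₂) :
    ∑ i ∈ Finset.Icc 1 (2 * J₁ - 1), ∑ j ∈ Finset.Icc 1 (2 * J₂ - 1), w i j
      = ∑ i ∈ Finset.range J₁, ∑ j ∈ Finset.range J₂, (w (2 * i + 1) (2 * j + 1)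
        + w (2 * i + 1) (2 * j) + (w (2 * i) (2 * j + 1) + w (2 * i) (2 * j))) := by
  have hedge : ∑ j ∈ Finset.Icc 1 (2 * J₂ - 1), w 0 j = 0 :=
    Finset.sum_eq_zero fun j hj => (hw.1 j (by rw [Finset.mem_Icc] at hj; omega)).1
  rw [sum_interior_eq_sum_range hedge]
  refine Finset.sum_congr rfl fun i hi => ?_
  rw [Finset.mem_range] at hi
  rw [sum_interior_eq_sum_range (hw.2 _ (by omega)).1,
    sum_interior_eq_sum_range (hw.2 _ (by omega)).1, ← Finset.sum_add_distrib]

theorem simpsonSquare_eq (hw : w ∈ zeroTrace J₁ J₂) :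
    simpsonSquare J₁ J₂ w = step J₁ * step J₂ * ∑ i ∈ Finset.range J₁, ∑ j ∈ Finset.range J₂,
      (4 / 3 * (4 / 3 * w (2 * i + 1) (2 * j + 1) + 2 / 3 * w (2 * i + 1) (2 * j))
        + 2 / 3 * (4 / 3 * w (2 * i) (2 * j + 1) + 2 / 3 * w (2 * i) (2 * j))) := by
  have hrow (i : ℕ) (hi : i ≤ 2 * J₁) := simpson_eq_of_endpoints (hw.2 i hi).1 (hw.2 i hi).2
  have hedge (i : ℕ) (hi : i ≤ 2 * J₁) (h : ∀ j ≤ 2 * J₂, w i j = 0) :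
      simpson J₂ (w i) = 0 := by
    rw [hrow i hi, Finset.sum_eq_zero, mul_zero]
    intro j hj
    rw [Finset.mem_range] at hj
    rw [h _ (by omega), h _ (by omega), mul_zero, mul_zero, add_zero]
  rw [simpsonSquare, simpson_eq_of_endpoints (hedge 0 (by omega) fun j hj => (hw.1 j hj).1)
    (hedge (2 * J₁) le_rfl fun j hj => (hw.1 j hj).2), mul_assoc, Finset.mul_sum _ _ (step J₂)]
  congr 1
  refine Finset.sum_congr rfl fun i hi => ?_
  rw [Finset.mem_range] at hi
  rw [hrow _ (by omega), hrow _ (by omega), mul_left_comm, mul_left_comm (2 / 3 : ℝ), ← mul_add,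
    Finset.mul_sum _ _ (4 / 3 : ℝ), Finset.mul_sum _ _ (2 / 3 : ℝ), ← Finset.sum_add_distrib]

theorem normE_sq (J₁ J₂ : ℕ) (w : ℕ → ℕ → ℝ) :
    normE J₁ J₂ w ^ 2 = 4 / 9 * (step J₁ * step J₂ * ∑ i ∈ Finset.range J₁,
      ∑ j ∈ Finset.range J₂, (w (2 * i) (2 * j + 1) ^ 2 + w (2 * i + 1) (2 * j) ^ 2
        + 3 * w (2 * i + 1) (2 * j + 1) ^ 2)) := by
  have hreindex (J : ℕ) (F : ℕ → ℕ → ℝ) :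
      ∑ i ∈ Finset.Icc 1 J, F (2 * i - 2) (2 * i - 1)
        = ∑ i ∈ Finset.range J, F (2 * i) (2 * i + 1) := by
    rw [← Finset.Ico_add_one_right_eq_Icc, Finset.sum_Ico_eq_sum_range, Nat.add_sub_cancel]
    refine Finset.sum_congr rfl fun i _ => ?_
    rw [show 2 * (1 + i) - 2 = 2 * i by omega, show 2 * (1 + i) - 1 = 2 * i + 1 by omega]
  have hinner (a b : ℕ) := hreindex J₂ fun e o => w a o ^ 2 + w b e ^ 2 + 3 * w b o ^ 2
  have hnonneg := mul_nonneg (step_nonneg J₁) (step_nonneg J₂)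
  rw [normE, mul_pow, Real.sq_sqrt (by positivity)]
  simp only [hinner]
  rw [hreindex J₁ fun a b => ∑ j ∈ Finset.range J₂,
    (w a (2 * j + 1) ^ 2 + w b (2 * j) ^ 2 + 3 * w b (2 * j + 1) ^ 2)]
  norm_num

theorem normF_sq (hw : w ∈ zeroTrace J₁ J₂) :
    normF J₁ J₂ w ^ 2 = simpsonSquare J₁ J₂ (fun i j => w i j ^ 2) := by
  have hsq : (fun i j => w i j ^ 2) ∈ zeroTrace J₁ J₂ :=
    ⟨fun j hj => by simp [hw.1 j hj], fun i hi => by simp [hw.2 i hi]⟩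
  rw [normF, Real.sq_sqrt (by positivity), gridNorm_sq, gridInner, normE_sq, simpsonSquare_eq hsq]
  simp only [← pow_two]
  rw [sum_interior_square_eq hsq, ← mul_add, ← mul_add, mul_left_comm, ← Finset.sum_add_distrib]
  simp only [← Finset.sum_add_distrib, Finset.mul_sum]
  exact Finset.sum_congr rfl fun i _ => Finset.sum_congr rfl fun j _ => by ring

theorem abs_normF_sq_sub_le (hw : w ∈ zeroTrace J₁ J₂) (hz : z ∈ zeroTrace J₁ J₂) :
    |normF J₁ J₂ w ^ 2 - normF J₁ J₂ z ^ 2|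
      ≤ 2 * (gridNorm J₁ J₂ (w - z) * (gridNorm J₁ J₂ w + gridNorm J₁ J₂ z)) := by
  let q (i j : ℕ) : ℝ := |(w - z) i j| * |(w + z) i j|
  have habs (y : ℕ → ℕ → ℝ) : gridNorm J₁ J₂ (fun i j => |y i j|) = gridNorm J₁ J₂ y := by
    simp [gridNorm, gridInner]
  have hq : q ∈ zeroTrace J₁ J₂ :=
    ⟨fun j hj => by simp [q, hw.1 j hj, hz.1 j hj], fun i hi => by simp [q, hw.2 i hi, hz.2 i hi]⟩
  have hcs : gridInner J₁ J₂ (fun i j => |(w - z) i j|) (fun i j => |(w + z) i j|)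
      ≤ gridNorm J₁ J₂ (w - z) * (gridNorm J₁ J₂ w + gridNorm J₁ J₂ z) := by
    refine (gridInner_le _ _).trans ?_
    rw [habs, habs]
    exact mul_le_mul_of_nonneg_left (gridNorm_add_le w z) (gridNorm_nonneg _)
  have hdiff : |normF J₁ J₂ w ^ 2 - normF J₁ J₂ z ^ 2| ≤ simpsonSquare J₁ J₂ q := by
    rw [normF_sq hw, normF_sq hz, simpsonSquare, simpsonSquare, simpson_sub]
    refine (abs_simpson_le _ _).trans (simpson_mono fun i _ => ?_)
    rw [simpson_sub]
    refine (abs_simpson_le _ _).trans_eq ?_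
    simp only [q, ← abs_mul, Pi.sub_apply, Pi.add_apply, sq_sub_sq, mul_comm (w i _ + z i _)]
  have hsum := simpsonSquare_le_sum (fun i j => by positivity) hq
  rw [gridInner] at hcs
  have hnonneg : 0 ≤ gridNorm J₁ J₂ (w - z) * (gridNorm J₁ J₂ w + gridNorm J₁ J₂ z) :=
    mul_nonneg (gridNorm_nonneg _) (add_nonneg (gridNorm_nonneg _) (gridNorm_nonneg _))
  linarith

theorem integral_square_eq_iterated {g : ℝ → ℝ → ℝ}
    (hg : ContinuousOn (fun p : ℝ × ℝ => g p.1 p.2) (Icc 0 1 ×ˢ Icc 0 1)) :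
    IntervalIntegrable (fun x => ∫ y in (0 : ℝ)..1, g x y) MeasureTheory.volume 0 1 ∧
      (∫ p in Icc (0 : ℝ) 1 ×ˢ Icc (0 : ℝ) 1, g p.1 p.2)
        = ∫ x in (0 : ℝ)..1, ∫ y in (0 : ℝ)..1, g x y := by
  have hint : MeasureTheory.IntegrableOn (fun p : ℝ × ℝ => g p.1 p.2) (Icc 0 1 ×ˢ Icc 0 1)
      (MeasureTheory.volume.prod MeasureTheory.volume) :=
    hg.integrableOn_compact (isCompact_Icc.prod isCompact_Icc)
  rw [intervalIntegrable_iff_integrableOn_Icc_of_le zero_le_one]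
  simp only [intervalIntegral.integral_of_le (zero_le_one' ℝ),
    ← MeasureTheory.integral_Icc_eq_integral_Ioc]
  refine ⟨?_, MeasureTheory.setIntegral_prod _ hint⟩
  rw [MeasureTheory.IntegrableOn, ← MeasureTheory.Measure.prod_restrict] at hint
  exact hint.integral_prod_left

theorem abs_integral_sub_simpsonSquare_le {M : ℝ} {g : ℝ → ℝ → ℝ} {φ ψ : ℕ → ℝ → ℝ → ℝ}
    (hφg : φ 0 = g) (hψg : ψ 0 = g)
    (hφ : ∀ y ∈ Icc (0 : ℝ) 1, DerivChain (Icc 0 1) 4 M (fun k x => φ k x y))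
    (hψ : ∀ x ∈ Icc (0 : ℝ) 1, DerivChain (Icc 0 1) 4 M (fun k y => ψ k x y))
    (hg : ContinuousOn (fun p : ℝ × ℝ => g p.1 p.2) (Icc 0 1 ×ˢ Icc 0 1))
    (h₁ : 1 ≤ J₁) (h₂ : 1 ≤ J₂) :
    |(∫ p in Icc (0 : ℝ) 1 ×ˢ Icc (0 : ℝ) 1, g p.1 p.2) - simpsonSquare J₁ J₂ (onGrid J₁ J₂ g)|
      ≤ 2 * M * (step J₁ ^ 4 + step J₂ ^ 4) := by
  subst hφg
  let S (x : ℝ) : ℝ := simpson J₂ (fun j => φ 0 x (j * step J₂))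
  obtain ⟨hinner, hfubini⟩ := integral_square_eq_iterated hg
  have hS : DerivChain (Icc 0 1) 4 M (fun k x => simpson J₂ (fun j => φ k x (j * step J₂))) :=
    DerivChain.simpson h₂ fun j hj => hφ _ (mul_step_mem h₂ hj)
  have hSint : IntervalIntegrable S MeasureTheory.volume 0 1 :=
    ContinuousOn.intervalIntegrable_of_Icc zero_le_one (hS.continuousOn (k := 0) (by norm_num))
  have herr₁ : |(∫ x in (0 : ℝ)..1, S x) - simpson J₁ (fun i => S (i * step J₁))|
      ≤ 2 * M * step J₁ ^ 4 := hS.abs_integral_sub_simpson_le le_rfl h₁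
  have herr₂ : |(∫ x in (0 : ℝ)..1, ∫ y in (0 : ℝ)..1, φ 0 x y) - ∫ x in (0 : ℝ)..1, S x|
      ≤ 2 * M * step J₂ ^ 4 := by
    rw [← intervalIntegral.integral_sub hinner hSint]
    have hbound (x : ℝ) (hx : x ∈ uIoc (0 : ℝ) 1) :
        ‖(∫ y in (0 : ℝ)..1, φ 0 x y) - S x‖ ≤ 2 * M * step J₂ ^ 4 := by
      rw [uIoc_of_le zero_le_one] at hx
      have hrow := (hψ x (Ioc_subset_Icc_self hx)).abs_integral_sub_simpson_le le_rfl h₂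
      rwa [hψg] at hrow
    simpa using intervalIntegral.norm_integral_le_of_norm_le_const hbound
  rw [hfubini]
  calc _ ≤ _ := abs_sub_le _ (∫ x in (0 : ℝ)..1, S x) _
    _ ≤ 2 * M * step J₂ ^ 4 + 2 * M * step J₁ ^ 4 := add_le_add herr₂ herr₁
    _ = _ := by ring

end Simpson

/-! ### Mixed partial derivatives -/

section MixedDerivatives

variable {s r : Set ℝ}

theorem abs_le_of_hasDerivWithinAt {ψ : ℝ → ℝ} {t C D : ℝ} (hs : UniqueDiffWithinAt ℝ s t)
    (hD : HasDerivWithinAt ψ D s t)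
    (hC : ∀ᶠ q in nhdsWithin t s, |ψ q - ψ t| ≤ C * |q - t|) : |D| ≤ C := by
  have : (nhdsWithin t (s \ {t})).NeBot :=
    accPt_principal_iff_nhdsWithin.1 (uniqueDiffWithinAt_iff_accPt.1 hs)
  refine le_of_tendsto (hasDerivWithinAt_iff_tendsto_slope.1 hD).abs ?_
  filter_upwards [hC.filter_mono (nhdsWithin_mono t sdiff_subset), self_mem_nhdsWithin]
    with q hq hqt
  rw [slope_def_field, abs_div, div_le_iff₀ (abs_pos.2 (sub_ne_zero.2 hqt.2))]
  exact hq

variable {w wx wt wxt : ℝ → ℝ → ℝ}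

theorem abs_mixed_difference_le (hs : Convex ℝ s) (hr : Convex ℝ r) {ε : ℝ}
    (hx : ∀ t ∈ s, ∀ x ∈ r, HasDerivWithinAt (w t) (wx t x) r x)
    (hxt : ∀ t ∈ s, ∀ x ∈ r, HasDerivWithinAt (fun q => wx q x) (wxt t x) s t)
    (hε : ∀ t ∈ s, ∀ x ∈ r, |wxt t x| ≤ ε) {t₀ t x₀ x : ℝ} (ht₀ : t₀ ∈ s) (ht : t ∈ s)
    (hx₀ : x₀ ∈ r) (hx₁ : x ∈ r) :
    |w t x - w t₀ x - (w t x₀ - w t₀ x₀)| ≤ ε * |t - t₀| * |x - x₀| :=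
  hr.norm_image_sub_le_of_norm_hasDerivWithin_le
    (fun y hy => (hx t ht y hy).sub (hx t₀ ht₀ y hy))
    (fun y hy => hs.norm_image_sub_le_of_norm_hasDerivWithin_le
      (fun q hq => hxt q hq y hy) (fun q hq => hε q hq y hy) ht₀ ht)
    hx₀ hx₁

/-- Peano's form of the symmetry of second derivatives: `∂ₓ ∂ₜ w` is not assumed to exist. -/
theorem hasDerivWithinAt_swap (hs : Convex ℝ s) (hr : Convex ℝ r) (hs' : UniqueDiffOn ℝ s)
    (hx : ∀ t ∈ s, ∀ x ∈ r, HasDerivWithinAt (w t) (wx t x) r x)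
    (ht : ∀ t ∈ s, ∀ x ∈ r, HasDerivWithinAt (fun q => w q x) (wt t x) s t)
    (hxt : ∀ t ∈ s, ∀ x ∈ r, HasDerivWithinAt (fun q => wx q x) (wxt t x) s t)
    (hc : ContinuousOn (fun p : ℝ × ℝ => wxt p.1 p.2) (s ×ˢ r))
    {t₀ x₀ : ℝ} (ht₀ : t₀ ∈ s) (hx₀ : x₀ ∈ r) :
    HasDerivWithinAt (wt t₀) (wxt t₀ x₀) r x₀ := by
  rw [hasDerivWithinAt_iff_isLittleO, Asymptotics.isLittleO_iff]
  intro ε hε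
  obtain ⟨δ, hδ, near⟩ := Metric.continuousOn_iff.1 hc (t₀, x₀) ⟨ht₀, hx₀⟩ ε hε
  set l := wxt t₀ x₀
  set B := Metric.ball t₀ δ
  set B' := Metric.ball x₀ δ
  have hlinear (c y : ℝ) (q : Set ℝ) : HasDerivWithinAt (fun z => c * z) c q y := by
    simpa using (hasDerivWithinAt_id y q).const_mul c
  have hmixed {t x : ℝ} (h : t ∈ s ∩ B) (h' : x ∈ r ∩ B') :
      |w t x - l * t * x - (w t₀ x - l * t₀ * x)
        - (w t x₀ - l * t * x₀ - (w t₀ x₀ - l * t₀ * x₀))| ≤ ε * |t - t₀| * |x - x₀| := by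
    refine abs_mixed_difference_le (w := fun t x => w t x - l * t * x)
      (wx := fun t x => wx t x - l * t) (wxt := fun t x => wxt t x - l)
      (hs.inter (convex_ball t₀ δ)) (hr.inter (convex_ball x₀ δ))
      (fun t ht x hx' => ?_) (fun t ht x hx' => ?_) (fun t ht x hx' => ?_)
      ⟨ht₀, Metric.mem_ball_self hδ⟩ h ⟨hx₀, Metric.mem_ball_self hδ⟩ h'
    · exact ((hx t ht.1 x hx'.1).fun_sub (hlinear _ _ r)).mono inter_subset_left
    · exact ((hxt t ht.1 x hx'.1).fun_sub (hlinear _ _ s)).mono inter_subset_left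
    · exact (near (t, x) ⟨ht.1, hx'.1⟩ (max_lt ht.2 hx'.2)).le
  filter_upwards [self_mem_nhdsWithin, mem_nhdsWithin_of_mem_nhds (Metric.ball_mem_nhds x₀ hδ)]
    with x hxr hxδ
  refine abs_le_of_hasDerivWithinAt (hs' t₀ ht₀)
    (((ht t₀ ht₀ x hxr).sub (ht t₀ ht₀ x₀ hx₀)).sub (hlinear ((x - x₀) * l) t₀ s)) ?_
  filter_upwards [self_mem_nhdsWithin, mem_nhdsWithin_of_mem_nhds (Metric.ball_mem_nhds t₀ hδ)]
    with t hts htδ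
  convert hmixed ⟨hts, htδ⟩ ⟨hxr, hxδ⟩ using 1
  · simp only [Pi.sub_apply]
    ring_nf
  · rw [Real.norm_eq_abs]
    ring

end MixedDerivatives

/-! ### Regularity of the solution -/

theorem partialDeriv_succ_t (T : ℝ) (a b c : ℕ) (u : ℝ → ℝ → ℝ → ℝ) :
    partialDeriv T (a + 1) b c u = dT T (partialDeriv T a b c u) :=
  Function.iterate_succ_apply' _ _ _

theorem partialDeriv_succ_x (T : ℝ) (b c : ℕ) (u : ℝ → ℝ → ℝ → ℝ) (t : ℝ) :
    partialDeriv T 0 (b + 1) c u t = dX (partialDeriv T 0 b c u t) :=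
  Function.iterate_succ_apply' _ _ _

theorem partialDeriv_succ_y (T : ℝ) (c : ℕ) (u : ℝ → ℝ → ℝ → ℝ) (t : ℝ) :
    partialDeriv T 0 0 (c + 1) u t = dY (partialDeriv T 0 0 c u t) :=
  Function.iterate_succ_apply' _ _ _

/-- All derivatives `∂ₜᵃ' ∂ₓᵇ' ∂_yᶜ' u` with `a' ≤ a`, `b' ≤ b`, `c' ≤ c` are bounded by `M`. -/
def BoundedDerivs (T M : ℝ) (a b c : ℕ) (u : ℝ → ℝ → ℝ → ℝ) : Prop :=
  ∀ a' ≤ a, ∀ b' ≤ b, ∀ c' ≤ c, ∀ t ∈ Icc 0 T, ∀ x ∈ Icc (0 : ℝ) 1, ∀ y ∈ Icc (0 : ℝ) 1,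
    |partialDeriv T a' b' c' u t x y| ≤ M

namespace PartialBound

variable {T Q M : ℝ} {a b c a' b' c' : ℕ} {u : ℝ → ℝ → ℝ → ℝ} {t x y : ℝ}

theorem eventually_boundedDerivs (h : PartialBound T Q a b c u) :
    ∀ᶠ M in Filter.atTop, BoundedDerivs T M a b c u := by
  have hcpt : IsCompact (cylinder T) := isCompact_Icc.prod (isCompact_Icc.prod isCompact_Icc)
  have heach : ∀ a' ∈ Iic a, ∀ b' ∈ Iic b, ∀ c' ∈ Iic c, ∀ᶠ M in Filter.atTop,
      ∀ p ∈ cylinder T, |partialDeriv T a' b' c' u p.1 p.2.1 p.2.2| ≤ M := by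
    intro a' ha b' hb c' hc
    obtain ⟨C, hC⟩ := hcpt.exists_bound_of_continuousOn (h.cont a' ha b' hb c' hc)
    filter_upwards [Filter.eventually_ge_atTop C] with M hM p hp using (hC p hp).trans hM
  have hall := (Filter.eventually_all_finite (finite_Iic a)).2 fun a' ha =>
    (Filter.eventually_all_finite (finite_Iic b)).2 fun b' hb =>
      (Filter.eventually_all_finite (finite_Iic c)).2 (heach a' ha b' hb)
  filter_upwards [hall] with M hM a' ha b' hb c' hc t ht x hx y hy using
    hM a' ha b' hb c' hc (t, x, y) ⟨ht, hx, hy⟩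

theorem hasDeriv_t (h : PartialBound T Q a b c u) (ha : a' < a) (hb : b' ≤ b) (hc : c' ≤ c)
    (ht : t ∈ Icc 0 T) (hx : x ∈ Icc (0 : ℝ) 1) (hy : y ∈ Icc (0 : ℝ) 1) :
    HasDerivWithinAt (fun s => partialDeriv T a' b' c' u s x y)
      (partialDeriv T (a' + 1) b' c' u t x y) (Icc 0 T) t := by
  rw [partialDeriv_succ_t]
  exact (h.diff_t a' ha b' hb c' hc t ht x hx y hy).hasDerivWithinAt

theorem hasDeriv_x (hT : 0 < T) (h : PartialBound T Q a b c u) (ha : a' ≤ a) (hb : b' < b)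
    (hc : c' ≤ c) (ht : t ∈ Icc 0 T) (hx : x ∈ Icc (0 : ℝ) 1) (hy : y ∈ Icc (0 : ℝ) 1) :
    HasDerivWithinAt (fun s => partialDeriv T a' b' c' u t s y)
      (partialDeriv T a' (b' + 1) c' u t x y) (Icc 0 1) x := by
  induction a' generalizing t x with
  | zero =>
    rw [partialDeriv_succ_x]
    exact (h.diff_x b' hb c' hc t ht x hx y hy).hasDerivWithinAt
  | succ k ih =>
    refine hasDerivWithinAt_swap (w := fun t x => partialDeriv T k b' c' u t x y)
      (convex_Icc 0 T) (convex_Icc 0 1) (uniqueDiffOn_Icc hT)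
      (fun t ht x hx => ih (by omega) ht hx)
      (fun t ht x hx => h.hasDeriv_t ha hb.le hc ht hx hy)
      (fun t ht x hx => h.hasDeriv_t ha hb hc ht hx hy) ?_ ht hx
    exact (h.cont (k + 1) ha (b' + 1) hb c' hc).comp
      (f := fun p : ℝ × ℝ => (p.1, p.2, y)) (by fun_prop) fun p hp => ⟨hp.1, hp.2, hy⟩

theorem hasDeriv_y (hT : 0 < T) (h : PartialBound T Q a b c u) (ha : a' ≤ a) (hc : c' < c)
    (ht : t ∈ Icc 0 T) (hx : x ∈ Icc (0 : ℝ) 1) (hy : y ∈ Icc (0 : ℝ) 1) :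
    HasDerivWithinAt (fun s => partialDeriv T a' 0 c' u t x s)
      (partialDeriv T a' 0 (c' + 1) u t x y) (Icc 0 1) y := by
  induction a' generalizing t y with
  | zero =>
    rw [partialDeriv_succ_y]
    exact (h.diff_y c' hc t ht x hx y hy).hasDerivWithinAt
  | succ k ih =>
    refine hasDerivWithinAt_swap (w := fun t y => partialDeriv T k 0 c' u t x y)
      (convex_Icc 0 T) (convex_Icc 0 1) (uniqueDiffOn_Icc hT)
      (fun t ht y hy => ih (by omega) ht hy)
      (fun t ht y hy => h.hasDeriv_t ha b.zero_le hc.le ht hx hy)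
      (fun t ht y hy => h.hasDeriv_t ha b.zero_le hc ht hx hy) ?_ ht hy
    exact (h.cont (k + 1) ha 0 b.zero_le (c' + 1) hc).comp
      (f := fun p : ℝ × ℝ => (p.1, x, p.2)) (by fun_prop) fun p hp => ⟨hp.1, hx, hp.2⟩

theorem chain_t (h : PartialBound T Q a b c u) (hM : BoundedDerivs T M a b c u) (hb : b' ≤ b)
    (hc : c' ≤ c) (hx : x ∈ Icc (0 : ℝ) 1) (hy : y ∈ Icc (0 : ℝ) 1) :
    DerivChain (Icc 0 T) a M (fun k t => partialDeriv T k b' c' u t x y) where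
  deriv _ hk _ ht := h.hasDeriv_t hk hb hc ht hx hy
  bound k hk t ht := hM k hk b' hb c' hc t ht x hx y hy

theorem chain_x (hT : 0 < T) (h : PartialBound T Q a b c u) (hM : BoundedDerivs T M a b c u)
    (ht : t ∈ Icc 0 T) (hy : y ∈ Icc (0 : ℝ) 1) :
    DerivChain (Icc 0 1) b M (fun k x => partialDeriv T 0 k 0 u t x y) where
  deriv _ hk _ hx := h.hasDeriv_x hT a.zero_le hk c.zero_le ht hx hy
  bound k hk x hx := hM 0 a.zero_le k hk 0 c.zero_le t ht x hx y hy

theorem chain_y (hT : 0 < T) (h : PartialBound T Q a b c u) (hM : BoundedDerivs T M a b c u)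
    (ht : t ∈ Icc 0 T) (hx : x ∈ Icc (0 : ℝ) 1) :
    DerivChain (Icc 0 1) c M (fun k y => partialDeriv T 0 0 k u t x y) where
  deriv _ hk _ hy := h.hasDeriv_y hT a.zero_le hk ht hx hy
  bound k hk y hy := hM 0 a.zero_le 0 b.zero_le k hk t ht x hx y hy

end PartialBound

theorem DerivChain.add {s : Set ℝ} {m : ℕ} {M M' : ℝ} {φ ψ : ℕ → ℝ → ℝ} (hφ : DerivChain s m M φ)
    (hψ : DerivChain s m M' ψ) : DerivChain s m (M + M') (fun k x => φ k x + ψ k x) where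
  deriv k hk x hx := (hφ.deriv k hk x hx).add (hψ.deriv k hk x hx)
  bound k hk x hx := (abs_add_le _ _).trans (add_le_add (hφ.bound k hk x hx) (hψ.bound k hk x hx))

/-- The regularity of `u` and `v = Δ u` that enters the error estimate, with a common bound. -/
structure IsRegular (T M : ℝ) (u : ℝ → ℝ → ℝ → ℝ) : Prop where
  u_t : ∀ x ∈ Icc (0 : ℝ) 1, ∀ y ∈ Icc (0 : ℝ) 1,
    DerivChain (Icc 0 T) 4 M (fun k t => partialDeriv T k 0 0 u t x y)
  lap_t : ∀ x ∈ Icc (0 : ℝ) 1, ∀ y ∈ Icc (0 : ℝ) 1, DerivChain (Icc 0 T) 3 M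
    (fun k t => partialDeriv T k 2 0 u t x y + partialDeriv T k 0 2 u t x y)
  u_x : ∀ t ∈ Icc 0 T, ∀ y ∈ Icc (0 : ℝ) 1,
    DerivChain (Icc 0 1) 6 M (fun k x => partialDeriv T 0 k 0 u t x y)
  u_y : ∀ t ∈ Icc 0 T, ∀ x ∈ Icc (0 : ℝ) 1,
    DerivChain (Icc 0 1) 6 M (fun k y => partialDeriv T 0 0 k u t x y)
  ux_t : ∀ k ≤ 6, ∀ x ∈ Icc (0 : ℝ) 1, ∀ y ∈ Icc (0 : ℝ) 1,
    DerivChain (Icc 0 T) 1 M (fun l t => partialDeriv T l k 0 u t x y)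
  uy_t : ∀ k ≤ 6, ∀ x ∈ Icc (0 : ℝ) 1, ∀ y ∈ Icc (0 : ℝ) 1,
    DerivChain (Icc 0 T) 1 M (fun l t => partialDeriv T l 0 k u t x y)
  lap_x : ∀ t ∈ Icc 0 T, ∀ y ∈ Icc (0 : ℝ) 1,
    DerivChain (Icc 0 1) 6 M (fun k x => partialDeriv T 0 k 0 (fun t => lap (u t)) t x y)
  lap_y : ∀ t ∈ Icc 0 T, ∀ x ∈ Icc (0 : ℝ) 1,
    DerivChain (Icc 0 1) 6 M (fun k y => partialDeriv T 0 0 k (fun t => lap (u t)) t x y)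
  lap_cont : ∀ t ∈ Icc 0 T,
    ContinuousOn (fun p : ℝ × ℝ => lap (u t) p.1 p.2) (Icc (0 : ℝ) 1 ×ˢ Icc (0 : ℝ) 1)

theorem exists_isRegular {T Q : ℝ} (hT : 0 < T) {u : ℝ → ℝ → ℝ → ℝ} (hS : SolutionBounds T Q u)
    (hC : CompactBounds T Q u) : ∃ M, IsRegular T M u := by
  have hhalf : Filter.Tendsto (fun M : ℝ => M / 2) Filter.atTop Filter.atTop :=
    Filter.tendsto_id.atTop_div_const two_pos
  have hreg : ∀ᶠ M in Filter.atTop, IsRegular T M u := by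
    filter_upwards [hS.tttt.eventually_boundedDerivs,
      hhalf.eventually hS.ttt_xx.eventually_boundedDerivs,
      hhalf.eventually hS.ttt_yy.eventually_boundedDerivs,
      hC.t_x6.eventually_boundedDerivs, hC.t_y6.eventually_boundedDerivs,
      hC.lap_x6.eventually_boundedDerivs, hC.lap_y6.eventually_boundedDerivs]
      with M tttt ttt_xx ttt_yy t_x6 t_y6 lap_x6 lap_y6
    exact
      { u_t := fun x hx y hy => hS.tttt.chain_t tttt le_rfl le_rfl hx hy
        lap_t := fun x hx y hy => add_halves M ▸
          (hS.ttt_xx.chain_t ttt_xx le_rfl le_rfl hx hy).add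
            (hS.ttt_yy.chain_t ttt_yy le_rfl le_rfl hx hy)
        u_x := fun t ht y hy => hC.t_x6.chain_x hT t_x6 ht hy
        u_y := fun t ht x hx => hC.t_y6.chain_y hT t_y6 ht hx
        ux_t := fun k hk x hx y hy => hC.t_x6.chain_t t_x6 hk le_rfl hx hy
        uy_t := fun k hk x hx y hy => hC.t_y6.chain_t t_y6 le_rfl hk hx hy
        lap_x := fun t ht y hy => hC.lap_x6.chain_x hT lap_x6 ht hy
        lap_y := fun t ht x hx => hC.lap_y6.chain_y hT lap_y6 ht hx
        lap_cont := fun t ht => (hC.lap_x6.cont 0 le_rfl 0 (by norm_num) 0 le_rfl).comp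
          (f := fun p : ℝ × ℝ => (t, p.1, p.2)) (by fun_prop) fun p hp => ⟨ht, hp.1, hp.2⟩ }
  exact hreg.exists

section Square

variable {g k : ℝ → ℝ → ℝ}

theorem dX_congr (h : ∀ x ∈ Icc (0 : ℝ) 1, ∀ y ∈ Icc (0 : ℝ) 1, g x y = k x y) :
    ∀ x ∈ Icc (0 : ℝ) 1, ∀ y ∈ Icc (0 : ℝ) 1, dX g x y = dX k x y :=
  fun x hx y hy => derivWithin_congr (fun s hs => h s hs y hy) (h x hx y hy)

theorem dY_congr (h : ∀ x ∈ Icc (0 : ℝ) 1, ∀ y ∈ Icc (0 : ℝ) 1, g x y = k x y) :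
    ∀ x ∈ Icc (0 : ℝ) 1, ∀ y ∈ Icc (0 : ℝ) 1, dY g x y = dY k x y :=
  fun x hx y hy => derivWithin_congr (fun s hs => h x hx s hs) (h x hx y hy)

theorem lap_congr (h : ∀ x ∈ Icc (0 : ℝ) 1, ∀ y ∈ Icc (0 : ℝ) 1, g x y = k x y) :
    ∀ x ∈ Icc (0 : ℝ) 1, ∀ y ∈ Icc (0 : ℝ) 1, lap g x y = lap k x y := fun x hx y hy => by
  rw [lap, lap, dX_congr (dX_congr h) x hx y hy, dY_congr (dY_congr h) x hx y hy]

theorem lap_eq_of_hasDerivWithinAt {φ ψ : ℕ → ℝ → ℝ → ℝ} (hφg : φ 0 = g) (hψg : ψ 0 = g)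
    (hφ : ∀ k < 2, ∀ x ∈ Icc (0 : ℝ) 1, ∀ y ∈ Icc (0 : ℝ) 1,
      HasDerivWithinAt (fun s => φ k s y) (φ (k + 1) x y) (Icc 0 1) x)
    (hψ : ∀ k < 2, ∀ x ∈ Icc (0 : ℝ) 1, ∀ y ∈ Icc (0 : ℝ) 1,
      HasDerivWithinAt (ψ k x) (ψ (k + 1) x y) (Icc 0 1) y) :
    ∀ x ∈ Icc (0 : ℝ) 1, ∀ y ∈ Icc (0 : ℝ) 1, lap g x y = φ 2 x y + ψ 2 x y := by
  have hX : ∀ k < 2, ∀ x ∈ Icc (0 : ℝ) 1, ∀ y ∈ Icc (0 : ℝ) 1, dX (φ k) x y = φ (k + 1) x y :=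
    fun k hk x hx y hy => (hφ k hk x hx y hy).derivWithin (uniqueDiffOn_Icc_zero_one x hx)
  have hY : ∀ k < 2, ∀ x ∈ Icc (0 : ℝ) 1, ∀ y ∈ Icc (0 : ℝ) 1, dY (ψ k) x y = ψ (k + 1) x y :=
    fun k hk x hx y hy => (hψ k hk x hx y hy).derivWithin (uniqueDiffOn_Icc_zero_one y hy)
  intro x hx y hy
  rw [lap, ← dX_congr (hX 0 two_pos) x hx y hy |>.trans (hX 1 one_lt_two x hx y hy), hφg,
    ← dY_congr (hY 0 two_pos) x hx y hy |>.trans (hY 1 one_lt_two x hx y hy), hψg]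

theorem lap_sum_partialDeriv {T Q Q' t : ℝ} (hT : 0 < T) {a n : ℕ} {u : ℝ → ℝ → ℝ → ℝ}
    (hx : PartialBound T Q a 2 0 u) (hy : PartialBound T Q' a 0 2 u) (hn : n ≤ a + 1)
    (ht : t ∈ Icc 0 T) (c : ℕ → ℝ) : ∀ x ∈ Icc (0 : ℝ) 1, ∀ y ∈ Icc (0 : ℝ) 1,
      lap (fun x y => ∑ l ∈ Finset.range n, partialDeriv T l 0 0 u t x y * c l) x y
        = ∑ l ∈ Finset.range n,
          (partialDeriv T l 2 0 u t x y + partialDeriv T l 0 2 u t x y) * c l := by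
  intro x hx' y hy'
  have hle : ∀ l ∈ Finset.range n, l ≤ a := fun l hl => by
    rw [Finset.mem_range] at hl
    omega
  simp only [add_mul, Finset.sum_add_distrib]
  exact lap_eq_of_hasDerivWithinAt
    (φ := fun k x y => ∑ l ∈ Finset.range n, partialDeriv T l k 0 u t x y * c l)
    (ψ := fun k x y => ∑ l ∈ Finset.range n, partialDeriv T l 0 k u t x y * c l) rfl rfl
    (fun k hk x hx' y hy' => .fun_sum fun l hl =>
      (hx.hasDeriv_x hT (hle l hl) hk le_rfl ht hx' hy').mul_const _)
    (fun k hk x hx' y hy' => .fun_sum fun l hl =>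
      (hy.hasDeriv_y hT (hle l hl) hk ht hx' hy').mul_const _) x hx' y hy'

theorem sqIntegral_congr (h : ∀ x ∈ Icc (0 : ℝ) 1, ∀ y ∈ Icc (0 : ℝ) 1, g x y = k x y) :
    sqIntegral g = sqIntegral k :=
  MeasureTheory.setIntegral_congr_fun (measurableSet_Icc.prod measurableSet_Icc)
    fun p hp => by simp only [h p.1 hp.1 p.2 hp.2]

theorem sqIntegral_nonneg (g : ℝ → ℝ → ℝ) : 0 ≤ sqIntegral g :=
  MeasureTheory.integral_nonneg fun _ => sq_nonneg _

theorem sqIntegral_le {M : ℝ} (h : ∀ x ∈ Icc (0 : ℝ) 1, ∀ y ∈ Icc (0 : ℝ) 1, |g x y| ≤ M) :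
    sqIntegral g ≤ M ^ 2 := by
  have hvol : MeasureTheory.volume (Icc (0 : ℝ) 1 ×ˢ Icc (0 : ℝ) 1 : Set (ℝ × ℝ)) = 1 := by
    rw [MeasureTheory.Measure.volume_eq_prod, MeasureTheory.Measure.prod_prod, Real.volume_Icc,
      sub_zero, ENNReal.ofReal_one, one_mul]
  have hle := MeasureTheory.norm_setIntegral_le_of_norm_le_const
    (μ := MeasureTheory.volume) (s := (Icc (0 : ℝ) 1 ×ˢ Icc (0 : ℝ) 1 : Set (ℝ × ℝ)))
    (f := fun p => |g p.1 p.2| ^ 2) (C := M ^ 2) (hvol ▸ ENNReal.one_lt_top) fun p hp => by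
      rw [norm_pow, norm_abs_eq_norm]
      exact pow_le_pow_left₀ (abs_nonneg _) (h p.1 hp.1 p.2 hp.2) 2
  rw [MeasureTheory.measureReal_def, hvol, ENNReal.toReal_one, mul_one] at hle
  exact (le_abs_self _).trans hle

end Square

section Solution

variable {T M : ℝ} {P : ℝ → ℝ} {f : ℝ → ℝ → ℝ → ℝ} {u₀ u₁ : ℝ → ℝ → ℝ} {u : ℝ → ℝ → ℝ → ℝ} {t : ℝ}

theorem IsPlateSolution.hinged_Icc (hT : 0 < T) (hu : IsPlateSolution P T f u₀ u₁ u)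
    (hM : IsRegular T M u) (ht : t ∈ Icc 0 T) {x y : ℝ} (hxy : OnBoundary x y) :
    u t x y = 0 ∧ lap (u t) x y = 0 := by
  have hext {w : ℝ → ℝ} (hw : ContinuousOn w (Icc 0 T)) (h0 : ∀ t ∈ Ioc 0 T, w t = 0) :
      w t = 0 := by
    rw [← closure_Ioc hT.ne] at hw ht
    exact EqOn.of_subset_closure h0 hw continuousOn_const subset_closure subset_rfl ht
  obtain ⟨⟨hx, hy⟩, -⟩ := hxy.imp id id
  exact ⟨hext ((hM.u_t x hx y hy).continuousOn (k := 0) (by norm_num))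
      fun s hs => (hu.hinged s hs x y hxy).1,
    hext ((hM.lap_t x hx y hy).continuousOn (k := 0) (by norm_num))
      fun s hs => (hu.hinged s hs x y hxy).2⟩

theorem IsRegular.abs_lap_lap_le (hM : IsRegular T M u) (ht : t ∈ Icc 0 T) {x y : ℝ}
    (hx : x ∈ Icc (0 : ℝ) 1) (hy : y ∈ Icc (0 : ℝ) 1) : |lap (lap (u t)) x y| ≤ 2 * M := by
  have hxx := (hM.lap_x t ht y hy).bound 2 (by norm_num) x hx
  have hyy := (hM.lap_y t ht x hx).bound 2 (by norm_num) y hy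
  exact (abs_add_le _ _).trans ((add_le_add hxx hyy).trans_eq (two_mul M).symm)

theorem IsRegular.sqIntegral_lap_le (hM : IsRegular T M u) (ht : t ∈ Icc 0 T) :
    sqIntegral (lap (u t)) ≤ M ^ 2 :=
  sqIntegral_le fun x hx y hy => (hM.lap_t x hx y hy).bound 0 (by norm_num) t ht

theorem onGrid_mem_zeroTrace {J₁ J₂ : ℕ} (h₁ : 1 ≤ J₁) (h₂ : 1 ≤ J₂) {g : ℝ → ℝ → ℝ}
    (hg : ∀ x y, OnBoundary x y → g x y = 0) : onGrid J₁ J₂ g ∈ zeroTrace J₁ J₂ := by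
  have hX (i) (hi : i ≤ 2 * J₁) := mul_step_mem h₁ hi
  have hY (j) (hj : j ≤ 2 * J₂) := mul_step_mem h₂ hj
  exact ⟨fun j hj => ⟨hg _ _ ⟨⟨hX 0 (Nat.zero_le _), hY j hj⟩, by simp⟩,
      hg _ _ ⟨⟨hX _ le_rfl, hY j hj⟩, .inr (.inl (step_mul h₁))⟩⟩,
    fun i hi => ⟨hg _ _ ⟨⟨hX i hi, hY 0 (Nat.zero_le _)⟩, by simp⟩,
      hg _ _ ⟨⟨hX i hi, hY _ le_rfl⟩, .inr (.inr (.inr (step_mul h₂)))⟩⟩⟩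

theorem IsRegular.abs_sqIntegral_sub_normF_sq_le (hM : IsRegular T M u) (ht : t ∈ Icc 0 T)
    (hbd : ∀ x y, OnBoundary x y → lap (u t) x y = 0) {J₁ J₂ : ℕ} (h₁ : 1 ≤ J₁) (h₂ : 1 ≤ J₂) :
    |sqIntegral (lap (u t)) - normF J₁ J₂ (onGrid J₁ J₂ (lap (u t))) ^ 2|
      ≤ 32 * M ^ 2 * (step J₁ ^ 4 + step J₂ ^ 4) := by
  have hsq {φ : ℕ → ℝ → ℝ} (h : DerivChain (Icc 0 1) 6 M φ) :
      DerivChain (Icc 0 1) 4 (16 * M ^ 2) (fun k x => ∑ ij ∈ Finset.HasAntidiagonal.antidiagonal k,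
        (k.choose ij.1 : ℝ) * (φ ij.1 x * φ ij.2 x)) := by
    have h4 : DerivChain (Icc 0 1) 4 M φ := h.shift (l := 0) (by norm_num)
    convert h4.mul h4 using 1
    ring
  have hsimpson := abs_integral_sub_simpsonSquare_le (g := fun x y => lap (u t) x y ^ 2)
    (by simp [partialDeriv, sq]) (by simp [partialDeriv, sq]) (fun y hy => hsq (hM.lap_x t ht y hy))
    (fun x hx => hsq (hM.lap_y t ht x hx)) ((hM.lap_cont t ht).pow 2) h₁ h₂
  rw [normF_sq (onGrid_mem_zeroTrace h₁ h₂ hbd)]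
  simp only [sqIntegral, sq_abs]
  exact hsimpson.trans_eq (by ring)

theorem IsPlateSolution.secondInit_eq (hT : 0 < T) (hu : IsPlateSolution P T f u₀ u₁ u) :
    ∀ x ∈ Icc (0 : ℝ) 1, ∀ y ∈ Icc (0 : ℝ) 1,
      secondInit P f u₀ u₁ x y = dT T (dT T u) 0 x y := by
  intro x hx y hy
  have hlap := lap_congr hu.init
  rw [secondInit, ← sqIntegral_congr hlap, ← lap_congr hlap x hx y hy, ← hu.init_deriv x hx y hy,
    ← hu.equation 0 (left_mem_Icc.2 hT.le) x hx y hy]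
  ring

theorem IsPlateSolution.firstStep_eq (hT : 0 < T) (hu : IsPlateSolution P T f u₀ u₁ u) (τ : ℝ) :
    ∀ x ∈ Icc (0 : ℝ) 1, ∀ y ∈ Icc (0 : ℝ) 1, firstStep P f u₀ u₁ τ x y
      = ∑ l ∈ Finset.range 3, partialDeriv T l 0 0 u 0 x y * (τ ^ l / (l.factorial : ℝ)) := by
  intro x hx y hy
  rw [firstStep, hu.secondInit_eq hT x hx y hy, ← hu.init x hx y hy, ← hu.init_deriv x hx y hy]
  simp only [Finset.sum_range_succ, Finset.range_zero, Finset.sum_empty, partialDeriv,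
    Function.iterate_succ_apply', Function.iterate_zero, id_eq, Nat.factorial, Nat.cast_one]
  ring

theorem IsRegular.abs_lap_sub_lap_firstStep_le (hT : 0 < T) (hu : IsPlateSolution P T f u₀ u₁ u)
    {Q : ℝ} (hS : SolutionBounds T Q u) (hM : IsRegular T M u) {τ : ℝ} (hτ : τ ∈ Icc 0 T)
    {x y : ℝ} (hx : x ∈ Icc (0 : ℝ) 1) (hy : y ∈ Icc (0 : ℝ) 1) :
    |lap (u τ) x y - lap (firstStep P f u₀ u₁ τ) x y| ≤ M * τ ^ 3 := by
  have h0 : (0 : ℝ) ∈ Icc 0 T := left_mem_Icc.2 hT.le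
  have htaylor := (hM.lap_t x hx y hy).taylor le_rfl h0 (d := τ) (by rwa [zero_add])
  rw [lap_congr (hu.firstStep_eq hT τ) x hx y hy,
    lap_sum_partialDeriv hT hS.ttt_xx hS.ttt_yy (by norm_num) h0 _ x hx y hy]
  simp only [← mul_div_assoc]
  rwa [zero_add, abs_of_nonneg hτ.1] at htaylor

end Solution

theorem natCast_add_one_mul (n : ℕ) (a : ℝ) : ((n + 1 : ℕ) : ℝ) * a = n * a + a := by
  push_cast; ring

theorem natCast_sub_one_mul {n : ℕ} (hn : 1 ≤ n) (a : ℝ) : ((n - 1 : ℕ) : ℝ) * a = n * a - a := by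
  push_cast [hn]; ring

theorem DerivChain.sub_div_const {s : Set ℝ} {m : ℕ} {M M₁ M₂ : ℝ} {φ ψ : ℕ → ℝ → ℝ}
    (hφ : DerivChain s m M₁ φ) (hψ : DerivChain s m M₂ ψ) (c : ℝ)
    (hM : ∀ k ≤ m, ∀ x ∈ s, |(φ k x - ψ k x) / c| ≤ M) :
    DerivChain s m M (fun k x => (φ k x - ψ k x) / c) where
  deriv k hk x hx := ((hφ.deriv k hk x hx).sub (hψ.deriv k hk x hx)).div_const c
  bound k hk x hx := hM k hk x hx

namespace DerivChain

variable {s : Set ℝ} [s.OrdConnected] {m n i j : ℕ} {M τ : ℝ} {φ : ℕ → ℝ → ℝ}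
  {W : ℕ → ℕ → ℕ → ℝ}

theorem abs_dt2_sub_le (h : DerivChain s m M φ) (hm : 4 ≤ m) (hτ : 0 < τ) (hn : 1 ≤ n)
    (hs : ∀ k ≤ n + 1, (k : ℝ) * τ ∈ s) (hW : ∀ k, W k i j = φ 0 (k * τ)) :
    |dt2 τ W n i j - φ 2 (n * τ)| ≤ 2 * M * τ ^ 2 := by
  have hquot := h.abs_second_quot_sub_le hm hτ (hs n (by omega))
    (natCast_add_one_mul n τ ▸ hs (n + 1) le_rfl) (natCast_sub_one_mul hn τ ▸ hs (n - 1) (by omega))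
  have hdt2 : dt2 τ W n i j
      = (φ 0 (n * τ + τ) - 2 * φ 0 (n * τ) + φ 0 (n * τ - τ)) / τ ^ 2 := by
    simp only [dt2, dt, Nat.add_sub_cancel, hW, natCast_add_one_mul, natCast_sub_one_mul hn]
    field_simp
    ring
  rwa [hdt2]

theorem abs_dtBar_sub_le (h : DerivChain s m M φ) (hm : 3 ≤ m) (hτ : 0 < τ) (hn : 1 ≤ n)
    (hs : ∀ k ≤ n + 1, (k : ℝ) * τ ∈ s) (hW : ∀ k, W k i j = φ 0 (k * τ)) :
    |dtBar τ W n i j - φ 1 (n * τ)| ≤ M * τ ^ 2 := by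
  have hquot := h.abs_central_quot_sub_le hm hτ (hs n (by omega))
    (natCast_add_one_mul n τ ▸ hs (n + 1) le_rfl) (natCast_sub_one_mul hn τ ▸ hs (n - 1) (by omega))
  rwa [dtBar, hW, hW, natCast_add_one_mul, natCast_sub_one_mul hn]

theorem abs_dtBar_le (h : DerivChain s m M φ) (hm : 1 ≤ m) (hτ : 0 < τ) (hn : 1 ≤ n)
    (hs : ∀ k ≤ n + 1, (k : ℝ) * τ ∈ s) (hW : ∀ k, W k i j = φ 0 (k * τ)) :
    |dtBar τ W n i j| ≤ M := by
  have hdiff := h.abs_image_sub_le hm (hs (n - 1) (by omega)) (hs (n + 1) le_rfl)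
  have htime : ((n + 1 : ℕ) : ℝ) * τ - ((n - 1 : ℕ) : ℝ) * τ = 2 * τ := by
    rw [natCast_add_one_mul, natCast_sub_one_mul hn]; ring
  have hτ2 : 0 < 2 * τ := by positivity
  rw [htime, abs_of_pos hτ2] at hdiff
  rwa [dtBar, hW, hW, abs_div, abs_of_pos hτ2, div_le_iff₀ hτ2]

theorem abs_avg_sub_le (h : DerivChain s m M φ) (hm : 2 ≤ m) (hn : 1 ≤ n)
    (hs : ∀ k ≤ n + 1, (k : ℝ) * τ ∈ s) (hW : ∀ k, W k i j = φ 0 (k * τ)) :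
    |(avg W n - W n) i j| ≤ M * τ ^ 2 := by
  have hdiff := h.abs_second_diff_le hm (hs n (by omega))
    (natCast_add_one_mul n τ ▸ hs (n + 1) le_rfl) (natCast_sub_one_mul hn τ ▸ hs (n - 1) (by omega))
  have havg : (avg W n - W n) i j
      = (φ 0 (n * τ + τ) - 2 * φ 0 (n * τ) + φ 0 (n * τ - τ)) / 2 := by
    rw [Pi.sub_apply, Pi.sub_apply, avg, hW, hW, hW, natCast_add_one_mul, natCast_sub_one_mul hn]
    ring
  rw [havg, abs_div, abs_two, div_le_iff₀ two_pos]
  linarith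

theorem abs_avg_sub_avg_le (h : DerivChain s m M φ) (hm : 3 ≤ m) (hτ : 0 ≤ τ) (hn : 1 ≤ n)
    (hs : ∀ k ≤ n + 2, (k : ℝ) * τ ∈ s) (hW : ∀ k, W k i j = φ 0 (k * τ)) :
    |(avg W n - W n - (avg W (n + 1) - W (n + 1))) i j| ≤ τ * (6 * M * τ ^ 2) := by
  have htwo : ((n + 1 + 1 : ℕ) : ℝ) * τ = n * τ + 2 * τ := by push_cast; ring
  have hdiff := h.abs_third_diff_le hm hτ (hs n (by omega))
    (natCast_add_one_mul n τ ▸ hs (n + 1) (by omega)) (htwo ▸ hs (n + 2) le_rfl)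
    (natCast_sub_one_mul hn τ ▸ hs (n - 1) (by omega))
  have havg : (avg W n - W n - (avg W (n + 1) - W (n + 1))) i j
      = -(φ 0 (n * τ + 2 * τ) - 3 * φ 0 (n * τ + τ) + 3 * φ 0 (n * τ) - φ 0 (n * τ - τ)) / 2 := by
    simp only [Pi.sub_apply, avg, Nat.add_sub_cancel, hW, htwo, natCast_add_one_mul,
      natCast_sub_one_mul hn]
    ring
  rw [havg, abs_div, abs_neg, abs_two, div_le_iff₀ two_pos]
  linarith

end DerivChain

section Compact

variable {J₁ J₂ i j : ℕ} {w : ℕ → ℕ → ℝ} {M c : ℝ}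

theorem abs_average_le {a b d : ℝ} (ha : |a| ≤ c) (hb : |b| ≤ c) (hd : |d| ≤ c) :
    |(a + 10 * b + d) / 12| ≤ c := by
  rw [abs_le] at *
  constructor <;> linarith

theorem opH_apply (w : ℕ → ℕ → ℝ) (h : Interior J₁ J₂ i j) :
    opH J₁ J₂ w i j = (opB J₂ w (i + 1) j + 10 * opB J₂ w i j + opB J₂ w (i - 1) j) / 12 :=
  if_pos h.bounds.1

theorem opB_apply (w : ℕ → ℕ → ℝ) (h : 1 ≤ j ∧ j + 1 ≤ 2 * J₂) :
    opB J₂ w i j = (w i (j + 1) + 10 * w i j + w i (j - 1)) / 12 :=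
  if_pos h

theorem abs_opH_le (h : Interior J₁ J₂ i j) (hw : ∀ i ≤ 2 * J₁, ∀ j ≤ 2 * J₂, |w i j| ≤ c) :
    |opH J₁ J₂ w i j| ≤ c := by
  obtain ⟨⟨hi, hi'⟩, hj⟩ := h.bounds
  have hB : ∀ k ≤ 2 * J₁, |opB J₂ w k j| ≤ c := fun k hk => by
    rw [opB_apply w hj]
    exact abs_average_le (hw k hk _ hj.2) (hw k hk _ (by omega)) (hw k hk _ (by omega))
  rw [opH_apply w h]
  exact abs_average_le (hB _ hi') (hB _ (by omega)) (hB _ (by omega))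

theorem step_neighbours_mem {J k : ℕ} (hk : 1 ≤ k ∧ k + 1 ≤ 2 * J) :
    (k : ℝ) * step J ∈ Icc (0 : ℝ) 1 ∧ (k : ℝ) * step J + step J ∈ Icc (0 : ℝ) 1
      ∧ (k : ℝ) * step J - step J ∈ Icc (0 : ℝ) 1 := by
  have hJ : 1 ≤ J := by omega
  rw [← natCast_add_one_mul, ← natCast_sub_one_mul hk.1]
  exact ⟨mul_step_mem hJ (by omega), mul_step_mem hJ hk.2, mul_step_mem hJ (by omega)⟩

theorem abs_opH_sub_opPhi_le {g : ℝ → ℝ → ℝ} {φ ψ : ℕ → ℝ → ℝ → ℝ} (hφg : φ 0 = g) (hψg : ψ 0 = g)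
    (hφ : ∀ y ∈ Icc (0 : ℝ) 1, DerivChain (Icc 0 1) 6 M (fun k x => φ k x y))
    (hψ : ∀ x ∈ Icc (0 : ℝ) 1, DerivChain (Icc 0 1) 6 M (fun k y => ψ k x y))
    (h : Interior J₁ J₂ i j) :
    |opH J₁ J₂ (onGrid J₁ J₂ fun x y => φ 2 x y + ψ 2 x y) i j
      - opPhi J₁ J₂ (onGrid J₁ J₂ g) i j| ≤ 3 * M * (step J₁ ^ 4 + step J₂ ^ 4) := by
  obtain ⟨hi, hj⟩ := h.bounds
  have h₁ := step_pos (J := J₁) (by omega)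
  have h₂ := step_pos (J := J₂) (by omega)
  obtain ⟨hx, hx', hx''⟩ := step_neighbours_mem hi
  obtain ⟨hy, hy', hy''⟩ := step_neighbours_mem hj
  have hX := fun y hy => (hφ y hy).abs_compact_sub_le le_rfl h₁.ne' hx hx' hx''
  have hY := fun x hx => (hψ x hx).abs_compact_sub_le le_rfl h₂.ne' hy hy' hy''
  have hsum := (abs_add_le _ _).trans (add_le_add
    (abs_average_le (hX _ hy') (hX _ hy) (hX _ hy''))
    (abs_average_le (hY _ hx') (hY _ hx) (hY _ hx'')))
  rw [← mul_add] at hsum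
  refine le_of_eq_of_le (congrArg _ ?_) hsum
  simp only [opH, opPhi, opA, opB, secX, secY, fwdX, bwdX, fwdY, bwdY, onGrid, if_pos hi, if_pos hj,
    hφg, hψg, natCast_add_one_mul, natCast_sub_one_mul hi.1, natCast_sub_one_mul hj.1]
  field_simp [h₁.ne', h₂.ne']
  ring

end Compact

section Truncation

variable {J₁ J₂ N n i j : ℕ} {T M τ B : ℝ} {P : ℝ → ℝ} {f u : ℝ → ℝ → ℝ → ℝ} {u₀ u₁ : ℝ → ℝ → ℝ}

theorem Interior.point_mem (h : Interior J₁ J₂ i j) :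
    (i : ℝ) * step J₁ ∈ Icc (0 : ℝ) 1 ∧ (j : ℝ) * step J₂ ∈ Icc (0 : ℝ) 1 := by
  obtain ⟨hi, hj⟩ := h.bounds
  exact ⟨mul_step_mem (by omega) (by omega),
    mul_step_mem (by omega) (by omega)⟩

theorem IsMesh.time_mem (m : IsMesh T J₁ J₂ N τ) (hn : n ≤ N + 1) : (n : ℝ) * τ ∈ Icc 0 T :=
  ⟨mul_nonneg n.cast_nonneg m.step_pos.le, m.mul_le hn⟩

theorem IsRegular.abs_equation_defect_le (hM : IsRegular T M u)
    (hu : IsPlateSolution P T f u₀ u₁ u) (m : IsMesh T J₁ J₂ N τ) (hn : n ∈ Finset.Icc 1 N)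
    (hB : |P (sqIntegral (lap (u (n * τ))))| ≤ B) (hi : i ≤ 2 * J₁) (hj : j ≤ 2 * J₂) :
    |(dt2 τ (sample J₁ J₂ τ u) n
        + P (sqIntegral (lap (u (n * τ)))) • dtBar τ (sample J₁ J₂ τ u) n
        + onGrid J₁ J₂ (lap (lap (u (n * τ)))) - sample J₁ J₂ τ f n) i j|
      ≤ 2 * M * τ ^ 2 + B * (M * τ ^ 2) := by
  obtain ⟨h1n, hnN⟩ := Finset.mem_Icc.1 hn
  have hx := mul_step_mem m.one_le_fst hi
  have hy := mul_step_mem m.one_le_snd hj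
  have hs : ∀ k ≤ n + 1, (k : ℝ) * τ ∈ Icc 0 T := fun k hk => m.time_mem (by omega)
  have hchain := hM.u_t _ hx _ hy
  have hdt2 := hchain.abs_dt2_sub_le (W := sample J₁ J₂ τ u) (i := i) (j := j) le_rfl m.step_pos h1n
    hs fun _ => rfl
  have hdtBar := hchain.abs_dtBar_sub_le (W := sample J₁ J₂ τ u) (i := i) (j := j) (by norm_num)
    m.step_pos h1n hs fun _ => rfl
  refine (le_of_eq_of_le (congrArg _ ?_) (abs_add_le _ _)).trans (add_le_add hdt2
    ((abs_mul (P (sqIntegral (lap (u (n * τ))))) _).trans_le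
      (mul_le_mul hB hdtBar (abs_nonneg _) ((abs_nonneg _).trans hB))))
  have hequation := hu.equation _ (hs n (by omega)) _ hx _ hy
  simp only [Pi.sub_apply, Pi.add_apply, Pi.smul_apply, smul_eq_mul]
  simp only [sample, onGrid, partialDeriv, Function.iterate_succ, Function.iterate_zero,
    Function.comp_apply, id_eq]
  rw [← hequation]
  ring

theorem IsRegular.abs_residualFst_le (hM : IsRegular T M u) (hu : IsPlateSolution P T f u₀ u₁ u)
    (m : IsMesh T J₁ J₂ N τ) (hn : n ∈ Finset.Icc 1 N)
    (hB : |P (sqIntegral (lap (u (n * τ))))| ≤ B) (h : Interior J₁ J₂ i j) :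
    |residualFst J₁ J₂ τ (fun n => P (sqIntegral (lap (u (n * τ))))) (sample J₁ J₂ τ f)
        (sample J₁ J₂ τ u) (sample J₁ J₂ τ fun t => lap (u t)) n i j|
      ≤ 2 * M * τ ^ 2 + B * (M * τ ^ 2) + 3 * M * (step J₁ ^ 4 + step J₂ ^ 4) := by
  have ht := m.time_mem (n := n) (by have := Finset.mem_Icc.1 hn; omega)
  have hdefect := abs_opH_le (w := dt2 τ (sample J₁ J₂ τ u) n
      + P (sqIntegral (lap (u (n * τ)))) • dtBar τ (sample J₁ J₂ τ u) n
      + onGrid J₁ J₂ (lap (lap (u (n * τ)))) - sample J₁ J₂ τ f n) h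
    fun i hi j hj => hM.abs_equation_defect_le hu m hn hB hi hj
  have hcompact := abs_opH_sub_opPhi_le (g := lap (u (n * τ)))
    (φ := fun k => partialDeriv T 0 k 0 (fun t => lap (u t)) (n * τ))
    (ψ := fun k => partialDeriv T 0 0 k (fun t => lap (u t)) (n * τ))
    rfl rfl (hM.lap_x _ ht) (hM.lap_y _ ht) h
  refine (le_of_eq_of_le (congrArg _ ?_) (abs_sub _ _)).trans (add_le_add hdefect hcompact)
  simp only [opH_eq_stencilH _ h, map_sub, map_add, map_smul, Pi.sub_apply, Pi.add_apply,
    Pi.smul_apply, smul_eq_mul, residualFst]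
  change _ = _ - (stencilH (onGrid J₁ J₂ (lap (lap (u (n * τ))))) i j - opPhi J₁ J₂ _ i j)
  rw [sample]
  ring

theorem IsRegular.abs_residualSnd_le (hM : IsRegular T M u) (m : IsMesh T J₁ J₂ N τ)
    (hn : n ∈ Finset.Icc 1 N) (h : Interior J₁ J₂ i j) :
    |residualSnd J₁ J₂ τ (sample J₁ J₂ τ u) (sample J₁ J₂ τ fun t => lap (u t)) n i j|
      ≤ 3 * M * (step J₁ ^ 4 + step J₂ ^ 4) := by
  obtain ⟨h1n, hnN⟩ := Finset.mem_Icc.1 hn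
  have ht := m.time_mem (n := n + 1) (by omega)
  have ht' := m.time_mem (n := n - 1) (by omega)
  have hquot : ∀ χ : ℕ → ℝ → ℝ, DerivChain (Icc 0 T) 1 M χ →
      |(χ 0 ((n + 1 : ℕ) * τ) - χ 0 ((n - 1 : ℕ) * τ)) / (2 * τ)| ≤ M := fun χ hχ =>
    hχ.abs_dtBar_le (W := fun k _ _ => χ 0 (k * τ)) (i := 0) (j := 0) le_rfl m.step_pos h1n
      (fun k hk => m.time_mem (by omega)) fun _ => rfl
  have hcompact := abs_opH_sub_opPhi_le
    (φ := fun k x y => (partialDeriv T 0 k 0 u ((n + 1 : ℕ) * τ) x y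
      - partialDeriv T 0 k 0 u ((n - 1 : ℕ) * τ) x y) / (2 * τ))
    (ψ := fun k x y => (partialDeriv T 0 0 k u ((n + 1 : ℕ) * τ) x y
      - partialDeriv T 0 0 k u ((n - 1 : ℕ) * τ) x y) / (2 * τ))
    rfl rfl
    (fun y hy => (hM.u_x _ ht y hy).sub_div_const (hM.u_x _ ht' y hy) _
      fun k hk x hx => hquot _ (hM.ux_t k hk x hx y hy))
    (fun x hx => (hM.u_y _ ht x hx).sub_div_const (hM.u_y _ ht' x hx) _
      fun k hk y hy => hquot _ (hM.uy_t k hk x hx y hy)) h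
  refine le_of_eq_of_le (congrArg (fun w => |opH J₁ J₂ w i j - _|) ?_) hcompact
  ext i j
  simp only [← add_div, dtBar, sample, onGrid]
  congr 1
  exact add_sub_add_comm _ _ _ _

end Truncation

section Convergence

variable {J₁ J₂ N n : ℕ} {T M B Q τ : ℝ} {L : NNReal} {P : ℝ → ℝ} {f u : ℝ → ℝ → ℝ → ℝ}
  {u₀ u₁ : ℝ → ℝ → ℝ} {U V : ℕ → ℕ → ℕ → ℝ}

/-- The order `τ² + h₁⁴ + h₂⁴` of the truncation error. -/
def truncationScale (J₁ J₂ : ℕ) (τ : ℝ) : ℝ := τ ^ 2 + (step J₁ ^ 4 + step J₂ ^ 4)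

theorem sq_le_truncationScale (J₁ J₂ : ℕ) (τ : ℝ) : τ ^ 2 ≤ truncationScale J₁ J₂ τ :=
  le_add_of_nonneg_right (by positivity)

theorem step_pow_le_truncationScale (J₁ J₂ : ℕ) (τ : ℝ) :
    step J₁ ^ 4 + step J₂ ^ 4 ≤ truncationScale J₁ J₂ τ :=
  le_add_of_nonneg_left (sq_nonneg τ)

theorem truncationScale_nonneg (J₁ J₂ : ℕ) (τ : ℝ) : 0 ≤ truncationScale J₁ J₂ τ :=
  (sq_nonneg τ).trans (sq_le_truncationScale J₁ J₂ τ)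

theorem truncationScale_le (J₁ J₂ : ℕ) (τ : ℝ) :
    truncationScale J₁ J₂ τ ≤ 2 * (τ ^ 2 + max (step J₁) (step J₂) ^ 4) := by
  have h₁ := pow_le_pow_left₀ (step_nonneg J₁) (le_max_left (step J₁) (step J₂)) 4
  have h₂ := pow_le_pow_left₀ (step_nonneg J₂) (le_max_right (step J₁) (step J₂)) 4
  unfold truncationScale
  linarith [sq_nonneg τ]

theorem IsMesh.step_le (m : IsMesh T J₁ J₂ N τ) : τ ≤ T := by
  simpa only [Nat.cast_one, one_mul] using m.mul_le (n := 1) (by omega)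

theorem IsRegular.nonneg (hM : IsRegular T M u) (hT : 0 < T) : 0 ≤ M :=
  (hM.u_t 0 unitInterval.zero_mem 0 unitInterval.zero_mem).nonneg (left_mem_Icc.2 hT.le)

theorem IsRegular.abs_damping_le (hM : IsRegular T M u) (hL : LipschitzOnWith L P (Ici 0)) {t : ℝ}
    (ht : t ∈ Icc 0 T) : |P (sqIntegral (lap (u t)))| ≤ |P 0| + L * M ^ 2 := by
  have hlip := hL.dist_le_mul _ (sqIntegral_nonneg (lap (u t))) 0 self_mem_Ici
  rw [Real.dist_eq, Real.dist_0_eq_abs, abs_of_nonneg (sqIntegral_nonneg _)] at hlip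
  have hmono := mul_le_mul_of_nonneg_left (hM.sqIntegral_lap_le ht) L.coe_nonneg
  linarith [abs_sub_abs_le_abs_sub (P (sqIntegral (lap (u t)))) (P 0)]

theorem IsRegular.isConsistent (hM : IsRegular T M u) (hT : 0 < T)
    (hu : IsPlateSolution P T f u₀ u₁ u) (m : IsMesh T J₁ J₂ N τ)
    (hB : ∀ t ∈ Icc 0 T, |P (sqIntegral (lap (u t)))| ≤ B) {K : ℝ} (hK : 6 * M + B * M ≤ K) :
    IsConsistent J₁ J₂ N τ K (truncationScale J₁ J₂ τ)
      (fun n => P (sqIntegral (lap (u (n * τ))))) (sample J₁ J₂ τ f) (sample J₁ J₂ τ u)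
      (sample J₁ J₂ τ fun t => lap (u t)) := by
  have hM0 := hM.nonneg hT
  have hBM := mul_nonneg ((abs_nonneg _).trans (hB 0 (left_mem_Icc.2 hT.le))) hM0
  have hτ2 := sq_le_truncationScale J₁ J₂ τ
  have hh4 := step_pow_le_truncationScale J₁ J₂ τ
  have hδ := truncationScale_nonneg J₁ J₂ τ
  have hMτ := mul_le_mul_of_nonneg_left hτ2 hM0
  have hMh := mul_le_mul_of_nonneg_left hh4 hM0
  have hBMδ := mul_nonneg hBM hδ
  have hMδ := mul_nonneg hM0 hδ
  have hKδ := mul_le_mul_of_nonneg_right hK hδ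
  have hlap {i j : ℕ} (h : Interior J₁ J₂ i j) :=
    hM.lap_t _ h.point_mem.1 _ h.point_mem.2
  refine ⟨fun n hn => ?_, fun n hn => ?_, fun n hn i j h => ?_, fun n hn i j h => ?_,
    fun n hn i j h => ?_, fun n hn i j h => ?_, fun n h1n hnN i j h => ?_⟩
  · exact onGrid_mem_zeroTrace m.one_le_fst m.one_le_snd fun x y hxy =>
      (hu.hinged_Icc hT hM (m.time_mem hn) hxy).1
  · exact onGrid_mem_zeroTrace m.one_le_fst m.one_le_snd fun x y hxy =>
      (hu.hinged_Icc hT hM (m.time_mem hn) hxy).2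
  · have hnN := (Finset.mem_Icc.1 hn).2
    have hres := hM.abs_residualFst_le hu m hn (hB _ (m.time_mem (by omega))) h
    linarith [mul_le_mul_of_nonneg_left hτ2 hBM]
  · linarith [hM.abs_residualSnd_le m hn h]
  · obtain ⟨h1n, hnN⟩ := Finset.mem_Icc.1 hn
    refine (abs_opH_le h fun i hi j hj => ?_).trans (show M ≤ _ by linarith)
    exact (hM.u_t _ (mul_step_mem m.one_le_fst hi) _ (mul_step_mem m.one_le_snd hj)).abs_dtBar_le
      (by norm_num) m.step_pos h1n (fun k hk => m.time_mem (by omega)) fun _ => rfl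
  · obtain ⟨h1n, hnN⟩ := Finset.mem_Icc.1 hn
    refine ((hlap h).abs_avg_sub_le (by norm_num) h1n (fun k hk => m.time_mem (by omega))
      fun _ => rfl).trans ?_
    linarith
  · refine ((hlap h).abs_avg_sub_avg_le le_rfl m.step_pos.le h1n
      (fun k hk => m.time_mem (by omega)) fun _ => rfl).trans
      (mul_le_mul_of_nonneg_left ?_ m.step_pos.le)
    linarith

theorem IsSchemeSolution.gridNorm_dt_one_sub_le (h : IsSchemeSolution P f u₀ u₁ J₁ J₂ N τ U V)
    (hT : 0 < T) (hu : IsPlateSolution P T f u₀ u₁ u) (hM : IsRegular T M u)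
    (m : IsMesh T J₁ J₂ N τ) : gridNorm J₁ J₂ (dt τ (sample J₁ J₂ τ u - U) 1) ≤ M * τ ^ 2 := by
  have hM0 := hM.nonneg hT
  refine gridNorm_le_of_abs_le m.one_le_fst m.one_le_snd (by positivity) fun i j hij => ?_
  obtain ⟨hx, hy⟩ := hij.point_mem
  have htaylor := (hM.u_t _ hx _ hy).abs_forward_quot_sub_le (by norm_num) m.step_pos
    (left_mem_Icc.2 hT.le) (by rw [zero_add]; exact ⟨m.step_pos.le, m.step_le⟩)
  rw [dt_sub, Pi.sub_apply, Pi.sub_apply, Pi.sub_apply, h.initU1 i hij.1 j hij.2, onGrid, onGrid,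
    hu.secondInit_eq hT _ hx _ hy, ← hu.init_deriv _ hx _ hy]
  refine le_of_eq_of_le (congrArg _ (congrArg₂ _ ?_ rfl)) htaylor
  simp only [dt, sample, onGrid, Nat.sub_self, Nat.cast_one, Nat.cast_zero, one_mul, zero_mul,
    zero_add, partialDeriv, Function.iterate_zero, id_eq]

theorem IsSchemeSolution.gridNorm_lap_one_sub_le (h : IsSchemeSolution P f u₀ u₁ J₁ J₂ N τ U V)
    (hT : 0 < T) (hu : IsPlateSolution P T f u₀ u₁ u) (hS : SolutionBounds T Q u)
    (hM : IsRegular T M u) (m : IsMesh T J₁ J₂ N τ) :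
    gridNorm J₁ J₂ (sample J₁ J₂ τ (fun t => lap (u t)) 1 - V 1) ≤ M * T * τ ^ 2 := by
  have hM0 := hM.nonneg hT
  refine gridNorm_le_of_abs_le m.one_le_fst m.one_le_snd (by positivity) fun i j hij => ?_
  obtain ⟨hx, hy⟩ := hij.point_mem
  rw [Pi.sub_apply, Pi.sub_apply, h.initV1 i hij.1 j hij.2, sample, Nat.cast_one, one_mul]
  calc _ ≤ M * τ ^ 3 := hM.abs_lap_sub_lap_firstStep_le hT hu hS ⟨m.step_pos.le, m.step_le⟩ hx hy
    _ = M * τ * τ ^ 2 := by ring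
    _ ≤ M * T * τ ^ 2 := by gcongr; exact m.step_le

theorem IsSchemeSolution.gridNorm_lap_zero_sub_eq (h : IsSchemeSolution P f u₀ u₁ J₁ J₂ N τ U V)
    (hu : IsPlateSolution P T f u₀ u₁ u) (m : IsMesh T J₁ J₂ N τ) :
    gridNorm J₁ J₂ (sample J₁ J₂ τ (fun t => lap (u t)) 0 - V 0) = 0 := by
  refine (gridNorm_le_of_abs_le m.one_le_fst m.one_le_snd le_rfl fun i j hij => ?_).antisymm
    (gridNorm_nonneg _)
  obtain ⟨hx, hy⟩ := hij.point_mem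
  rw [Pi.sub_apply, Pi.sub_apply, h.initV0 i hij.1 j hij.2, sample, Nat.cast_zero, zero_mul, onGrid,
    onGrid, lap_congr hu.init _ hx _ hy, sub_self, abs_zero]

theorem gridNorm_le_add_gridNorm_sub (w z : ℕ → ℕ → ℝ) :
    gridNorm J₁ J₂ z ≤ gridNorm J₁ J₂ w + gridNorm J₁ J₂ (w - z) := by
  simpa only [sub_sub_cancel] using gridNorm_sub_le (J₁ := J₁) (J₂ := J₂) w (w - z)

theorem IsRegular.gridNorm_lap_le (hM : IsRegular T M u) (hT : 0 < T) (m : IsMesh T J₁ J₂ N τ)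
    (hn : n ≤ N + 1) : gridNorm J₁ J₂ (sample J₁ J₂ τ (fun t => lap (u t)) n) ≤ M :=
  gridNorm_le_of_abs_le m.one_le_fst m.one_le_snd (hM.nonneg hT) fun _ _ hij =>
    (hM.lap_t _ hij.point_mem.1 _ hij.point_mem.2).bound 0 (by norm_num) _ (m.time_mem hn)

theorem IsRegular.gridNorm_dt_one_le (hM : IsRegular T M u) (hT : 0 < T)
    (m : IsMesh T J₁ J₂ N τ) : gridNorm J₁ J₂ (dt τ (sample J₁ J₂ τ u) 1) ≤ M := by
  refine gridNorm_le_of_abs_le m.one_le_fst m.one_le_snd (hM.nonneg hT) fun i j hij => ?_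
  have hdiff := (hM.u_t _ hij.point_mem.1 _ hij.point_mem.2).abs_image_sub_le (by norm_num)
    (m.time_mem (n := 0) (by omega)) (m.time_mem (n := 1) (by omega))
  rw [Nat.cast_one, Nat.cast_zero, one_mul, zero_mul, sub_zero, abs_of_pos m.step_pos] at hdiff
  rw [dt, abs_div, abs_of_pos m.step_pos, div_le_iff₀ m.step_pos, Nat.sub_self, sample, sample,
    Nat.cast_one, Nat.cast_zero, one_mul, zero_mul]
  exact hdiff

theorem IsPlateSolution.abs_source_le (hu : IsPlateSolution P T f u₀ u₁ u) (hM : IsRegular T M u)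
    {t x y : ℝ} (ht : t ∈ Icc 0 T) (hB : |P (sqIntegral (lap (u t)))| ≤ B)
    (hx : x ∈ Icc (0 : ℝ) 1) (hy : y ∈ Icc (0 : ℝ) 1) : |f t x y| ≤ (3 + B) * M := by
  have hut := (hM.u_t x hx y hy).bound 1 (by norm_num) t ht
  have hutt := (hM.u_t x hx y hy).bound 2 (by norm_num) t ht
  have hdamp := mul_le_mul hB hut (abs_nonneg _) ((abs_nonneg _).trans hB)
  rw [← abs_mul] at hdamp
  rw [← hu.equation t ht x hx y hy]
  calc _ ≤ M + B * M + 2 * M := (abs_add_three _ _ _).trans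
          (add_le_add (add_le_add hutt hdamp) (hM.abs_lap_lap_le ht hx hy))
    _ = (3 + B) * M := by ring

theorem IsSchemeSolution.gridNorm_initial_le (h : IsSchemeSolution P f u₀ u₁ J₁ J₂ N τ U V)
    (hT : 0 < T) (hu : IsPlateSolution P T f u₀ u₁ u) (hS : SolutionBounds T Q u)
    (hM : IsRegular T M u) (m : IsMesh T J₁ J₂ N τ) :
    gridNorm J₁ J₂ (dt τ U 1) ≤ M + M * T ^ 2 ∧ gridNorm J₁ J₂ (V 1) ≤ M + M * T ^ 3 ∧
      gridNorm J₁ J₂ (V 0) ≤ M := by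
  have hM0 := hM.nonneg hT
  have hτT : τ ^ 2 ≤ T ^ 2 := pow_le_pow_left₀ m.step_pos.le m.step_le 2
  have hMT2 := mul_le_mul_of_nonneg_left hτT hM0
  have hMT3 := mul_le_mul_of_nonneg_left hτT (mul_nonneg hM0 hT.le)
  have hU := gridNorm_le_add_gridNorm_sub (J₁ := J₁) (J₂ := J₂) (dt τ (sample J₁ J₂ τ u) 1)
    (dt τ U 1)
  have hV (n : ℕ) := gridNorm_le_add_gridNorm_sub (J₁ := J₁) (J₂ := J₂)
    (sample J₁ J₂ τ (fun t => lap (u t)) n) (V n)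
  rw [← Pi.sub_apply, ← dt_sub] at hU
  refine ⟨?_, ?_, ?_⟩
  · linarith [hM.gridNorm_dt_one_le hT m, h.gridNorm_dt_one_sub_le hT hu hM m]
  · linarith [hV 1, hM.gridNorm_lap_le hT m (n := 1) (by omega),
      h.gridNorm_lap_one_sub_le hT hu hS hM m]
  · linarith [hV 0, hM.gridNorm_lap_le hT m (n := 0) (by omega), h.gridNorm_lap_zero_sub_eq hu m]

theorem IsPlateSolution.gridNorm_opH_source_le (hu : IsPlateSolution P T f u₀ u₁ u) (hT : 0 < T)
    (hM : IsRegular T M u) (m : IsMesh T J₁ J₂ N τ) (hn : n ≤ N)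
    (hB : |P (sqIntegral (lap (u (n * τ))))| ≤ B) :
    gridNorm J₁ J₂ (opH J₁ J₂ (sample J₁ J₂ τ f n)) ≤ (3 + B) * M := by
  have hM0 := hM.nonneg hT
  have hB0 := (abs_nonneg _).trans hB
  refine gridNorm_le_of_abs_le m.one_le_fst m.one_le_snd (by positivity) fun i j hij =>
    abs_opH_le hij fun i hi j hj => ?_
  exact hu.abs_source_le hM (m.time_mem (by omega)) hB (mul_step_mem m.one_le_fst hi)
    (mul_step_mem m.one_le_snd hj)

/-- The a priori bound of `‖Vⁿ‖` for solutions of the scheme, in terms of the bounds `M` of the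
derivatives of `u` and `B` of the damping. -/
def aprioriBound (T M B : ℝ) : ℝ := stabilityConst ((3 + B) * M + M * T ^ 2 + M * T ^ 3) T

theorem aprioriBound_pos {T M B : ℝ} (hT : 0 ≤ T) (hM : 0 ≤ M) (hB : 0 ≤ B) :
    0 < aprioriBound T M B :=
  stabilityConst_pos (by positivity) T

theorem IsSchemeSolution.gridNorm_le_aprioriBound (h : IsSchemeSolution P f u₀ u₁ J₁ J₂ N τ U V)
    (hP : ∀ z, 0 ≤ z → 0 ≤ P z) (hT : 0 < T) (hu : IsPlateSolution P T f u₀ u₁ u)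
    (hS : SolutionBounds T Q u) (hM : IsRegular T M u) (m : IsMesh T J₁ J₂ N τ)
    (hB : ∀ t ∈ Icc 0 T, |P (sqIntegral (lap (u t)))| ≤ B) (hn : n ≤ N) :
    gridNorm J₁ J₂ (V n) ≤ aprioriBound T M B := by
  set K := (3 + B) * M + M * T ^ 2 + M * T ^ 3
  have hM0 := hM.nonneg hT
  have hB0 := (abs_nonneg _).trans (hB 0 (left_mem_Icc.2 hT.le))
  have hBM : 0 ≤ B * M := by positivity
  have hMT2 : 0 ≤ M * T ^ 2 := by positivity
  have hMT3 : 0 ≤ M * T ^ 3 := by positivity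
  have hK : 0 ≤ K := by positivity
  have hzero : gridNorm J₁ J₂ (0 : ℕ → ℕ → ℝ) = 0 := by
    simpa using gridNorm_smul (J₁ := J₁) (J₂ := J₂) 0 0
  obtain ⟨hU₁, hV₁, hV₀⟩ := h.gridNorm_initial_le hT hu hS hM m
  refine (h.isDampedSolution.stability m hK zero_le_one (fun k _ => hP _ (sq_nonneg _))
    (by linarith) (by linarith) (by linarith) (fun k _ => ?_) (fun k _ => ?_)
    (fun k hk => ?_) hn).2.2.trans_eq (mul_one _)
  · rwa [Pi.zero_apply, hzero, mul_one]
  · rw [Pi.zero_apply, Pi.zero_apply, sub_self, hzero, mul_one]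
    exact mul_nonneg m.step_pos.le hK
  · have hkN := (Finset.mem_Icc.1 hk).2
    have hsource := hu.gridNorm_opH_source_le hT hM m hkN (hB _ (m.time_mem (by omega)))
    rw [Pi.zero_apply, hzero, mul_add, mul_one]
    linarith [mul_nonneg hK (gridNorm_nonneg (J₁ := J₁) (J₂ := J₂) (V k))]

theorem IsSchemeSolution.abs_damping_sub_le (h : IsSchemeSolution P f u₀ u₁ J₁ J₂ N τ U V)
    (hL : LipschitzOnWith L P (Ici 0)) (hT : 0 < T) (hu : IsPlateSolution P T f u₀ u₁ u)
    (hM : IsRegular T M u) (m : IsMesh T J₁ J₂ N τ) {R : ℝ} (hn : n ≤ N)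
    (hR : gridNorm J₁ J₂ (V n) ≤ R) :
    |P (sqIntegral (lap (u (n * τ)))) - P (normF J₁ J₂ (V n) ^ 2)|
      ≤ L * (32 * M ^ 2 * truncationScale J₁ J₂ τ
        + 2 * (M + R) * gridNorm J₁ J₂ (sample J₁ J₂ τ (fun t => lap (u t)) n - V n)) := by
  set v := sample J₁ J₂ τ fun t => lap (u t)
  have ht := m.time_mem (n := n) (by omega)
  have hbd x y (hxy : OnBoundary x y) : lap (u (n * τ)) x y = 0 := (hu.hinged_Icc hT hM ht hxy).2
  have hsimpson := (hM.abs_sqIntegral_sub_normF_sq_le ht hbd m.one_le_fst m.one_le_snd).trans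
    (mul_le_mul_of_nonneg_left (step_pow_le_truncationScale J₁ J₂ τ) (by positivity))
  have hnorm := abs_normF_sq_sub_le (onGrid_mem_zeroTrace m.one_le_fst m.one_le_snd hbd)
    (h.isDampedSolution.trace_snd n (by omega))
  have hsum := mul_le_mul_of_nonneg_left (add_le_add (hM.gridNorm_lap_le hT m (n := n) (by omega))
    hR) (gridNorm_nonneg (J₁ := J₁) (J₂ := J₂) (v n - V n))
  refine (hL.dist_le_mul _ (sqIntegral_nonneg _) _ (mem_Ici.2 (sq_nonneg _))).trans
    (mul_le_mul_of_nonneg_left ?_ L.coe_nonneg)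
  refine (abs_sub_le _ (normF J₁ J₂ (v n) ^ 2) _).trans (add_le_add hsimpson (hnorm.trans ?_))
  exact (mul_le_mul_of_nonneg_left hsum two_pos.le).trans_eq (by ring)

/-- The constant of the consistency estimates, of the initial errors and of the perturbation of the
damping, in terms of the bound `M` of the derivatives of `u`, the bound `B` and the Lipschitz
constant `L` of the damping, and the bound `R` of `‖Vⁿ‖`. -/
def consistencyConst (T M B L R : ℝ) : ℝ :=
  6 * M + B * M + M * T + L * (32 * M ^ 2 + 2 * (M + R))

/-- The constant of the stability estimate for the error, in terms of the data of
`consistencyConst`. -/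
def errorConst (T M B L R : ℝ) : ℝ :=
  stabilityConst (2 * consistencyConst T M B L R + consistencyConst T M B L R ^ 2) T

theorem errorConst_pos {T M B L R : ℝ} (hT : 0 ≤ T) (hM : 0 ≤ M) (hB : 0 ≤ B) (hL : 0 ≤ L)
    (hR : 0 ≤ R) : 0 < errorConst T M B L R :=
  stabilityConst_pos (by unfold consistencyConst; positivity) T

theorem IsSchemeSolution.error_le (h : IsSchemeSolution P f u₀ u₁ J₁ J₂ N τ U V)
    (hP : ∀ z, 0 ≤ z → 0 ≤ P z) (hL : LipschitzOnWith L P (Ici 0)) (hT : 0 < T)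
    (hu : IsPlateSolution P T f u₀ u₁ u) (hS : SolutionBounds T Q u) (hM : IsRegular T M u)
    (m : IsMesh T J₁ J₂ N τ) (hB : ∀ t ∈ Icc 0 T, |P (sqIntegral (lap (u t)))| ≤ B) {R : ℝ}
    (hR₀ : 0 ≤ R) (hR : ∀ n ≤ N, gridNorm J₁ J₂ (V n) ≤ R) (hn : n ∈ Finset.Icc 1 N) :
    gridNorm J₁ J₂ (dt τ (sample J₁ J₂ τ u - U) (n + 1))
        ≤ errorConst T M B L R * truncationScale J₁ J₂ τ ∧
      gridNorm J₁ J₂ (sample J₁ J₂ τ (fun t => lap (u t)) (n + 1) - V (n + 1))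
        ≤ errorConst T M B L R * truncationScale J₁ J₂ τ ∧
      gridNorm J₁ J₂ (sample J₁ J₂ τ (fun t => lap (u t)) n - V n)
        ≤ errorConst T M B L R * truncationScale J₁ J₂ τ := by
  have hδ := truncationScale_nonneg J₁ J₂ τ
  have hτ2 := sq_le_truncationScale J₁ J₂ τ
  have hM0 := hM.nonneg hT
  have hBM := mul_nonneg ((abs_nonneg _).trans (hB 0 (left_mem_Icc.2 hT.le))) hM0
  have hMT := mul_nonneg hM0 hT.le
  have hLM : 0 ≤ L * (32 * M ^ 2) := by positivity
  have hLR : 0 ≤ L * (2 * (M + R)) := by positivity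
  set K := consistencyConst T M B L R with hKdef
  rw [consistencyConst] at hKdef
  have hK : 0 ≤ K := by linarith
  have hMτ : M * τ ^ 2 ≤ K * truncationScale J₁ J₂ τ :=
    mul_le_mul (by linarith) hτ2 (sq_nonneg τ) hK
  have hMTτ : M * T * τ ^ 2 ≤ K * truncationScale J₁ J₂ τ :=
    mul_le_mul (by linarith) hτ2 (sq_nonneg τ) hK
  refine (hM.isConsistent hT hu m hB (by linarith)).error_le m h.isDampedSolution hK hδ
    (fun _ _ => hP _ (sq_nonneg _)) (fun k hk => ?_)
    ((h.gridNorm_dt_one_sub_le hT hu hM m).trans hMτ)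
    ((h.gridNorm_lap_one_sub_le hT hu hS hM m).trans hMTτ)
    ((h.gridNorm_lap_zero_sub_eq hu m).trans_le (mul_nonneg hK hδ)) hn
  have hkN := (Finset.mem_Icc.1 hk).2
  set r := gridNorm J₁ J₂ (sample J₁ J₂ τ (fun t => lap (u t)) k - V k)
  have hr : 0 ≤ r := gridNorm_nonneg _
  calc _ ≤ L * (32 * M ^ 2 * truncationScale J₁ J₂ τ + 2 * (M + R) * r) :=
        h.abs_damping_sub_le hL hT hu hM m hkN (hR k hkN)
    _ = L * (32 * M ^ 2) * truncationScale J₁ J₂ τ + L * (2 * (M + R)) * r := by ring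
    _ ≤ K * truncationScale J₁ J₂ τ + K * r :=
        add_le_add (mul_le_mul_of_nonneg_right (by linarith) hδ)
          (mul_le_mul_of_nonneg_right (by linarith) hr)
    _ = K * (truncationScale J₁ J₂ τ + r) := (mul_add _ _ _).symm

theorem sqrt_add_sq_add_sq_le {a b c s : ℝ} (ha₀ : 0 ≤ a) (hb₀ : 0 ≤ b) (hc₀ : 0 ≤ c) (ha : a ≤ s)
    (hb : b ≤ s) (hc : c ≤ s) : √(a ^ 2 + b ^ 2 + c ^ 2) ≤ 2 * s := by
  refine Real.sqrt_le_iff.2 ⟨by linarith, ?_⟩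
  linarith [pow_le_pow_left₀ ha₀ ha 2, pow_le_pow_left₀ hb₀ hb 2, pow_le_pow_left₀ hc₀ hc 2,
    mul_pow 2 s 2, sq_nonneg s]

end Convergence

theorem DampingBounds.nonneg {P : ℝ → ℝ} {p₀ p₁ z₀ z : ℝ} (h : DampingBounds P p₀ p₁ z₀)
    (hz : 0 ≤ z) : 0 ≤ P z :=
  h.1.le.trans (h.2.2.2.2 z hz)

theorem DampingSlope.lipschitzOnWith {P : ℝ → ℝ} {L : ℝ} (h : DampingSlope P L) :
    LipschitzOnWith L.toNNReal P (Ici 0) :=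
  (convex_Ici 0).lipschitzOnWith_of_nnnorm_derivWithin_le (h.1.differentiableOn one_ne_zero)
    fun z hz => by
      rw [← norm_toNNReal, Real.norm_of_nonneg (h.2 z hz).1]
      exact Real.toNNReal_le_toNNReal (h.2 z hz).2
end

end PlateScheme

open PlateScheme in
theorem theorem4p2_general
    (P : ℝ → ℝ) (L : NNReal) (hP : ∀ z, 0 ≤ z → 0 ≤ P z) (hL : LipschitzOnWith L P (Ici 0))
    (T : ℝ) (hT : 0 < T)
    (f : ℝ → ℝ → ℝ → ℝ) (u₀ u₁ : ℝ → ℝ → ℝ) (u : ℝ → ℝ → ℝ → ℝ)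
    (hu : IsPlateSolution P T f u₀ u₁ u)
    (Q : ℝ) (hA4 : SolutionBounds T Q u) (hC : CompactBounds T Q u) :
    ∃ C : ℝ, 0 < C ∧
      ∀ (J₁ J₂ N : ℕ) (τ : ℝ), 1 ≤ J₁ → 1 ≤ J₂ → 0 < τ → ((N : ℝ) + 1) * τ ≤ T →
      ∀ U V : ℕ → ℕ → ℕ → ℝ, IsSchemeSolution P f u₀ u₁ J₁ J₂ N τ U V →
      ∀ n : ℕ, 1 ≤ n → n ≤ N →
        √(gridNorm J₁ J₂ (dt τ (sample J₁ J₂ τ u - U) (n + 1)) ^ 2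
            + gridNorm J₁ J₂ (sample J₁ J₂ τ (fun t => lap (u t)) (n + 1) - V (n + 1)) ^ 2
            + gridNorm J₁ J₂ (sample J₁ J₂ τ (fun t => lap (u t)) n - V n) ^ 2)
          ≤ C * (τ ^ 2 + max (step J₁) (step J₂) ^ 4) := by
  obtain ⟨M, hM⟩ := exists_isRegular hT hA4 hC
  set B := |P 0| + L * M ^ 2
  have hB : ∀ t ∈ Icc 0 T, |P (sqIntegral (lap (u t)))| ≤ B :=
    fun t ht => hM.abs_damping_le hL ht
  have hM₀ := hM.nonneg hT
  set R := aprioriBound T M B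
  have hR₀ : 0 ≤ R := (aprioriBound_pos hT.le hM₀ (by positivity)).le
  have hpos : 0 < errorConst T M B L R :=
    errorConst_pos hT.le hM₀ (by positivity) L.coe_nonneg hR₀
  refine ⟨4 * errorConst T M B L R, by positivity,
    fun J₁ J₂ N τ h₁ h₂ hτ hNτ U V h n h1n hnN => ?_⟩
  have m : IsMesh T J₁ J₂ N τ := ⟨h₁, h₂, hτ, hNτ⟩
  have hR : ∀ n ≤ N, gridNorm J₁ J₂ (V n) ≤ R :=
    fun n hn => h.gridNorm_le_aprioriBound hP hT hu hA4 hM m hB hn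
  obtain ⟨he, hη, hη'⟩ :=
    h.error_le hP hL hT hu hA4 hM m hB hR₀ hR (Finset.mem_Icc.2 ⟨h1n, hnN⟩)
  have hscale := mul_le_mul_of_nonneg_left (truncationScale_le J₁ J₂ τ) hpos.le
  linarith [sqrt_add_sq_add_sq_le (gridNorm_nonneg _) (gridNorm_nonneg _) (gridNorm_nonneg _)
    he hη hη']

theorem theorem4p2
    (P : ℝ → ℝ) (p₀ p₁ z₀ L : ℝ)
    (hA1 : PlateScheme.DampingBounds P p₀ p₁ z₀)
    (hA2 : PlateScheme.DampingSlope P L)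
    (T : ℝ) (hT : 0 < T)
    (f : ℝ → ℝ → ℝ → ℝ) (u₀ u₁ : ℝ → ℝ → ℝ) (u : ℝ → ℝ → ℝ → ℝ)
    (hu : PlateScheme.IsPlateSolution P T f u₀ u₁ u)
    (Q : ℝ)
    (hA4 : PlateScheme.SolutionBounds T Q u)
    (hC : PlateScheme.CompactBounds T Q u) :
    ∃ C : ℝ, 0 < C ∧
      ∀ (J₁ J₂ N : ℕ) (τ : ℝ), 1 ≤ J₁ → 1 ≤ J₂ → 1 ≤ N → 0 < τ → ((N : ℝ) + 1) * τ ≤ T →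
      ∀ U V : ℕ → ℕ → ℕ → ℝ, PlateScheme.IsSchemeSolution P f u₀ u₁ J₁ J₂ N τ U V →
      ∀ n : ℕ, 1 ≤ n → n ≤ N →
        √(PlateScheme.gridNorm J₁ J₂
              (PlateScheme.dt τ (PlateScheme.sample J₁ J₂ τ u - U) (n + 1)) ^ 2
            + PlateScheme.gridNorm J₁ J₂
              (PlateScheme.sample J₁ J₂ τ (fun t => PlateScheme.lap (u t)) (n + 1)
                - V (n + 1)) ^ 2
            + PlateScheme.gridNorm J₁ J₂
              (PlateScheme.sample J₁ J₂ τ (fun t => PlateScheme.lap (u t)) n - V n) ^ 2)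
          ≤ C * (τ ^ 2 + max (PlateScheme.step J₁) (PlateScheme.step J₂) ^ 4) :=
  let ⟨C, hC₀, hle⟩ := theorem4p2_general P L.toNNReal (fun _ => hA1.nonneg) hA2.lipschitzOnWith T
    hT f u₀ u₁ u hu Q hA4 hC
  ⟨C, hC₀, fun J₁ J₂ N τ h₁ h₂ _ => hle J₁ J₂ N τ h₁ h₂⟩
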